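/- Let $p\ge 2$ and let $Y_1,Y_2,\dots$ be i.i.d. random vectors in $\mathbb R^p$. Put $U_i=\|Y_i\|$, $V_i=Y_i/\|Y_i\|$, let $\omega_{p-1}(\mathrm dv)$ be the area element of the unit sphere $\mathbb S^{p-1}$, $\mathbb R^+=(0,\infty)$, $\omega_{p-1}=2\pi^{p/2}/\Gamma(p/2)$ and $\omega_{p-2}=2\pi^{(p-1)/2}/\Gamma((p-1)/2)$. Assume that $(U_i,V_i)$ has a density $f\ge 0$ with respect to $\mathrm du\,\omega_{p-1}(\mathrm dv)$ on $\mathbb R^+\times\mathbb S^{p-1}$, and set $$\mathcal M^2=\min_{g}\int_{\mathbb R^+}\int_{\mathbb S^{p-1}}\big(f(u,v)-\omega_{p-1}^{-1}g(u)\big)^2\,\omega_{p-1}(\mathrm dv)\,\mathrm du ,$$ the minimum being over all probability densities $g$ on $\mathbb R^+$. Assume: 1. $K$ is a symmetric probability density on $\mathbb R$, zero outside $(-1,1)$, with $\int K^4<\infty$; and $L(\kappa t)=\kappa^{p/2-1}\{(2\pi)^{p/2}\mathcal I_{p/2-1}(\kappa)\}^{-1}e^{\kappa t}$, where $\mathcal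 I_\nu(\kappa)=\frac{(\kappa/2)^\nu}{\Gamma(\nu+1/2)\Gamma(1/2)}\int_{-1}^1e^{\kappa t}(1-t^2)^{\nu-1/2}\,\mathrm dt$. 2. $f$ is twice differentiable on $\mathbb R^+\times\mathbb S^{p-1}$. With $D_f^2(u,v)$ denoting the Hessian at $y=v$ of $y\mapsto f(u,y/\|y\|)$, the function $v\mapsto D_f^2(u,v)$ is uniformly continuous on $\mathbb S^{p-1}$ with a modulus of continuity that does not depend on $u$, and $u\mapsto\partial^2f(u,v)/\partial u^2$ is uniformly continuous on $\mathbb R^+$ with a modulus of continuity that does not depend on $v$. Moreover $\lim_{u\downarrow0}f(u,v)$ exists for each $v$ and is the same real number for all $v\in\mathbb S^{p-1}$. 3. The bandwidths $h=h_n>0$ and $\kappa=\kappa_n$ satisfy, as $n\to\infty$, $\kappa\to\infty$, $h\to0$, $\kappa^{(p-1)/2}/(nh)\to0$ and $\sqrt n/\kappa+\sqrt n\,h^2\to0$. 4. The distribution is not spherically symmetric, that is, $\mathcal M^2>0$. Let $c_1(\kappa)=\omega_{p-2}\int_0^\pi L(\kappa\cos\theta)(\sin\theta)^{p-2}\,\mathrm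 d\theta$ and $$\hat{\mathcal M}_n^2=\frac1{n(n-1)h}\sum_{i\ne j\le n}K\Big(\frac{U_i-U_j}h\Big)\Big\{\frac{L(\kappa V_i^\top V_j)}{c_1(\kappa)}-\frac1{\omega_{p-1}}\Big\}.$$ Let $\hat{\mathcal M}_{n-1}^2(-i)$ be the same statistic (with the same $h,\kappa$) computed from the $n-1$ observations other than $Y_i$, let $\tilde{\mathcal M}_i^2=n\hat{\mathcal M}_n^2-(n-1)\hat{\mathcal M}_{n-1}^2(-i)$ and $\bar{\mathcal M}_n^2=n^{-1}\sum_{i=1}^n\tilde{\mathcal M}_i^2$, and let $$\hat\sigma_n^2=\frac1{4(n-1)}\sum_{i=1}^n\big(\tilde{\mathcal M}_i^2-\bar{\mathcal M}_n^2\big)^2 .$$ Let $0<\alpha<1$ and let $u_{1-\alpha/2}$ be the $(1-\alpha/2)$-quantile of the standard normal distribution. Then the interval $$\hat I_n=\Big[\hat{\mathcal M}_n^2-\frac{2\hat\sigma_n}{\sqrt n}u_{1-\alpha/2},\ \hat{\mathcal M}_n^2+\frac{2\hat\sigma_n}{\sqrt n}u_{1-\alpha/2}\Big]$$ satisfies $\lim_{n\to\infty}\mathbb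 P(\mathcal M^2\in\hat I_n)=1-\alpha$. -/

import Mathlib

open MeasureTheory ProbabilityTheory Filter Topology Set

noncomputable section

/-- `2 π^{m/2} / Γ(m/2)`, the area of the unit sphere of `ℝ^m`; thus `ω_{p-1}` is `unitSphereArea p`
and `ω_{p-2}` is `unitSphereArea (p - 1)`. -/
def unitSphereArea (m : ℝ) : ℝ := 2 * Real.pi ^ (m / 2) / Real.Gamma (m / 2)

/-- The area element `ω_{p-1}(dv)` of the unit sphere of `ℝ^p`, as a measure on `ℝ^p`. -/
def surfaceMeasure (p : ℕ) : Measure (EuclideanSpace ℝ (Fin p)) :=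
  ((volume : Measure (EuclideanSpace ℝ (Fin p))).toSphere).map Subtype.val

/-- The measure `du ω_{p-1}(dv)` on `ℝ⁺ × S^{p-1}`. -/
def polarMeasure (p : ℕ) : Measure (ℝ × EuclideanSpace ℝ (Fin p)) :=
  ((volume : Measure ℝ).restrict (Ioi 0)).prod (surfaceMeasure p)

/-- The direction `y / ‖y‖`. -/
def direction {p : ℕ} (y : EuclideanSpace ℝ (Fin p)) : EuclideanSpace ℝ (Fin p) := ‖y‖⁻¹ • y

/-- `f` is the joint density of the radius `‖Y‖` and the direction `Y / ‖Y‖`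
with respect to `du ω_{p-1}(dv)`. Only the values of `f` on `ℝ⁺ × S^{p-1}` matter. -/
structure HasPolarDensity {Ω : Type*} [MeasurableSpace Ω] (P : Measure Ω) {p : ℕ}
    (Y : Ω → EuclideanSpace ℝ (Fin p)) (f : ℝ → EuclideanSpace ℝ (Fin p) → ℝ) : Prop where
  nonneg : ∀ u > 0, ∀ v, ‖v‖ = 1 → 0 ≤ f u v
  law : P.map (fun ω => (‖Y ω‖, direction (Y ω))) =
    (polarMeasure p).withDensity (fun x => ENNReal.ofReal (f x.1 x.2))

/-- `g` is a probability density on `ℝ⁺`. -/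
structure IsRadialDensity (g : ℝ → ℝ) : Prop where
  measurable : Measurable g
  nonneg : ∀ u > 0, 0 ≤ g u
  lintegral_eq_one : ∫⁻ u in Ioi 0, ENNReal.ofReal (g u) = 1

/-- The measure of deviation `ℳ²`: the minimum over all densities `g` on `ℝ⁺` of
`∫∫ (f(u,v) - g(u) / ω_{p-1})² du ω_{p-1}(dv)`. -/
def sphericityDeviation {p : ℕ} (f : ℝ → EuclideanSpace ℝ (Fin p) → ℝ) : ℝ :=
  (⨅ (g : ℝ → ℝ) (_ : IsRadialDensity g),
    ∫⁻ x, ENNReal.ofReal ((f x.1 x.2 - g x.1 * (unitSphereArea p)⁻¹) ^ 2) ∂(polarMeasure p)).toReal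

/-- The modified Bessel function of the first kind of order `ν`. -/
def besselI (ν κ : ℝ) : ℝ :=
  (κ / 2) ^ ν / (Real.Gamma (ν + 1 / 2) * Real.Gamma (1 / 2)) *
    ∫ t in (-1 : ℝ)..1, Real.exp (κ * t) * (1 - t ^ 2) ^ (ν - 1 / 2)

/-- The Langevin (Fisher-von Mises) kernel `L(κ t)` in dimension `p`. -/
def langevin (p : ℕ) (κ t : ℝ) : ℝ :=
  κ ^ ((p : ℝ) / 2 - 1) * ((2 * Real.pi) ^ ((p : ℝ) / 2) * besselI ((p : ℝ) / 2 - 1) κ)⁻¹ *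
    Real.exp (κ * t)

/-- `c₁(κ) = ω_{p-2} ∫₀^π L(κ cos θ) (sin θ)^{p-2} dθ`. -/
def langevinConst (p : ℕ) (κ : ℝ) : ℝ :=
  unitSphereArea ((p : ℝ) - 1) *
    ∫ θ in (0 : ℝ)..Real.pi, langevin p κ (Real.cos θ) * Real.sin θ ^ (p - 2)

/-- The estimator of `∫ f_U²` from the observations `y i`, `i ∈ s`. -/
def radialEstimator (K : ℝ → ℝ) (h : ℝ) {p : ℕ} (s : Finset ℕ)
    (y : ℕ → EuclideanSpace ℝ (Fin p)) : ℝ :=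
  ((s.card : ℝ) * ((s.card : ℝ) - 1) * h)⁻¹ *
    ∑ q ∈ s.offDiag, K ((‖y q.1‖ - ‖y q.2‖) / h)

/-- The estimator of `∫∫ f²` from the observations `y i`, `i ∈ s`. -/
def jointEstimator (K : ℝ → ℝ) (h κ : ℝ) {p : ℕ} (s : Finset ℕ)
    (y : ℕ → EuclideanSpace ℝ (Fin p)) : ℝ :=
  ((s.card : ℝ) * ((s.card : ℝ) - 1) * langevinConst p κ * h)⁻¹ *
    ∑ q ∈ s.offDiag, K ((‖y q.1‖ - ‖y q.2‖) / h) *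
      langevin p κ (inner ℝ (direction (y q.1)) (direction (y q.2)))

/-- The estimator `ℳ̂²` of `ℳ²` from the observations `y i`, `i ∈ s`. -/
def deviationEstimator (K : ℝ → ℝ) (h κ : ℝ) {p : ℕ} (s : Finset ℕ)
    (y : ℕ → EuclideanSpace ℝ (Fin p)) : ℝ :=
  jointEstimator K h κ s y - (unitSphereArea p)⁻¹ * radialEstimator K h s y

/-- The `i`-th jackknife pseudovalue of the sample `y 0, …, y (n-1)`. -/
def pseudovalue (K : ℝ → ℝ) (h κ : ℝ) {p : ℕ} (n : ℕ) (y : ℕ → EuclideanSpace ℝ (Fin p))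
    (i : ℕ) : ℝ :=
  (n : ℝ) * deviationEstimator K h κ (Finset.range n) y -
    ((n : ℝ) - 1) * deviationEstimator K h κ ((Finset.range n).erase i) y

/-- The mean of the jackknife pseudovalues. -/
def pseudovalueMean (K : ℝ → ℝ) (h κ : ℝ) {p : ℕ} (n : ℕ) (y : ℕ → EuclideanSpace ℝ (Fin p)) : ℝ :=
  (n : ℝ)⁻¹ * ∑ i ∈ Finset.range n, pseudovalue K h κ n y i

/-- The jackknife variance estimator `σ̂²`. -/
def jackknifeVariance (K : ℝ → ℝ) (h κ : ℝ) {p : ℕ} (n : ℕ)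
    (y : ℕ → EuclideanSpace ℝ (Fin p)) : ℝ :=
  (4 * ((n : ℝ) - 1))⁻¹ *
    ∑ i ∈ Finset.range n, (pseudovalue K h κ n y i - pseudovalueMean K h κ n y) ^ 2

/-- The `q`-quantile of the standard normal distribution. -/
def stdNormalQuantile (q : ℝ) : ℝ := sInf {x : ℝ | q ≤ cdf (gaussianReal 0 1) x}

/-- The jackknife confidence interval of nominal level `1 - α`. -/
def jackknifeInterval (K : ℝ → ℝ) (h κ α : ℝ) {p : ℕ} (n : ℕ)
    (y : ℕ → EuclideanSpace ℝ (Fin p)) : Set ℝ :=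
  Icc
    (deviationEstimator K h κ (Finset.range n) y -
      2 * √(jackknifeVariance K h κ n y) / √(n : ℝ) * stdNormalQuantile (1 - α / 2))
    (deviationEstimator K h κ (Finset.range n) y +
      2 * √(jackknifeVariance K h κ n y) / √(n : ℝ) * stdNormalQuantile (1 - α / 2))

/-- `K` is a symmetric probability density supported on `(-1, 1)` with `∫ K⁴ < ∞`. -/
structure KernelAssumption (K : ℝ → ℝ) : Prop where
  measurable : Measurable K
  nonneg : ∀ x, 0 ≤ K x
  symm : ∀ x, K (-x) = K x
  support : ∀ x, x ∉ Ioo (-1 : ℝ) 1 → K x = 0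
  integrable : Integrable K
  integral_eq_one : ∫ x, K x = 1
  integrable_pow_four : Integrable (fun x => K x ^ 4)

/-- The extension of `f` from `ℝ⁺ × S^{p-1}` to `ℝ⁺ × (ℝ^p ∖ {0})` that is constant on rays. -/
def rayExtension {p : ℕ} (f : ℝ → EuclideanSpace ℝ (Fin p) → ℝ) (u : ℝ)
    (y : EuclideanSpace ℝ (Fin p)) : ℝ := f u (direction y)

/-- The second derivative `D²_f(u, v)` with respect to the direction `v ∈ S^{p-1}`. With the
extension constant on rays one has `v ᵀ D²_f(u, v) v = 0`, and for a unit vector `ξ ⟂ v` the number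
`ξ ᵀ D²_f(u, v) ξ` is the second derivative of `θ ↦ f(u, v cos θ + ξ sin θ)` at `0`. -/
def angularHessian {p : ℕ} (f : ℝ → EuclideanSpace ℝ (Fin p) → ℝ) (u : ℝ)
    (v : EuclideanSpace ℝ (Fin p)) :
    EuclideanSpace ℝ (Fin p) →L[ℝ] EuclideanSpace ℝ (Fin p) →L[ℝ] ℝ :=
  fderiv ℝ (fderiv ℝ (rayExtension f u)) v

/-- The second derivative `∂²f(u, v)/∂u²`. -/
def radialSecondDeriv {p : ℕ} (f : ℝ → EuclideanSpace ℝ (Fin p) → ℝ) (u : ℝ)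
    (v : EuclideanSpace ℝ (Fin p)) : ℝ :=
  deriv (deriv (fun r => f r v)) u

/-- Smoothness of the density `f` on `ℝ⁺ × S^{p-1}`: it is twice differentiable, its second
derivatives in the direction and in the radius are uniformly continuous, uniformly in the other
variable, and its limit at the origin does not depend on the direction. -/
structure DensityAssumption {p : ℕ} (f : ℝ → EuclideanSpace ℝ (Fin p) → ℝ) : Prop where
  differentiable : DifferentiableOn ℝ
    (fun x : ℝ × EuclideanSpace ℝ (Fin p) => rayExtension f x.1 x.2) (Ioi 0 ×ˢ {0}ᶜ)
  twice_differentiable : DifferentiableOn ℝ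
    (fderiv ℝ (fun x : ℝ × EuclideanSpace ℝ (Fin p) => rayExtension f x.1 x.2)) (Ioi 0 ×ˢ {0}ᶜ)
  angular : ∀ ε > 0, ∃ δ > 0, ∀ u > 0, ∀ v w : EuclideanSpace ℝ (Fin p), ‖v‖ = 1 → ‖w‖ = 1 →
    ‖v - w‖ < δ → ‖angularHessian f u v - angularHessian f u w‖ < ε
  radial : ∀ ε > 0, ∃ δ > 0, ∀ v : EuclideanSpace ℝ (Fin p), ‖v‖ = 1 → ∀ r > 0, ∀ s > 0,
    |r - s| < δ → |radialSecondDeriv f r v - radialSecondDeriv f s v| < ε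
  origin : ∃ b : ℝ, ∀ v : EuclideanSpace ℝ (Fin p), ‖v‖ = 1 →
    Tendsto (fun u => f u v) (𝓝[>] 0) (𝓝 b)

end

/-!
The estimator is a `U`-statistic of order two in the pairs `X i = (‖Y i‖, Y i / ‖Y i‖)`, with the
symmetric kernel `H(x, y) = h⁻¹ K((u - u') / h) (l(v, v') - 1 / ω_{p-1})`, where `l` is the Langevin
kernel normalized on the sphere (`deviationEstimator_eq_uStat`). Write `d = f - f_U / ω_{p-1}` for the
deviation of the density from its spherical mean (`devPart`). The minimum that defines `ℳ²` is attained
at the radial density, so that `ℳ² = ∫ d² = E d(X)` (`sphericityDeviation_eq`,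
`integral_devPart_polarLaw`).

*Reduction to a limit theorem for `U`-statistics* (`tendsto_jackknife_coverage`). Let
`h_n(x) = E H(x, X)` be the first order projection of the kernel. If `E H² = o(n)`, `h_n → d` in `L²`
and `E h_n(X) - E d(X) = o(n^{-1/2})`, the Hoeffding decomposition shows that `√n (ℳ̂² - ℳ²)` is
asymptotically equivalent to `n^{-1/2} ∑ 2 (d(X i) - E d(X))`, because the completely degenerate part
has variance `O(E H² / n²)`. The pseudovalues are affine in the row means of the matrix `H(X i, X j)`
(`jackknife_pseudovalue_eq`), and the row means are close to `d(X i)` in mean square; hence the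
jackknife variance is consistent for `Var d(X)`. The central limit theorem, Slutsky's lemma and the
portmanteau theorem then give the coverage, provided that `Var d(X) > 0`. If the variance vanished, `d`
would be equal to the constant `E d(X) = ℳ² > 0` on the support, and on almost every sphere `f(u, ·)`
could take only two values, one of them zero; by connectedness it would be constant, so that `d`
vanishes there (`variance_devPart_pos`).

*Bias.* Let `Q(x, y) = h⁻¹ K((u - u') / h) l(v, v')`. With the radius extended to the whole line, this
is a Markov kernel, reversible with respect to `du ω(dv)` (`isReversibleKernel_smoothKernel`), and
`h_n = Q d`, because subtracting `1 / ω_{p-1}` removes the spherically symmetric part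
(`hajekProj_deviationKernel`). Let `D_n = ∬ Q(x, y) (d(x) - d(y))²` be its Dirichlet form. Jensen's
inequality gives `∫ f (Q d - d)² ≤ sup f · D_n`, and reversibility gives
`E h_n(X) - E d(X) = ⟨d, Q d - d⟩ = -D_n / 2`. Both approximation conditions thus follow from
`D_n = O(h² + 1 / κ)` (`exists_dirichletForm_devPart_le`). Only first order regularity of `d` enters
this estimate, in the form `(d(x) - d(y))² ≤ C (|u - u'|² + |v - v'|²) (m(x) + m(y))` with an
integrable `m` (`exists_devPart_sub_sq_le`).

*Regularity.* The second derivatives are only assumed uniformly continuous. They are bounded because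
`f` is an integrable function on unbounded slabs in the radius and a periodic function along great
circles (`exists_radial_bounds`, `exists_angularHessian_bound`). Glaeser's inequality then shows that
`√f` is Lipschitz (`glaeser_sq_sub_le`), which yields the weight `m` in terms of `f` and its spherical
mean. Near the origin the common limit of `f` makes `d` vanish at a linear rate
(`abs_devPart_le_mul`).

*Second moment.* Slicing the sphere (`lintegral_surfaceMeasure_inner`) reduces the Langevin kernel to
integrals over the colatitude, which give `l = O(κ^{(p-1)/2})` and a mean squared distance of order
`1 / κ`; hence `E H² = O(κ^{(p-1)/2} / h)` (`exists_lintegral_deviationKernel_sq_le`).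
-/

/-! ### Degenerate kernels of independent observations -/

theorem tendstoInMeasure_zero_of_integral_sq {Ω : Type*} [MeasurableSpace Ω] {P : Measure Ω}
    [IsProbabilityMeasure P] {Z : ℕ → Ω → ℝ} (hZ : ∀ᶠ n in atTop, MemLp (Z n) 2 P) {c : ℕ → ℝ}
    (hc : ∀ᶠ n in atTop, ∫ ω, Z n ω ^ 2 ∂P ≤ c n) (hc0 : Tendsto c atTop (𝓝 0)) :
    TendstoInMeasure P Z atTop (fun _ => (0 : ℝ)) := by
  rw [tendstoInMeasure_iff_measureReal_norm]
  intro ε hε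
  have h1 : Tendsto (fun n => c n / ε ^ 2) atTop (𝓝 0) := by simpa using hc0.div_const (ε ^ 2)
  refine tendsto_of_tendsto_of_tendsto_of_le_of_le' tendsto_const_nhds h1
    (Eventually.of_forall fun n => measureReal_nonneg) ?_
  filter_upwards [hZ, hc] with n hn hcn
  have := mul_meas_ge_le_integral_of_nonneg (μ := P) (f := fun ω => Z n ω ^ 2)
    (Eventually.of_forall fun ω => sq_nonneg _) hn.integrable_sq (ε ^ 2)
  rw [le_div_iff₀ (by positivity), mul_comm]
  refine le_trans (le_of_eq ?_) (this.trans hcn)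
  congr 3
  ext ω
  simp [sq_le_sq, abs_of_pos hε]

theorem tendstoInMeasure_zero_of_integral_abs {Ω : Type*} [MeasurableSpace Ω] {P : Measure Ω}
    [IsProbabilityMeasure P] {Z : ℕ → Ω → ℝ} (hZ : ∀ᶠ n in atTop, Integrable (Z n) P) {c : ℕ → ℝ}
    (hc : ∀ᶠ n in atTop, ∫ ω, |Z n ω| ∂P ≤ c n) (hc0 : Tendsto c atTop (𝓝 0)) :
    TendstoInMeasure P Z atTop (fun _ => (0 : ℝ)) := by
  rw [tendstoInMeasure_iff_measureReal_norm]
  intro ε hε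
  have h1 : Tendsto (fun n => c n / ε) atTop (𝓝 0) := by simpa using hc0.div_const ε
  refine tendsto_of_tendsto_of_tendsto_of_le_of_le' tendsto_const_nhds h1
    (Eventually.of_forall fun n => measureReal_nonneg) ?_
  filter_upwards [hZ, hc] with n hn hcn
  have := mul_meas_ge_le_integral_of_nonneg (μ := P) (f := fun ω => |Z n ω|)
    (Eventually.of_forall fun ω => abs_nonneg _) hn.abs ε
  rw [le_div_iff₀ (by positivity), mul_comm]
  refine le_trans (le_of_eq ?_) (this.trans hcn)
  simp

section IID
variable {Ω S : Type*} [MeasurableSpace Ω] [MeasurableSpace S] {P : Measure Ω}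
  [IsProbabilityMeasure P] {ν : Measure S} [IsProbabilityMeasure ν] {X : ℕ → Ω → S}

omit [IsProbabilityMeasure ν] in
theorem measurePreserving_pair (hX : ∀ i, Measurable (X i)) (hind : iIndepFun X P)
    (hlaw : ∀ i, P.map (X i) = ν) {i j : ℕ} (hij : i ≠ j) :
    MeasurePreserving (fun ω => (X i ω, X j ω)) P (ν.prod ν) := by
  refine ⟨by fun_prop, ?_⟩
  rw [(indepFun_iff_map_prod_eq_prod_map_map (hX i).aemeasurable (hX j).aemeasurable).1
    (hind.indepFun hij), hlaw, hlaw]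

/-- Observations entering a degenerate kernel through an index that occurs nowhere else
are orthogonal to everything. -/
theorem integral_degenerate_mul_eq_zero (hX : ∀ i, Measurable (X i)) (hind : iIndepFun X P)
    (hlaw : ∀ i, P.map (X i) = ν) {e G : S × S → ℝ} (hem : Measurable e) (hGm : Measurable G)
    (he : MemLp e 2 (ν.prod ν)) (hG : MemLp G 2 (ν.prod ν))
    (he0 : ∀ᵐ x ∂ν, ∫ y, e (x, y) ∂ν = 0)
    {i j k l : ℕ} (hij : i ≠ j) (hkl : k ≠ l) (hjk : j ≠ k) (hjl : j ≠ l) :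
    ∫ ω, e (X i ω, X j ω) * G (X k ω, X l ω) ∂P = 0 := by
  let Z : Ω → S × (S × S) := fun ω => (X i ω, (X k ω, X l ω))
  have hZ : Measurable Z := by fun_prop
  have hZX : IndepFun Z (X j) P := by
    have h1 := hind.indepFun_finset ({i, k, l} : Finset ℕ) {j} (by simp; tauto) hX
    exact h1.comp
      (φ := fun x : (({i, k, l} : Finset ℕ) → S) =>
        (x ⟨i, by simp⟩, (x ⟨k, by simp⟩, x ⟨l, by simp⟩)))
      (ψ := fun x : (({j} : Finset ℕ) → S) => x ⟨j, by simp⟩) (by fun_prop) (by fun_prop)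
  have hmp : P.map (fun ω => (Z ω, X j ω)) = (P.map Z).prod ν := by
    rw [(indepFun_iff_map_prod_eq_prod_map_map hZ.aemeasurable (hX j).aemeasurable).1 hZX, hlaw]
  have hint : Integrable (fun ω => e (X i ω, X j ω) * G (X k ω, X l ω)) P :=
    (he.comp_measurePreserving (measurePreserving_pair hX hind hlaw hij)).integrable_mul
      (hG.comp_measurePreserving (measurePreserving_pair hX hind hlaw hkl))
  have hm : Measurable (fun z : (S × (S × S)) × S => e (z.1.1, z.2) * G z.1.2) := by fun_prop
  have hpr : IsProbabilityMeasure (P.map Z) := Measure.isProbabilityMeasure_map hZ.aemeasurable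
  have hZXm : Measurable (fun ω => (Z ω, X j ω)) := by fun_prop
  have h2 : ∫ ω, e (X i ω, X j ω) * G (X k ω, X l ω) ∂P
      = ∫ z, e (z.1.1, z.2) * G z.1.2 ∂((P.map Z).prod ν) := by
    rw [← hmp, integral_map hZXm.aemeasurable hm.aestronglyMeasurable]
  have hint2 : Integrable (fun z : (S × (S × S)) × S => e (z.1.1, z.2) * G z.1.2)
      ((P.map Z).prod ν) := by
    rw [← hmp]
    exact (integrable_map_measure hm.aestronglyMeasurable hZXm.aemeasurable).2 hint
  rw [h2, integral_prod _ hint2]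
  have h3 : ∀ᵐ z ∂(P.map Z), ∫ y, e (z.1, y) ∂ν = 0 := by
    have h4 : ∀ᵐ x ∂((P.map Z).map Prod.fst), ∫ y, e (x, y) ∂ν = 0 := by
      rw [Measure.map_map measurable_fst hZ]
      have : Prod.fst ∘ Z = X i := rfl
      rwa [this, hlaw]
    exact ae_of_ae_map measurable_fst.aemeasurable h4
  rw [integral_eq_zero_of_ae]
  filter_upwards [h3] with z hz
  simp only [integral_mul_const, hz, zero_mul, Pi.zero_apply]

omit [IsProbabilityMeasure P] in
/-- If every `g i` is orthogonal to all `g j` other than itself and one partner `g (τ i)`, the second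
moment of the sum grows linearly in the number of terms. -/
theorem integral_sum_sq_le {ι : Type*} [DecidableEq ι] (s : Finset ι) {g : ι → Ω → ℝ}
    (hg : ∀ i ∈ s, MemLp (g i) 2 P) {c : ℝ} (hc : ∀ i ∈ s, ∫ ω, g i ω ^ 2 ∂P ≤ c)
    (τ : ι → ι) (hτ : ∀ i ∈ s, τ i ∈ s)
    (horth : ∀ i ∈ s, ∀ j ∈ s, j ≠ i → j ≠ τ i → ∫ ω, g i ω * g j ω ∂P = 0) :
    ∫ ω, (∑ i ∈ s, g i ω) ^ 2 ∂P ≤ 2 * s.card * c := by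
  have hint : ∀ i ∈ s, ∀ j ∈ s, Integrable (fun ω => g i ω * g j ω) P :=
    fun i hi j hj => (hg i hi).integrable_mul (hg j hj)
  have hcross : ∀ i ∈ s, ∀ j ∈ s, ∫ ω, g i ω * g j ω ∂P ≤ c := by
    intro i hi j hj
    have h1 : ∫ ω, g i ω * g j ω ∂P ≤ ∫ ω, (g i ω ^ 2 + g j ω ^ 2) / 2 ∂P := by
      refine integral_mono (hint i hi j hj)
        (((hg i hi).integrable_sq.add (hg j hj).integrable_sq).div_const 2) fun ω => ?_
      simp only
      nlinarith [sq_nonneg (g i ω - g j ω)]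
    rw [integral_div, integral_add (hg i hi).integrable_sq (hg j hj).integrable_sq] at h1
    linarith [hc i hi, hc j hj]
  have hexp : ∀ ω, (∑ i ∈ s, g i ω) ^ 2 = ∑ i ∈ s, ∑ j ∈ s, g i ω * g j ω := fun ω => by
    rw [sq, Finset.sum_mul_sum]
  simp_rw [hexp]
  rw [integral_finsetSum _ fun i hi => integrable_finsetSum _ fun j hj => hint i hi j hj]
  have : ∀ i ∈ s, ∫ ω, ∑ j ∈ s, g i ω * g j ω ∂P ≤ 2 * c := by
    intro i hi
    rw [integral_finsetSum _ fun j hj => hint i hi j hj]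
    have hc0 : 0 ≤ c := (integral_nonneg fun ω => sq_nonneg _).trans (hc i hi)
    calc ∑ j ∈ s, ∫ ω, g i ω * g j ω ∂P
        ≤ ∑ j ∈ s, ((if j = i then c else 0) + if j = τ i then c else 0) := by
          refine Finset.sum_le_sum fun j hj => ?_
          by_cases h1 : j = i
          · have := hcross i hi j hj
            rw [if_pos h1]; split_ifs <;> linarith
          · by_cases h2 : j = τ i
            · have := hcross i hi j hj
              rw [if_neg h1, if_pos h2]; linarith
            · rw [horth i hi j hj h1 h2]; simp [h1, h2]
      _ = 2 * c := by
          rw [Finset.sum_add_distrib, Finset.sum_ite_eq', Finset.sum_ite_eq', if_pos hi,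
            if_pos (hτ i hi)]; ring
  calc _ ≤ ∑ i ∈ s, 2 * c := Finset.sum_le_sum this
    _ = _ := by simp; ring

/-- Variance bound for a completely degenerate symmetric `U`-statistic of order two. -/
theorem integral_offDiag_sq_le (hX : ∀ i, Measurable (X i)) (hind : iIndepFun X P)
    (hlaw : ∀ i, P.map (X i) = ν) {e : S × S → ℝ} (hem : Measurable e)
    (he : MemLp e 2 (ν.prod ν)) (hes : ∀ x y, e (x, y) = e (y, x))
    (he0 : ∀ᵐ x ∂ν, ∫ y, e (x, y) ∂ν = 0) (s : Finset ℕ) :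
    ∫ ω, (∑ q ∈ s.offDiag, e (X q.1 ω, X q.2 ω)) ^ 2 ∂P
      ≤ 2 * s.offDiag.card * ∫ z, e z ^ 2 ∂(ν.prod ν) := by
  refine integral_sum_sq_le s.offDiag (fun q hq => ?_) (fun q hq => ?_) Prod.swap
    (fun q hq => ?_) fun q hq q' hq' h1 h2 => ?_
  · have hq := (Finset.mem_offDiag.1 hq).2.2
    exact he.comp_measurePreserving (measurePreserving_pair hX hind hlaw hq)
  · have hq := (Finset.mem_offDiag.1 hq).2.2
    have := measurePreserving_pair hX hind hlaw hq
    rw [← this.map_eq, integral_map this.measurable.aemeasurable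
      (hem.pow_const 2).aestronglyMeasurable]
  · have := Finset.mem_offDiag.1 hq
    exact Finset.mem_offDiag.2 ⟨this.2.1, this.1, this.2.2.symm⟩
  · have hq := (Finset.mem_offDiag.1 hq).2.2
    have hq' := (Finset.mem_offDiag.1 hq').2.2
    obtain ⟨i, j⟩ := q
    obtain ⟨k, l⟩ := q'
    simp only [ne_eq, Prod.mk.injEq, Prod.swap_prod_mk, not_and] at *
    by_cases hj : j ≠ k ∧ j ≠ l
    · exact integral_degenerate_mul_eq_zero hX hind hlaw hem hem he he he0 hq hq' hj.1 hj.2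
    · have hi : i ≠ k ∧ i ≠ l := by
        by_contra hcon
        have a1 : j = k ∨ j = l := by tauto
        have a2 : i = k ∨ i = l := by tauto
        rcases a1 with rfl | rfl <;> rcases a2 with rfl | rfl <;> simp_all
      simp_rw [hes (X i _) (X j _)]
      exact integral_degenerate_mul_eq_zero hX hind hlaw hem hem he he he0 (Ne.symm hq) hq'
        hi.1 hi.2

/-- Variance bound for a sum over one argument of a kernel that is degenerate in this argument. -/
theorem integral_sum_row_sq_le (hX : ∀ i, Measurable (X i)) (hind : iIndepFun X P)
    (hlaw : ∀ i, P.map (X i) = ν) {e : S × S → ℝ} (hem : Measurable e)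
    (he : MemLp e 2 (ν.prod ν)) (he0 : ∀ᵐ x ∂ν, ∫ y, e (x, y) ∂ν = 0) {s : Finset ℕ} {i : ℕ}
    (hi : i ∉ s) :
    ∫ ω, (∑ j ∈ s, e (X i ω, X j ω)) ^ 2 ∂P ≤ 2 * s.card * ∫ z, e z ^ 2 ∂(ν.prod ν) := by
  have hne : ∀ j ∈ s, i ≠ j := fun j hj h => hi (h ▸ hj)
  refine integral_sum_sq_le s (fun j hj => ?_) (fun j hj => ?_) id
    (fun j hj => hj) fun j hj k hk h1 _ => ?_
  · exact he.comp_measurePreserving (measurePreserving_pair hX hind hlaw (hne j hj))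
  · have := measurePreserving_pair hX hind hlaw (hne j hj)
    rw [← this.map_eq, integral_map this.measurable.aemeasurable
      (hem.pow_const 2).aestronglyMeasurable]
  · exact integral_degenerate_mul_eq_zero hX hind hlaw hem hem he he he0 (hne j hj) (hne k hk)
      (hne j hj).symm (Ne.symm h1)

end IID

/-! ### The Hoeffding decomposition -/

section Projection
variable {S : Type*} [MeasurableSpace S] {ν : Measure S} [IsProbabilityMeasure ν]
  {H : S × S → ℝ}

/-- The first order (Hájek) projection of the kernel `H`. -/
noncomputable def hajekProj (ν : Measure S) (H : S × S → ℝ) (x : S) : ℝ := ∫ y, H (x, y) ∂ν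

theorem measurable_hajekProj (hH : Measurable H) : Measurable (hajekProj ν H) :=
  hH.stronglyMeasurable.integral_prod_right'.measurable

theorem ae_memLp_section (hH : Measurable H) (hH2 : MemLp H 2 (ν.prod ν)) :
    ∀ᵐ x ∂ν, MemLp (fun y => H (x, y)) 2 ν := by
  have := (integrable_prod_iff (hH.pow_const 2).aestronglyMeasurable).1 hH2.integrable_sq
  filter_upwards [this.1] with x hx
  exact (memLp_two_iff_integrable_sq (hH.comp measurable_prodMk_left).aestronglyMeasurable).2 hx

theorem sq_integral_le_integral_sq {g : S → ℝ} (hg : MemLp g 2 ν) :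
    (∫ y, g y ∂ν) ^ 2 ≤ ∫ y, g y ^ 2 ∂ν := by
  have h := variance_eq_sub hg
  have h2 := variance_nonneg g ν
  simp only [Pi.pow_apply] at h
  linarith

theorem hajekProj_sq_le (hH : Measurable H) (hH2 : MemLp H 2 (ν.prod ν)) :
    ∀ᵐ x ∂ν, hajekProj ν H x ^ 2 ≤ ∫ y, H (x, y) ^ 2 ∂ν := by
  filter_upwards [ae_memLp_section hH hH2] with x hx
  exact sq_integral_le_integral_sq hx

theorem memLp_hajekProj (hH : Measurable H) (hH2 : MemLp H 2 (ν.prod ν)) :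
    MemLp (hajekProj ν H) 2 ν := by
  rw [memLp_two_iff_integrable_sq (measurable_hajekProj hH).aestronglyMeasurable]
  refine hH2.integrable_sq.integral_prod_left.mono'
    ((measurable_hajekProj hH).pow_const 2).aestronglyMeasurable ?_
  filter_upwards [hajekProj_sq_le hH hH2] with x hx
  rwa [Real.norm_of_nonneg (sq_nonneg _)]

theorem integral_hajekProj_sq_le (hH : Measurable H) (hH2 : MemLp H 2 (ν.prod ν)) :
    ∫ x, hajekProj ν H x ^ 2 ∂ν ≤ ∫ z, H z ^ 2 ∂(ν.prod ν) := by
  rw [integral_prod _ hH2.integrable_sq]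
  exact integral_mono_ae (memLp_hajekProj hH hH2).integrable_sq
    hH2.integrable_sq.integral_prod_left (hajekProj_sq_le hH hH2)

theorem memLp_comp_fst {g : S → ℝ} (hg : MemLp g 2 ν) :
    MemLp (fun z : S × S => g z.1) 2 (ν.prod ν) :=
  hg.comp_measurePreserving measurePreserving_fst

theorem memLp_comp_snd {g : S → ℝ} (hg : MemLp g 2 ν) :
    MemLp (fun z : S × S => g z.2) 2 (ν.prod ν) :=
  hg.comp_measurePreserving measurePreserving_snd

theorem integral_comp_fst_sq {g : S → ℝ} (hgm : Measurable g) :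
    ∫ z, g z.1 ^ 2 ∂(ν.prod ν) = ∫ x, g x ^ 2 ∂ν := by
  have := (measurePreserving_fst (μ := ν) (ν := ν))
  conv_rhs => rw [← this.map_eq, integral_map this.measurable.aemeasurable
      (hgm.pow_const 2).aestronglyMeasurable]

theorem integral_comp_snd_sq {g : S → ℝ} (hgm : Measurable g) :
    ∫ z, g z.2 ^ 2 ∂(ν.prod ν) = ∫ x, g x ^ 2 ∂ν := by
  have := (measurePreserving_snd (μ := ν) (ν := ν))
  conv_rhs => rw [← this.map_eq, integral_map this.measurable.aemeasurable
      (hgm.pow_const 2).aestronglyMeasurable]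

/-- The kernel centred in its second argument. -/
noncomputable def rowCentered (ν : Measure S) (H : S × S → ℝ) (z : S × S) : ℝ :=
  H z - hajekProj ν H z.1

/-- The completely degenerate part of `H` in its Hoeffding decomposition. -/
noncomputable def degeneratePart (ν : Measure S) (H : S × S → ℝ) (z : S × S) : ℝ :=
  H z - hajekProj ν H z.1 - hajekProj ν H z.2 + ∫ x, hajekProj ν H x ∂ν

theorem measurable_rowCentered (hH : Measurable H) : Measurable (rowCentered ν H) :=
  hH.sub ((measurable_hajekProj hH).comp measurable_fst)

theorem measurable_degeneratePart (hH : Measurable H) : Measurable (degeneratePart ν H) :=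
  ((hH.sub ((measurable_hajekProj hH).comp measurable_fst)).sub
    ((measurable_hajekProj hH).comp measurable_snd)).add_const _

theorem memLp_rowCentered (hH : Measurable H) (hH2 : MemLp H 2 (ν.prod ν)) :
    MemLp (rowCentered ν H) 2 (ν.prod ν) :=
  hH2.sub (memLp_comp_fst (memLp_hajekProj hH hH2))

theorem memLp_degeneratePart (hH : Measurable H) (hH2 : MemLp H 2 (ν.prod ν)) :
    MemLp (degeneratePart ν H) 2 (ν.prod ν) :=
  ((hH2.sub (memLp_comp_fst (memLp_hajekProj hH hH2))).sub
    (memLp_comp_snd (memLp_hajekProj hH hH2))).add (memLp_const _)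

theorem integral_rowCentered_eq_zero (hH : Measurable H) (hH2 : MemLp H 2 (ν.prod ν)) :
    ∀ᵐ x ∂ν, ∫ y, rowCentered ν H (x, y) ∂ν = 0 := by
  filter_upwards [ae_memLp_section hH hH2] with x hx
  simp only [rowCentered]
  rw [integral_sub (hx.integrable one_le_two) (integrable_const _)]
  simp [hajekProj]

theorem integral_degeneratePart_eq_zero (hH : Measurable H) (hH2 : MemLp H 2 (ν.prod ν)) :
    ∀ᵐ x ∂ν, ∫ y, degeneratePart ν H (x, y) ∂ν = 0 := by
  filter_upwards [ae_memLp_section hH hH2] with x hx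
  have h1 := hx.integrable one_le_two
  have h2 := (memLp_hajekProj hH hH2).integrable one_le_two
  simp only [degeneratePart]
  have h3 : Integrable (fun y => H (x, y) - hajekProj ν H x) ν := h1.sub (integrable_const _)
  have h4 : Integrable (fun y => H (x, y) - hajekProj ν H x - hajekProj ν H y) ν := h3.sub h2
  rw [integral_add h4 (integrable_const _), integral_sub h3 h2,
    integral_sub h1 (integrable_const _)]
  simp [hajekProj]

theorem integral_rowCentered_sq_le (hH : Measurable H) (hH2 : MemLp H 2 (ν.prod ν)) :
    ∫ z, rowCentered ν H z ^ 2 ∂(ν.prod ν) ≤ 4 * ∫ z, H z ^ 2 ∂(ν.prod ν) := by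
  have hb := memLp_hajekProj hH hH2
  have h1 : ∫ z, rowCentered ν H z ^ 2 ∂(ν.prod ν)
      ≤ ∫ z, (2 * H z ^ 2 + 2 * hajekProj ν H z.1 ^ 2) ∂(ν.prod ν) := by
    refine integral_mono (memLp_rowCentered hH hH2).integrable_sq
      ((hH2.integrable_sq.const_mul 2).add ((memLp_comp_fst hb).integrable_sq.const_mul 2))
      fun z => ?_
    simp only [rowCentered]
    nlinarith [sq_nonneg (H z + hajekProj ν H z.1)]
  rw [integral_add (hH2.integrable_sq.const_mul 2) ((memLp_comp_fst hb).integrable_sq.const_mul 2),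
    integral_const_mul, integral_const_mul, integral_comp_fst_sq (measurable_hajekProj hH)] at h1
  linarith [integral_hajekProj_sq_le hH hH2]

theorem integral_degeneratePart_sq_le (hH : Measurable H) (hH2 : MemLp H 2 (ν.prod ν)) :
    ∫ z, degeneratePart ν H z ^ 2 ∂(ν.prod ν) ≤ 16 * ∫ z, H z ^ 2 ∂(ν.prod ν) := by
  have hb := memLp_hajekProj hH hH2
  set θ := ∫ x, hajekProj ν H x ∂ν with hθ
  have i1 := hH2.integrable_sq.const_mul 4
  have i2 := (memLp_comp_fst hb).integrable_sq.const_mul 4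
  have i3 := (memLp_comp_snd hb).integrable_sq.const_mul 4
  have i4 : Integrable (fun z => 4 * H z ^ 2 + 4 * hajekProj ν H z.1 ^ 2) (ν.prod ν) := i1.add i2
  have i5 : Integrable (fun z => 4 * H z ^ 2 + 4 * hajekProj ν H z.1 ^ 2
    + 4 * hajekProj ν H z.2 ^ 2) (ν.prod ν) := i4.add i3
  have h1 : ∫ z, degeneratePart ν H z ^ 2 ∂(ν.prod ν)
      ≤ ∫ z, (4 * H z ^ 2 + 4 * hajekProj ν H z.1 ^ 2 + 4 * hajekProj ν H z.2 ^ 2 + 4 * θ ^ 2)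
        ∂(ν.prod ν) := by
    refine integral_mono (memLp_degeneratePart hH hH2).integrable_sq
      (i5.add (integrable_const _)) fun z => ?_
    simp only [degeneratePart, ← hθ]
    nlinarith [sq_nonneg (H z + hajekProj ν H z.1), sq_nonneg (H z + hajekProj ν H z.2),
      sq_nonneg (H z - θ), sq_nonneg (hajekProj ν H z.1 - hajekProj ν H z.2),
      sq_nonneg (hajekProj ν H z.1 + θ), sq_nonneg (hajekProj ν H z.2 + θ)]
  rw [integral_add i5 (integrable_const _), integral_add i4 i3,
    integral_add i1 i2, integral_const_mul, integral_const_mul, integral_const_mul,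
    integral_comp_fst_sq (measurable_hajekProj hH),
    integral_comp_snd_sq (measurable_hajekProj hH)] at h1
  have h2 := sq_integral_le_integral_sq hb
  have h3 := integral_hajekProj_sq_le hH hH2
  simp only [integral_const, probReal_univ, smul_eq_mul, one_mul] at h1
  linarith

end Projection

section Algebra
variable {S : Type*}

/-- The `U`-statistic of order two with kernel `H` for the observations `x i`, `i ∈ s`. -/
noncomputable def uStat (H : S × S → ℝ) (s : Finset ℕ) (x : ℕ → S) : ℝ :=
  ((s.card : ℝ) * ((s.card : ℝ) - 1))⁻¹ * ∑ q ∈ s.offDiag, H (x q.1, x q.2)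

/-- The mean of `H (x i, x j)` over the indices `j ≠ i` below `n`. -/
noncomputable def rowMean (H : S × S → ℝ) (n : ℕ) (x : ℕ → S) (i : ℕ) : ℝ :=
  ((n : ℝ) - 1)⁻¹ * ∑ j ∈ (Finset.range n).erase i, H (x i, x j)

/-- The empirical variance, normalized by `n`. -/
noncomputable def empVar (n : ℕ) (a : ℕ → ℝ) : ℝ :=
  (n : ℝ)⁻¹ * ∑ i ∈ Finset.range n, (a i - (n : ℝ)⁻¹ * ∑ j ∈ Finset.range n, a j) ^ 2

theorem sum_offDiag_eq_sum_sum {M : Type*} [AddCommMonoid M] (s : Finset ℕ) (F : ℕ × ℕ → M) :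
    ∑ q ∈ s.offDiag, F q = ∑ i ∈ s, ∑ j ∈ s.erase i, F (i, j) := by
  rw [Finset.sum_sigma']
  refine Finset.sum_bij' (fun q _ => ⟨q.1, q.2⟩) (fun q _ => (q.1, q.2)) ?_ ?_ ?_ ?_ ?_
  · intro q hq
    have := Finset.mem_offDiag.1 hq
    simp only [Finset.mem_sigma, Finset.mem_erase]
    exact ⟨this.1, this.2.2.symm, this.2.1⟩
  · intro q hq
    simp only [Finset.mem_sigma, Finset.mem_erase] at hq
    exact Finset.mem_offDiag.2 ⟨hq.1, hq.2.2, hq.2.1.symm⟩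
  all_goals intros; rfl

theorem sum_offDiag_erase {H : S × S → ℝ} (hs : ∀ x y, H (x, y) = H (y, x)) (s : Finset ℕ)
    (x : ℕ → S) {i : ℕ} (hi : i ∈ s) :
    ∑ q ∈ s.offDiag, H (x q.1, x q.2) = ∑ q ∈ (s.erase i).offDiag, H (x q.1, x q.2)
      + 2 * ∑ j ∈ s.erase i, H (x i, x j) := by
  rw [sum_offDiag_eq_sum_sum, sum_offDiag_eq_sum_sum, ← Finset.add_sum_erase _ _ hi]
  have : ∀ k ∈ s.erase i, ∑ j ∈ s.erase k, H (x k, x j)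
      = ∑ j ∈ (s.erase i).erase k, H (x k, x j) + H (x i, x k) := by
    intro k hk
    have hk' := Finset.mem_erase.1 hk
    have hmem : i ∈ s.erase k := Finset.mem_erase.2 ⟨Ne.symm hk'.1, hi⟩
    rw [Finset.erase_right_comm, ← Finset.sum_erase_add _ _ hmem, hs (x k)]
  rw [Finset.sum_congr rfl this, Finset.sum_add_distrib]
  ring

/-- The pseudovalues are affine in the row means, with coefficients that do not depend on the index. -/
theorem jackknife_pseudovalue_eq {H : S × S → ℝ} (hs : ∀ x y, H (x, y) = H (y, x)) {n : ℕ}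
    (hn : 3 ≤ n) (x : ℕ → S) {i : ℕ} (hi : i < n) :
    (n : ℝ) * uStat H (Finset.range n) x - ((n : ℝ) - 1) * uStat H ((Finset.range n).erase i) x
      = -((n : ℝ) / ((n : ℝ) - 2)) * uStat H (Finset.range n) x
        + 2 * ((n : ℝ) - 1) / ((n : ℝ) - 2) * rowMean H n x i := by
  have hn' : (3 : ℝ) ≤ n := by exact_mod_cast hn
  have h1 : ((n - 1 : ℕ) : ℝ) = (n : ℝ) - 1 := by
    rw [Nat.cast_sub (by omega)]; simp
  have hi' := Finset.mem_range.2 hi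
  have e1 : (n : ℝ) ≠ 0 := by linarith
  have e2 : (n : ℝ) - 1 ≠ 0 := by linarith
  have e3 : (n : ℝ) - 2 ≠ 0 := by linarith
  have e4 : (n : ℝ) - 1 - 1 ≠ 0 := by intro h; apply e3; linarith
  simp only [uStat, rowMean, Finset.card_erase_of_mem hi', Finset.card_range, h1]
  rw [sum_offDiag_erase hs _ x hi']
  have e5 : (n : ℝ) - 1 - 1 = n - 2 := by ring
  rw [e5]
  field_simp
  ring

/-- The jackknife variance is, up to a factor tending to `1`, the empirical variance of the
row means of the kernel matrix. -/
theorem jackknife_sum_sq_eq {H : S × S → ℝ} (hs : ∀ x y, H (x, y) = H (y, x)) {n : ℕ}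
    (hn : 3 ≤ n) (x : ℕ → S) {pv : ℕ → ℝ} (hpv : ∀ i < n, pv i =
      (n : ℝ) * uStat H (Finset.range n) x
        - ((n : ℝ) - 1) * uStat H ((Finset.range n).erase i) x) :
    (4 * ((n : ℝ) - 1))⁻¹ * ∑ i ∈ Finset.range n,
        (pv i - (n : ℝ)⁻¹ * ∑ j ∈ Finset.range n, pv j) ^ 2
      = (n : ℝ) * ((n : ℝ) - 1) / ((n : ℝ) - 2) ^ 2 * empVar n (rowMean H n x) := by
  have hn' : (3 : ℝ) ≤ n := by exact_mod_cast hn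
  have e1 : (n : ℝ) ≠ 0 := by linarith
  have e2 : (n : ℝ) - 1 ≠ 0 := by linarith
  have e3 : (n : ℝ) - 2 ≠ 0 := by linarith
  obtain ⟨c, hc⟩ : ∃ c, c = -((n : ℝ) / ((n : ℝ) - 2)) * uStat H (Finset.range n) x := ⟨_, rfl⟩
  set m : ℝ := (n : ℝ)⁻¹ * ∑ j ∈ Finset.range n, rowMean H n x j with hm
  have h1 : ∀ i ∈ Finset.range n, pv i = c + 2 * ((n : ℝ) - 1) / ((n : ℝ) - 2) * rowMean H n x i :=
    fun i hi => by
      rw [hpv i (Finset.mem_range.1 hi), jackknife_pseudovalue_eq hs hn x (Finset.mem_range.1 hi),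
        hc]
  have h2 : (n : ℝ)⁻¹ * ∑ j ∈ Finset.range n, pv j = c + 2 * ((n : ℝ) - 1) / ((n : ℝ) - 2) * m := by
    rw [Finset.sum_congr rfl h1, Finset.sum_add_distrib, ← Finset.mul_sum, hm]
    simp only [Finset.sum_const, Finset.card_range, nsmul_eq_mul]
    field_simp
  rw [h2]
  have h3 : ∀ i ∈ Finset.range n, (pv i - (c + 2 * ((n : ℝ) - 1) / ((n : ℝ) - 2) * m)) ^ 2
      = (2 * ((n : ℝ) - 1) / ((n : ℝ) - 2)) ^ 2 * (rowMean H n x i - m) ^ 2 := fun i hi => by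
    rw [h1 i hi]; ring
  rw [Finset.sum_congr rfl h3, ← Finset.mul_sum, empVar, ← hm]
  field_simp
  ring

theorem empVar_eq {n : ℕ} (hn : 0 < n) (a : ℕ → ℝ) :
    empVar n a = (n : ℝ)⁻¹ * ∑ i ∈ Finset.range n, a i ^ 2
      - ((n : ℝ)⁻¹ * ∑ i ∈ Finset.range n, a i) ^ 2 := by
  have e1 : (n : ℝ) ≠ 0 := by positivity
  simp only [empVar]
  set m := (n : ℝ)⁻¹ * ∑ j ∈ Finset.range n, a j with hm
  have h1 : ∑ j ∈ Finset.range n, a j = n * m := by rw [hm]; field_simp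
  have h2 : ∀ i ∈ Finset.range n, (a i - m) ^ 2 = a i ^ 2 - 2 * m * a i + m ^ 2 :=
    fun i _ => by ring
  rw [Finset.sum_congr rfl h2, Finset.sum_add_distrib, Finset.sum_sub_distrib, ← Finset.mul_sum, h1]
  simp only [Finset.sum_const, Finset.card_range, nsmul_eq_mul]
  field_simp
  ring

theorem empVar_le {n : ℕ} (hn : 0 < n) (a : ℕ → ℝ) :
    empVar n a ≤ (n : ℝ)⁻¹ * ∑ i ∈ Finset.range n, a i ^ 2 := by
  rw [empVar_eq hn]
  linarith [sq_nonneg ((n : ℝ)⁻¹ * ∑ i ∈ Finset.range n, a i)]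

/-- A consequence of `|a² - b²| ≤ (1 + ε⁻¹) (a - b)² + ε b²`, used with `ε` tending to zero. -/
theorem abs_empVar_sub_le {n : ℕ} (hn : 0 < n) (a b : ℕ → ℝ) {ε : ℝ} (hε : 0 < ε) :
    |empVar n a - empVar n b| ≤
      (1 + ε⁻¹) * ((n : ℝ)⁻¹ * ∑ i ∈ Finset.range n, (a i - b i) ^ 2) + ε * empVar n b := by
  have hc := empVar_le hn (fun i => a i - b i)
  have h1 : |empVar n a - empVar n b| ≤
      (1 + ε⁻¹) * empVar n (fun i => a i - b i) + ε * empVar n b := by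
    simp only [empVar, Finset.sum_sub_distrib, mul_sub]
    set ma := (n : ℝ)⁻¹ * ∑ j ∈ Finset.range n, a j
    set mb := (n : ℝ)⁻¹ * ∑ j ∈ Finset.range n, b j
    rw [← mul_sub, ← Finset.sum_sub_distrib, abs_mul, abs_of_nonneg (by positivity : 0 ≤ (n : ℝ)⁻¹),
      mul_left_comm, mul_left_comm ε, ← mul_add]
    refine mul_le_mul_of_nonneg_left ?_ (by positivity)
    rw [Finset.mul_sum, Finset.mul_sum, ← Finset.sum_add_distrib]
    refine (Finset.abs_sum_le_sum_abs _ _).trans (Finset.sum_le_sum fun i _ => ?_)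
    set u := b i - mb
    set w := a i - b i - (ma - mb)
    have e1 : (a i - ma) ^ 2 - u ^ 2 = w ^ 2 + 2 * (u * w) := by simp only [u, w]; ring
    have e2 : |2 * (u * w)| ≤ ε⁻¹ * w ^ 2 + ε * u ^ 2 := by
      have h5 : 0 ≤ ε⁻¹ * (w - ε * u) ^ 2 := by positivity
      have h6 : 0 ≤ ε⁻¹ * (w + ε * u) ^ 2 := by positivity
      have h7 : ε⁻¹ * (w - ε * u) ^ 2 = ε⁻¹ * w ^ 2 + ε * u ^ 2 - 2 * (u * w) := by
        field_simp; ring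
      have h8 : ε⁻¹ * (w + ε * u) ^ 2 = ε⁻¹ * w ^ 2 + ε * u ^ 2 + 2 * (u * w) := by
        field_simp; ring
      rw [abs_le]; constructor <;> linarith
    rw [e1]
    refine (abs_add_le _ _).trans ?_
    rw [abs_of_nonneg (sq_nonneg w)]
    linarith
  refine h1.trans ?_
  have : 0 ≤ 1 + ε⁻¹ := by positivity
  nlinarith [mul_le_mul_of_nonneg_left hc this]

end Algebra

/-! ### U-statistics with varying kernels -/

section Limit

theorem MeasureTheory.TendstoInMeasure.add_of_zero {Ω : Type*} [MeasurableSpace Ω]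
    {P : Measure Ω} [IsProbabilityMeasure P] {Z W : ℕ → Ω → ℝ} {c : ℝ}
    (hZ : TendstoInMeasure P Z atTop (fun _ => (0 : ℝ)))
    (hW : TendstoInMeasure P W atTop (fun _ => c)) :
    TendstoInMeasure P (fun n ω => Z n ω + W n ω) atTop (fun _ => c) := by
  rw [tendstoInMeasure_iff_measureReal_norm] at *
  intro ε hε
  have := (hZ (ε / 2) (by positivity)).add (hW (ε / 2) (by positivity))
  rw [add_zero] at this
  refine squeeze_zero (fun n => measureReal_nonneg) (fun n => ?_) this
  refine (measureReal_mono ?_).trans (measureReal_union_le _ _)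
  intro ω hω
  simp only [mem_ofPred_eq, mem_union, Real.norm_eq_abs, sub_zero] at *
  by_contra hcon
  push Not at hcon
  have := abs_add_le (Z n ω) (W n ω - c)
  rw [← add_sub_assoc] at this
  linarith [hcon.1, hcon.2]

theorem MeasureTheory.TendstoInMeasure.mul_of_tendsto_one {Ω : Type*} [MeasurableSpace Ω]
    {P : Measure Ω} [IsProbabilityMeasure P] {W : ℕ → Ω → ℝ} {c : ℝ} {a : ℕ → ℝ}
    (ha : Tendsto a atTop (𝓝 1)) (hW : TendstoInMeasure P W atTop (fun _ => c)) :
    TendstoInMeasure P (fun n ω => a n * W n ω) atTop (fun _ => c) := by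
  rw [tendstoInMeasure_iff_measureReal_norm] at *
  intro ε hε
  have h1 : ∀ᶠ n in atTop, |a n| < 2 := by
    have := ha.abs.eventually_lt_const (u := 2) (by simp)
    exact this
  have h2 : ∀ᶠ n in atTop, |a n - 1| * |c| < ε / 2 := by
    have := (((ha.sub_const 1).abs).mul_const |c|).eventually_lt_const (u := ε / 2)
      (by simpa using hε)
    exact this
  refine tendsto_of_tendsto_of_tendsto_of_le_of_le' tendsto_const_nhds (hW (ε / 4) (by positivity))
    (Eventually.of_forall fun n => measureReal_nonneg) ?_
  filter_upwards [h1, h2] with n h1 h2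
  refine measureReal_mono ?_
  intro ω hω
  simp only [mem_ofPred_eq, Real.norm_eq_abs] at *
  have h3 := abs_add_le (a n * (W n ω - c)) ((a n - 1) * c)
  have h4 : a n * (W n ω - c) + (a n - 1) * c = a n * W n ω - c := by ring
  rw [h4, abs_mul, abs_mul] at h3
  nlinarith [abs_nonneg (W n ω - c)]

variable {Ω S : Type*} [MeasurableSpace Ω] [MeasurableSpace S] {P : Measure Ω}
  [IsProbabilityMeasure P] {ν : Measure S} [IsProbabilityMeasure ν] {X : ℕ → Ω → S}

omit [IsProbabilityMeasure ν] in
/-- The Hoeffding decomposition of the `U`-statistic. -/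
theorem uStat_eq_degenerate_add_mean_sub {H : S × S → ℝ} {n : ℕ} (hn : 2 ≤ n) (x : ℕ → S) :
    uStat H (Finset.range n) x = uStat (degeneratePart ν H) (Finset.range n) x
      + 2 * ((n : ℝ)⁻¹ * ∑ i ∈ Finset.range n, hajekProj ν H (x i)) - ∫ y, hajekProj ν H y ∂ν := by
  have hn' : (2 : ℝ) ≤ n := by exact_mod_cast hn
  have e1 : (n : ℝ) ≠ 0 := by linarith
  have e2 : (n : ℝ) - 1 ≠ 0 := by linarith
  set θ := ∫ y, hajekProj ν H y ∂ν with hθ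
  have hcard : ∀ i ∈ Finset.range n, (((Finset.range n).erase i).card : ℝ) = (n : ℝ) - 1 := by
    intro i hi
    rw [Finset.card_erase_of_mem hi, Finset.card_range, Nat.cast_sub (by omega)]; simp
  have h1 : ∑ q ∈ (Finset.range n).offDiag, hajekProj ν H (x q.1)
      = ((n : ℝ) - 1) * ∑ i ∈ Finset.range n, hajekProj ν H (x i) := by
    rw [sum_offDiag_eq_sum_sum, Finset.mul_sum]
    refine Finset.sum_congr rfl fun i hi => ?_
    simp only [Finset.sum_const, nsmul_eq_mul, hcard i hi]
  have h2 : ∑ q ∈ (Finset.range n).offDiag, hajekProj ν H (x q.2)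
      = ((n : ℝ) - 1) * ∑ i ∈ Finset.range n, hajekProj ν H (x i) := by
    rw [← h1]
    refine Finset.sum_bij' (fun q _ => q.swap) (fun q _ => q.swap) ?_ ?_ ?_ ?_ ?_
    · intro q hq
      have := Finset.mem_offDiag.1 hq
      exact Finset.mem_offDiag.2 ⟨this.2.1, this.1, this.2.2.symm⟩
    · intro q hq
      have := Finset.mem_offDiag.1 hq
      exact Finset.mem_offDiag.2 ⟨this.2.1, this.1, this.2.2.symm⟩
    all_goals intros; rfl
  have h3 : ∑ q ∈ (Finset.range n).offDiag, θ = n * ((n : ℝ) - 1) * θ := by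
    rw [sum_offDiag_eq_sum_sum]
    simp only [Finset.sum_const, nsmul_eq_mul]
    rw [Finset.sum_congr rfl fun i hi => by rw [hcard i hi]]
    simp only [Finset.sum_const, nsmul_eq_mul, Finset.card_range]
    ring
  simp only [uStat, degeneratePart, Finset.sum_add_distrib, Finset.sum_sub_distrib,
    Finset.card_range]
  rw [h1, h2, ← hθ, h3]
  field_simp
  ring

omit [IsProbabilityMeasure P] [IsProbabilityMeasure ν] in
theorem memLp_sum_comp {s : Finset ℕ} (hX : ∀ i, Measurable (X i)) (hlaw : ∀ i, P.map (X i) = ν)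
    {g : S → ℝ} (hg : MemLp g 2 ν) : MemLp (fun ω => ∑ i ∈ s, g (X i ω)) 2 P :=
  memLp_finsetSum s fun i _ => hg.comp_measurePreserving ⟨hX i, hlaw i⟩

theorem memLp_uStat {H : S × S → ℝ} (hX : ∀ i, Measurable (X i)) (hind : iIndepFun X P)
    (hlaw : ∀ i, P.map (X i) = ν) (hH2 : MemLp H 2 (ν.prod ν)) (s : Finset ℕ) :
    MemLp (fun ω => ∑ q ∈ s.offDiag, H (X q.1 ω, X q.2 ω)) 2 P :=
  memLp_finsetSum _ fun _ hq => hH2.comp_measurePreserving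
    (measurePreserving_pair hX hind hlaw (Finset.mem_offDiag.1 hq).2.2)

omit [IsProbabilityMeasure P] [IsProbabilityMeasure ν] in
theorem integral_comp_eq (hX : ∀ i, Measurable (X i)) (hlaw : ∀ i, P.map (X i) = ν)
    {g : S → ℝ} (hg : Measurable g) (i : ℕ) : ∫ ω, g (X i ω) ∂P = ∫ x, g x ∂ν := by
  rw [← hlaw i, integral_map (hX i).aemeasurable hg.aestronglyMeasurable]

/-- Variance of a sum of i.i.d. centred variables. -/
theorem integral_sum_centered_sq (hX : ∀ i, Measurable (X i)) (hind : iIndepFun X P)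
    (hlaw : ∀ i, P.map (X i) = ν) {g : S → ℝ} (hgm : Measurable g) (hg : MemLp g 2 ν) (n : ℕ) :
    ∫ ω, (∑ i ∈ Finset.range n, (g (X i ω) - ∫ x, g x ∂ν)) ^ 2 ∂P ≤ n * ∫ x, g x ^ 2 ∂ν := by
  have hgi : ∀ i, MemLp (fun ω => g (X i ω)) 2 P :=
    fun i => hg.comp_measurePreserving ⟨hX i, hlaw i⟩
  have h1 : Var[∑ i ∈ Finset.range n, fun ω => g (X i ω); P]
      = ∑ i ∈ Finset.range n, Var[fun ω => g (X i ω); P] :=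
    IndepFun.variance_sum (fun i _ => hgi i)
      fun i _ j _ hij => (hind.indepFun hij).comp hgm hgm
  have h2 : ∀ i, Var[fun ω => g (X i ω); P] ≤ ∫ x, g x ^ 2 ∂ν := by
    intro i
    refine (variance_le_expectation_sq (hgi i).aestronglyMeasurable).trans (le_of_eq ?_)
    exact integral_comp_eq hX hlaw (hgm.pow_const 2) i
  have hms : MemLp (∑ i ∈ Finset.range n, fun ω => g (X i ω)) 2 P := by
    have := memLp_sum_comp (s := Finset.range n) hX hlaw hg
    convert this using 1
    ext ω; simp
  rw [variance_eq_integral hms.aemeasurable] at h1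
  have h3 : ∫ ω, (∑ i ∈ Finset.range n, fun ω => g (X i ω)) ω ∂P = n * ∫ x, g x ∂ν := by
    simp only [Finset.sum_apply]
    rw [integral_finsetSum _ fun i _ => (hgi i).integrable one_le_two]
    simp [integral_comp_eq hX hlaw hgm]
  rw [h3] at h1
  have h4 : ∀ ω, (∑ i ∈ Finset.range n, (g (X i ω) - ∫ x, g x ∂ν))
      = (∑ i ∈ Finset.range n, fun ω => g (X i ω)) ω - n * ∫ x, g x ∂ν := by
    intro ω; simp
  simp_rw [h4]
  rw [h1]
  refine (Finset.sum_le_sum fun i _ => h2 i).trans (le_of_eq ?_)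
  simp

/-- Linearization of a `U`-statistic with varying kernels: it is asymptotically equivalent to a
normalized sum of i.i.d. variables as soon as the kernels have second moments `o(n)`, the
projections converge and the bias is `o(n^{-1/2})`. -/
theorem uStat_linearization (hX : ∀ i, Measurable (X i)) (hind : iIndepFun X P)
    (hlaw : ∀ i, P.map (X i) = ν) {H : ℕ → S × S → ℝ} (hHm : ∀ n, Measurable (H n))
    (hHs : ∀ n x y, H n (x, y) = H n (y, x)) (hH2 : ∀ᶠ n in atTop, MemLp (H n) 2 (ν.prod ν))
    (hV : Tendsto (fun n : ℕ => (∫ z, H n z ^ 2 ∂(ν.prod ν)) / n) atTop (𝓝 0))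
    {r : S → ℝ} (hrm : Measurable r) (hr : MemLp r 2 ν)
    (hb : Tendsto (fun n => ∫ x, (hajekProj ν (H n) x - r x) ^ 2 ∂ν) atTop (𝓝 0))
    (hθ : Tendsto (fun n : ℕ => √(n : ℝ) * (∫ x, hajekProj ν (H n) x ∂ν - ∫ x, r x ∂ν))
      atTop (𝓝 0)) :
    TendstoInMeasure P (fun (n : ℕ) ω =>
      √(n : ℝ) * (uStat (H n) (Finset.range n) (fun i => X i ω) - ∫ x, r x ∂ν)
        - (√(n : ℝ))⁻¹ * ∑ i ∈ Finset.range n, 2 * (r (X i ω) - ∫ x, r x ∂ν)) atTop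
      (fun _ => (0 : ℝ)) := by
  set m := ∫ x, r x ∂ν with hm
  -- the degenerate part, the error of the projection, and the bias
  have hdec : ∀ n : ℕ, 2 ≤ n → MemLp (H n) 2 (ν.prod ν) → ∀ ω,
      √(n : ℝ) * (uStat (H n) (Finset.range n) (fun i => X i ω) - m)
        - (√(n : ℝ))⁻¹ * ∑ i ∈ Finset.range n, 2 * (r (X i ω) - m)
      = √(n : ℝ) * uStat (degeneratePart ν (H n)) (Finset.range n) (fun i => X i ω)
        + (2 * (√(n : ℝ))⁻¹ * ∑ i ∈ Finset.range n, ((hajekProj ν (H n) (X i ω) - r (X i ω))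
            - ∫ x, (hajekProj ν (H n) x - r x) ∂ν)
          + √(n : ℝ) * (∫ x, hajekProj ν (H n) x ∂ν - m)) := by
    intro n hn hHn ω
    have hs0 : √(n : ℝ) ≠ 0 := by positivity
    have hs : (n : ℝ) = √(n : ℝ) * √(n : ℝ) := (Real.mul_self_sqrt (by positivity)).symm
    rw [integral_sub ((memLp_hajekProj (hHm n) hHn).integrable one_le_two)
      (hr.integrable one_le_two), uStat_eq_degenerate_add_mean_sub (ν := ν) hn, ← hm]
    simp only [← Finset.mul_sum, Finset.sum_sub_distrib, Finset.sum_const, Finset.card_range,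
      nsmul_eq_mul]
    set σ := √(n : ℝ)
    rw [hs]
    field_simp
    ring
  refine tendstoInMeasure_zero_of_integral_sq (c := fun n : ℕ =>
      3 * (64 * ((∫ z, H n z ^ 2 ∂(ν.prod ν)) / n)
      + 4 * ∫ x, (hajekProj ν (H n) x - r x) ^ 2 ∂ν
      + (√(n : ℝ) * (∫ x, hajekProj ν (H n) x ∂ν - m)) ^ 2)) ?_ ?_ ?_
  · filter_upwards [hH2] with n hn
    refine MemLp.sub (MemLp.const_mul (MemLp.sub (MemLp.const_mul ?_ _) (memLp_const _)) _)
      (MemLp.const_mul ?_ _)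
    · exact memLp_uStat hX hind hlaw hn _
    · exact memLp_sum_comp hX hlaw ((hr.sub (memLp_const m)).const_mul 2)
  · filter_upwards [hH2, eventually_ge_atTop 2] with n hn hn2
    have hn' : (2 : ℝ) ≤ n := by exact_mod_cast hn2
    have hn1 : 0 < (n : ℝ) - 1 := by linarith
    have hVn : 0 ≤ ∫ z, H n z ^ 2 ∂(ν.prod ν) := integral_nonneg fun z => sq_nonneg _
    have hbr : MemLp (fun x => hajekProj ν (H n) x - r x) 2 ν := (memLp_hajekProj (hHm n) hn).sub hr
    have hbrm : Measurable (fun x => hajekProj ν (H n) x - r x) :=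
      (measurable_hajekProj (hHm n)).sub hrm
    simp_rw [hdec n hn2 hn]
    set A : Ω → ℝ := fun ω =>
      √(n : ℝ) * uStat (degeneratePart ν (H n)) (Finset.range n) (fun i => X i ω) with hA
    set C : Ω → ℝ := fun ω => 2 * (√(n : ℝ))⁻¹ * ∑ i ∈ Finset.range n,
      ((hajekProj ν (H n) (X i ω) - r (X i ω)) - ∫ x, (hajekProj ν (H n) x - r x) ∂ν) with hC
    set t := √(n : ℝ) * (∫ x, hajekProj ν (H n) x ∂ν - m) with ht
    have hAm : MemLp A 2 P := MemLp.const_mul (MemLp.const_mul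
      (memLp_uStat hX hind hlaw (memLp_degeneratePart (hHm n) hn) _) _) _
    have hCm : MemLp C 2 P := MemLp.const_mul
      (memLp_sum_comp (g := fun x => (hajekProj ν (H n) x - r x)
        - ∫ x, (hajekProj ν (H n) x - r x) ∂ν) hX hlaw (hbr.sub (memLp_const _))) _
    have hA2 : ∫ ω, A ω ^ 2 ∂P ≤ 64 * ((∫ z, H n z ^ 2 ∂(ν.prod ν)) / n) := by
      have h1 := integral_offDiag_sq_le hX hind hlaw (measurable_degeneratePart (hHm n))
        (memLp_degeneratePart (hHm n) hn) (fun x y => by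
          simp only [degeneratePart, hHs n x y]; ring)
        (integral_degeneratePart_eq_zero (hHm n) hn) (Finset.range n)
      have h2 := integral_degeneratePart_sq_le (hHm n) hn
      have hcard : ((Finset.range n).offDiag.card : ℝ) = n * ((n : ℝ) - 1) := by
        rw [Finset.offDiag_card, Finset.card_range, Nat.cast_sub (Nat.le_mul_self n)]
        push_cast; ring
      rw [hcard] at h1
      have h3 : ∀ ω, A ω ^ 2 = n * ((n * ((n : ℝ) - 1))⁻¹) ^ 2 *
          (∑ q ∈ (Finset.range n).offDiag, degeneratePart ν (H n) (X q.1 ω, X q.2 ω)) ^ 2 := by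
        intro ω
        simp only [hA, uStat, Finset.card_range]
        rw [mul_pow, mul_pow, Real.sq_sqrt (by positivity)]; ring
      simp_rw [h3]
      rw [integral_const_mul]
      calc _ ≤ n * ((n * ((n : ℝ) - 1))⁻¹) ^ 2 * (2 * (n * ((n : ℝ) - 1)) *
            (16 * ∫ z, H n z ^ 2 ∂(ν.prod ν))) := by
            refine mul_le_mul_of_nonneg_left (h1.trans ?_) (by positivity)
            exact mul_le_mul_of_nonneg_left h2 (by positivity)
        _ = 32 * (∫ z, H n z ^ 2 ∂(ν.prod ν)) * ((n : ℝ) - 1)⁻¹ := by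
            field_simp; ring
        _ ≤ 32 * (∫ z, H n z ^ 2 ∂(ν.prod ν)) * (2 * (n : ℝ)⁻¹) := by
            refine mul_le_mul_of_nonneg_left ?_ (by positivity)
            rw [inv_le_comm₀ hn1 (by positivity), mul_inv, inv_inv]; linarith
        _ = _ := by ring
    have hC2 : ∫ ω, C ω ^ 2 ∂P ≤ 4 * ∫ x, (hajekProj ν (H n) x - r x) ^ 2 ∂ν := by
      have h1 := integral_sum_centered_sq hX hind hlaw hbrm hbr n
      simp only [hC, mul_pow]
      rw [integral_const_mul]
      calc _ ≤ 2 ^ 2 * (√(n : ℝ))⁻¹ ^ 2 * (n * ∫ x, (hajekProj ν (H n) x - r x) ^ 2 ∂ν) :=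
            mul_le_mul_of_nonneg_left h1 (by positivity)
        _ = _ := by
            rw [inv_pow, Real.sq_sqrt (by positivity)]; field_simp; ring
    have hint : Integrable (fun ω => A ω ^ 2 + C ω ^ 2) P := hAm.integrable_sq.add hCm.integrable_sq
    have hint2 : Integrable (fun ω => A ω ^ 2 + C ω ^ 2 + t ^ 2) P := hint.add (integrable_const _)
    calc ∫ ω, (A ω + (C ω + t)) ^ 2 ∂P ≤ ∫ ω, 3 * (A ω ^ 2 + C ω ^ 2 + t ^ 2) ∂P := by
          refine integral_mono (hAm.add (hCm.add (memLp_const t))).integrable_sq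
            (hint2.const_mul 3) fun ω => ?_
          nlinarith [sq_nonneg (A ω - C ω), sq_nonneg (A ω - t), sq_nonneg (C ω - t)]
      _ = 3 * (∫ ω, A ω ^ 2 ∂P + ∫ ω, C ω ^ 2 ∂P + t ^ 2) := by
          rw [integral_const_mul, integral_add hint (integrable_const _),
            integral_add hAm.integrable_sq hCm.integrable_sq]
          simp
      _ ≤ _ := by linarith
  · have := ((hV.const_mul 64).add (hb.const_mul 4)).add (hθ.pow 2)
    simpa using this.const_mul 3

/-- The row means of the kernel matrix approximate the limiting projection in mean square. -/
theorem integral_rowMean_sub_sq_le (hX : ∀ i, Measurable (X i)) (hind : iIndepFun X P)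
    (hlaw : ∀ i, P.map (X i) = ν) {H : S × S → ℝ} (hHm : Measurable H)
    (hH2 : MemLp H 2 (ν.prod ν)) {r : S → ℝ} (hrm : Measurable r) (hr : MemLp r 2 ν) {n : ℕ}
    (hn : 2 ≤ n) {i : ℕ} (hi : i < n) :
    ∫ ω, (rowMean H n (fun j => X j ω) i - r (X i ω)) ^ 2 ∂P
      ≤ 16 * ((n : ℝ) - 1)⁻¹ * ∫ z, H z ^ 2 ∂(ν.prod ν)
        + 2 * ∫ x, (hajekProj ν H x - r x) ^ 2 ∂ν := by
  have hn' : (2 : ℝ) ≤ n := by exact_mod_cast hn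
  have hn1 : 0 < (n : ℝ) - 1 := by linarith
  have hcard : (((Finset.range n).erase i).card : ℝ) = (n : ℝ) - 1 := by
    rw [Finset.card_erase_of_mem (Finset.mem_range.2 hi), Finset.card_range,
      Nat.cast_sub (by omega)]; simp
  set A : Ω → ℝ := fun ω => ∑ j ∈ (Finset.range n).erase i, rowCentered ν H (X i ω, X j ω) with hA
  set C : Ω → ℝ := fun ω => hajekProj ν H (X i ω) - r (X i ω) with hC
  have hAm : MemLp A 2 P := memLp_finsetSum _ fun _ hj =>
    (memLp_rowCentered hHm hH2).comp_measurePreserving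
      (measurePreserving_pair hX hind hlaw (Finset.mem_erase.1 hj).1.symm)
  have hCm : MemLp C 2 P :=
    ((memLp_hajekProj hHm hH2).sub hr).comp_measurePreserving ⟨hX i, hlaw i⟩
  have hA2 : ∫ ω, A ω ^ 2 ∂P ≤ 2 * ((n : ℝ) - 1) * (4 * ∫ z, H z ^ 2 ∂(ν.prod ν)) := by
    have h1 := integral_sum_row_sq_le hX hind hlaw (measurable_rowCentered hHm)
      (memLp_rowCentered hHm hH2) (integral_rowCentered_eq_zero hHm hH2)
      (Finset.notMem_erase i (Finset.range n))
    rw [hcard] at h1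
    exact h1.trans (mul_le_mul_of_nonneg_left (integral_rowCentered_sq_le hHm hH2) (by positivity))
  have hC2 : ∫ ω, C ω ^ 2 ∂P = ∫ x, (hajekProj ν H x - r x) ^ 2 ∂ν :=
    integral_comp_eq (g := fun x => (hajekProj ν H x - r x) ^ 2) hX hlaw
      (((measurable_hajekProj hHm).sub hrm).pow_const 2) i
  have hdec : ∀ ω, rowMean H n (fun j => X j ω) i - r (X i ω) = ((n : ℝ) - 1)⁻¹ * A ω + C ω := by
    intro ω
    simp only [hA, hC, rowMean, rowCentered, Finset.sum_sub_distrib, Finset.sum_const, hcard,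
      nsmul_eq_mul]
    field_simp
    ring
  simp_rw [hdec]
  have i1 : Integrable (fun ω => 2 * ((n : ℝ) - 1)⁻¹ ^ 2 * A ω ^ 2) P :=
    hAm.integrable_sq.const_mul _
  have i2 : Integrable (fun ω => 2 * C ω ^ 2) P := hCm.integrable_sq.const_mul _
  calc _ ≤ ∫ ω, (2 * ((n : ℝ) - 1)⁻¹ ^ 2 * A ω ^ 2 + 2 * C ω ^ 2) ∂P := by
        refine integral_mono ((hAm.const_mul _).add hCm).integrable_sq (i1.add i2) fun ω => ?_
        nlinarith [sq_nonneg (((n : ℝ) - 1)⁻¹ * A ω - C ω)]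
    _ = 2 * ((n : ℝ) - 1)⁻¹ ^ 2 * ∫ ω, A ω ^ 2 ∂P + 2 * ∫ ω, C ω ^ 2 ∂P := by
        rw [integral_add i1 i2, integral_const_mul, integral_const_mul]
    _ ≤ 2 * ((n : ℝ) - 1)⁻¹ ^ 2 * (2 * ((n : ℝ) - 1) * (4 * ∫ z, H z ^ 2 ∂(ν.prod ν)))
        + 2 * ∫ ω, C ω ^ 2 ∂P := by
        have := mul_le_mul_of_nonneg_left hA2 (by positivity : 0 ≤ 2 * ((n : ℝ) - 1)⁻¹ ^ 2)
        linarith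
    _ = _ := by rw [hC2]; field_simp; ring

theorem memLp_rowMean (hX : ∀ i, Measurable (X i)) (hind : iIndepFun X P)
    (hlaw : ∀ i, P.map (X i) = ν) {H : S × S → ℝ} (hH2 : MemLp H 2 (ν.prod ν)) (n i : ℕ) :
    MemLp (fun ω => rowMean H n (fun j => X j ω) i) 2 P :=
  (memLp_finsetSum _ fun _ hj => hH2.comp_measurePreserving
    (measurePreserving_pair hX hind hlaw (Finset.mem_erase.1 hj).1.symm)).const_mul _

/-- Law of large numbers for the empirical variance. -/
theorem ae_tendsto_empVar (hX : ∀ i, Measurable (X i)) (hind : iIndepFun X P)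
    (hlaw : ∀ i, P.map (X i) = ν) {r : S → ℝ} (hrm : Measurable r) (hr : MemLp r 2 ν) :
    ∀ᵐ ω ∂P, Tendsto (fun n : ℕ => empVar n (fun i => r (X i ω))) atTop (𝓝 (Var[r; ν])) := by
  have hid : ∀ (g : S → ℝ), Measurable g → ∀ i,
      IdentDistrib (fun ω => g (X i ω)) (fun ω => g (X 0 ω)) P P := fun g hg i =>
    (IdentDistrib.mk (hX i).aemeasurable (hX 0).aemeasurable
      ((hlaw i).trans (hlaw 0).symm)).comp hg
  have hL : ∀ (g : S → ℝ), Measurable g → Integrable g ν → ∀ᵐ ω ∂P,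
      Tendsto (fun n : ℕ => (n : ℝ)⁻¹ * ∑ i ∈ Finset.range n, g (X i ω)) atTop
        (𝓝 (∫ x, g x ∂ν)) := by
    intro g hg hgi
    have hi : Integrable (fun ω => g (X 0 ω)) P :=
      (MeasurePreserving.mk (hX 0) (hlaw 0)).integrable_comp_of_integrable hgi
    have := strong_law_ae_real (fun i ω => g (X i ω)) hi
      (fun i j hij => (hind.indepFun hij).comp hg hg) (hid g hg)
    filter_upwards [this] with ω hω
    rw [integral_comp_eq hX hlaw hg] at hω
    simpa [div_eq_inv_mul] using hω
  filter_upwards [hL r hrm (hr.integrable one_le_two),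
    hL (fun x => r x ^ 2) (hrm.pow_const 2) hr.integrable_sq] with ω h1 h2
  have h3 : Var[r; ν] = ∫ x, r x ^ 2 ∂ν - (∫ x, r x ∂ν) ^ 2 := variance_eq_sub hr
  rw [h3]
  refine (h2.sub (h1.pow 2)).congr' ?_
  filter_upwards [eventually_gt_atTop 0] with n hn
  rw [empVar_eq hn]

/-- Consistency of the empirical variance of the row means. -/
theorem tendstoInMeasure_empVar_rowMean (hX : ∀ i, Measurable (X i)) (hind : iIndepFun X P)
    (hlaw : ∀ i, P.map (X i) = ν) {H : ℕ → S × S → ℝ} (hHm : ∀ n, Measurable (H n))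
    (hH2 : ∀ᶠ n in atTop, MemLp (H n) 2 (ν.prod ν))
    (hV : Tendsto (fun n : ℕ => (∫ z, H n z ^ 2 ∂(ν.prod ν)) / n) atTop (𝓝 0))
    {r : S → ℝ} (hrm : Measurable r) (hr : MemLp r 2 ν)
    (hb : Tendsto (fun n => ∫ x, (hajekProj ν (H n) x - r x) ^ 2 ∂ν) atTop (𝓝 0)) :
    TendstoInMeasure P (fun (n : ℕ) ω => empVar n (rowMean (H n) n (fun i => X i ω))) atTop
      (fun _ => Var[r; ν]) := by
  have hri : ∀ i, MemLp (fun ω => r (X i ω)) 2 P :=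
    fun i => hr.comp_measurePreserving ⟨hX i, hlaw i⟩
  -- a bound `D n` for the mean square distance between row means and limits; the summand `n⁻¹` makes
  -- it positive, so that `ε = √(D n)` may be used in `abs_empVar_sub_le`
  set D : ℕ → ℝ := fun n => 32 * ((∫ z, H n z ^ 2 ∂(ν.prod ν)) / n)
        + 2 * ∫ x, (hajekProj ν (H n) x - r x) ^ 2 ∂ν + (n : ℝ)⁻¹ with hD
  have hD0 : Tendsto D atTop (𝓝 0) := by
    have := ((hV.const_mul 32).add (hb.const_mul 2)).add (tendsto_inv_atTop_nhds_zero_nat (𝕜 := ℝ))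
    simpa using this
  have key : TendstoInMeasure P (fun (n : ℕ) ω => empVar n (rowMean (H n) n (fun i => X i ω))
      - empVar n (fun i => r (X i ω))) atTop (fun _ => (0 : ℝ)) := by
    refine tendstoInMeasure_zero_of_integral_abs (c := fun n =>
      D n + √(D n) + √(D n) * ∫ x, r x ^ 2 ∂ν) ?_ ?_ ?_
    · filter_upwards [hH2] with n hn
      have hc : ∀ a : ℕ → Ω → ℝ, (∀ i, MemLp (a i) 2 P) →
          Integrable (fun ω => empVar n (fun i => a i ω)) P := by
        intro a ha
        unfold empVar
        refine Integrable.const_mul (integrable_finsetSum _ fun i _ => MemLp.integrable_sq ?_) _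
        exact (ha i).sub ((memLp_finsetSum _ fun j _ => ha j).const_mul _)
      exact (hc _ fun i => memLp_rowMean hX hind hlaw hn n i).sub (hc _ hri)
    · filter_upwards [hH2, eventually_ge_atTop 2] with n hn hn2
      have hn' : (2 : ℝ) ≤ n := by exact_mod_cast hn2
      have hn1 : 0 < (n : ℝ) - 1 := by linarith
      have hVn : 0 ≤ ∫ z, H n z ^ 2 ∂(ν.prod ν) := integral_nonneg fun z => sq_nonneg _
      have hbn : 0 ≤ ∫ x, (hajekProj ν (H n) x - r x) ^ 2 ∂ν := integral_nonneg fun z => sq_nonneg _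
      have hDn : 0 < D n := by simp only [hD]; positivity
      have hT := fun i => memLp_rowMean hX hind hlaw hn n i
      have hd : ∀ i, Integrable
          (fun ω => (rowMean (H n) n (fun i => X i ω) i - r (X i ω)) ^ 2) P :=
        fun i => ((hT i).sub (hri i)).integrable_sq
      have hq : ∀ i, Integrable (fun ω => r (X i ω) ^ 2) P := fun i => (hri i).integrable_sq
      have hε : 0 < √(D n) := Real.sqrt_pos.2 hDn
      have i1 : Integrable (fun ω => (1 + (√(D n))⁻¹) * ((n : ℝ)⁻¹ * ∑ i ∈ Finset.range n,
          (rowMean (H n) n (fun i => X i ω) i - r (X i ω)) ^ 2)) P :=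
        ((integrable_finsetSum _ fun i _ => hd i).const_mul _).const_mul _
      have i2 : Integrable (fun ω => √(D n) * ((n : ℝ)⁻¹ * ∑ i ∈ Finset.range n,
          r (X i ω) ^ 2)) P :=
        ((integrable_finsetSum _ fun i _ => hq i).const_mul _).const_mul _
      have hED : (n : ℝ)⁻¹ * ∑ i ∈ Finset.range n,
          ∫ ω, (rowMean (H n) n (fun i => X i ω) i - r (X i ω)) ^ 2 ∂P ≤ D n := by
        have h3 : ∀ i ∈ Finset.range n,
            ∫ ω, (rowMean (H n) n (fun i => X i ω) i - r (X i ω)) ^ 2 ∂P ≤ D n := by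
          intro i hi
          refine (integral_rowMean_sub_sq_le hX hind hlaw (hHm n) hn hrm hr hn2
            (Finset.mem_range.1 hi)).trans ?_
          have h4 : ((n : ℝ) - 1)⁻¹ ≤ 2 * (n : ℝ)⁻¹ := by
            rw [inv_le_comm₀ hn1 (by positivity), mul_inv, inv_inv]; linarith
          have h5 := mul_le_mul_of_nonneg_right h4 hVn
          have h6 : 0 ≤ (n : ℝ)⁻¹ := by positivity
          simp only [hD, div_eq_mul_inv]
          nlinarith
        calc _ ≤ (n : ℝ)⁻¹ * ∑ i ∈ Finset.range n, D n :=
              mul_le_mul_of_nonneg_left (Finset.sum_le_sum h3) (by positivity)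
          _ = D n := by simp; field_simp
      calc _ ≤ ∫ ω, ((1 + (√(D n))⁻¹) * ((n : ℝ)⁻¹ * ∑ i ∈ Finset.range n,
              (rowMean (H n) n (fun i => X i ω) i - r (X i ω)) ^ 2)
              + √(D n) * ((n : ℝ)⁻¹ * ∑ i ∈ Finset.range n, r (X i ω) ^ 2)) ∂P := by
            refine integral_mono_of_nonneg (Eventually.of_forall fun ω => abs_nonneg _)
              (i1.add i2) (Eventually.of_forall fun ω => ?_)
            refine (abs_empVar_sub_le (by omega) _ _ hε).trans ?_
            exact add_le_add le_rfl (mul_le_mul_of_nonneg_left (empVar_le (by omega) _) hε.le)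
        _ = (1 + (√(D n))⁻¹) * ((n : ℝ)⁻¹ * ∑ i ∈ Finset.range n,
              ∫ ω, (rowMean (H n) n (fun i => X i ω) i - r (X i ω)) ^ 2 ∂P)
              + √(D n) * ∫ x, r x ^ 2 ∂ν := by
            rw [integral_add i1 i2, integral_const_mul, integral_const_mul, integral_const_mul,
              integral_const_mul, integral_finsetSum _ fun i _ => hd i,
              integral_finsetSum _ fun i _ => hq i]
            have : ∀ i, ∫ ω, r (X i ω) ^ 2 ∂P = ∫ x, r x ^ 2 ∂ν :=
              integral_comp_eq hX hlaw (hrm.pow_const 2)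
            simp only [this, Finset.sum_const, Finset.card_range, nsmul_eq_mul]
            field_simp
        _ ≤ (1 + (√(D n))⁻¹) * D n + √(D n) * ∫ x, r x ^ 2 ∂ν :=
            add_le_add (mul_le_mul_of_nonneg_left hED (by positivity)) le_rfl
        _ = _ := by
            have : (√(D n))⁻¹ * D n = √(D n) := by
              rw [inv_mul_eq_div, Real.div_sqrt]
            rw [add_mul, this, one_mul]
    · have h1 : Tendsto (fun n => √(D n)) atTop (𝓝 0) := by
        have := (Real.continuous_sqrt.tendsto 0).comp hD0
        rwa [Real.sqrt_zero] at this
      simpa using (hD0.add h1).add (h1.mul_const (∫ x, r x ^ 2 ∂ν))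
  have h2 : TendstoInMeasure P (fun (n : ℕ) ω => empVar n (fun i => r (X i ω))) atTop
      (fun _ => Var[r; ν]) := by
    refine tendstoInMeasure_of_tendsto_ae (fun n => ?_)
      (ae_tendsto_empVar hX hind hlaw hrm hr)
    unfold empVar
    exact Measurable.aestronglyMeasurable (by fun_prop)
  refine (key.add_of_zero h2).congr_left fun n => Eventually.of_forall fun ω => ?_
  simp

end Limit

/-! ### Coverage of the jackknife interval -/

/-- By continuity of the distribution function, the infimum that defines the quantile is attained with
equality. -/
theorem stdNormalQuantile_spec {q : ℝ} (hq0 : 0 < q) (hq1 : q < 1) :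
    cdf (gaussianReal 0 1) (stdNormalQuantile q) = q := by
  have hna := nullSingletonClass_gaussianReal (μ := 0) (v := 1) one_ne_zero
  have hcont : Continuous (cdf (gaussianReal 0 1)) := by
    rw [continuous_iff_continuousAt]
    intro x
    have h := (cdf (gaussianReal 0 1)).measure_singleton x
    rw [measure_cdf, measure_singleton] at h
    rw [(monotone_cdf (gaussianReal 0 1)).continuousAt_iff_leftLim_eq_rightLim,
      StieltjesFunction.rightLim_eq]
    have h1 := ENNReal.ofReal_eq_zero.1 h.symm
    have h2 := (monotone_cdf (gaussianReal 0 1)).leftLim_le (le_refl x)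
    linarith
  obtain ⟨x0, hx0⟩ : ∃ x, cdf (gaussianReal 0 1) x = q := by
    have hlo := ((tendsto_cdf_atBot (gaussianReal 0 1)).eventually_lt_const hq0).exists
    have hhi := ((tendsto_cdf_atTop (gaussianReal 0 1)).eventually_const_lt hq1).exists
    obtain ⟨a, ha⟩ := hlo
    obtain ⟨b, hb⟩ := hhi
    exact mem_range_of_exists_le_of_exists_ge hcont ⟨a, ha.le⟩ ⟨b, hb.le⟩
  set A := {x : ℝ | q ≤ cdf (gaussianReal 0 1) x} with hA
  have hne : A.Nonempty := ⟨x0, hx0.ge⟩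
  have hbdd : BddBelow A := by
    obtain ⟨a, ha⟩ := ((tendsto_cdf_atBot (gaussianReal 0 1)).eventually_lt_const hq0).exists
    refine ⟨a, fun x hx => ?_⟩
    by_contra hlt
    exact absurd (hx.trans (monotone_cdf _ (not_le.1 hlt).le)) (not_le.2 ha)
  have hcl : IsClosed A := isClosed_le continuous_const hcont
  have hmem : q ≤ cdf (gaussianReal 0 1) (sInf A) := hcl.csInf_mem hne hbdd
  have hle : sInf A ≤ x0 := csInf_le hbdd hx0.ge
  exact le_antisymm ((monotone_cdf _ hle).trans hx0.le) hmem

theorem gaussianReal_Icc_quantile {α : ℝ} (hα0 : 0 < α) (hα1 : α < 1) :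
    0 < stdNormalQuantile (1 - α / 2) ∧
    (gaussianReal 0 1).real (Icc (-stdNormalQuantile (1 - α / 2)) (stdNormalQuantile (1 - α / 2)))
      = 1 - α := by
  have hna := nullSingletonClass_gaussianReal (μ := 0) (v := 1) one_ne_zero
  set q := stdNormalQuantile (1 - α / 2)
  have hq : cdf (gaussianReal 0 1) q = 1 - α / 2 := stdNormalQuantile_spec (by linarith) (by linarith)
  -- symmetry of the standard normal law
  have hsymm : ∀ x, cdf (gaussianReal 0 1) (-x) = 1 - cdf (gaussianReal 0 1) x := by
    intro x
    have h1 : (gaussianReal 0 1).map (fun y => -y) = gaussianReal 0 1 := by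
      have := gaussianReal_map_neg (μ := 0) (v := 1)
      simpa using this
    have h2 : (gaussianReal 0 1).real (Iic (-x)) = (gaussianReal 0 1).real (Ici x) := by
      conv_lhs => rw [← h1]
      rw [map_measureReal_apply measurable_neg measurableSet_Iic]
      congr 1; ext y; simp
    rw [cdf_eq_real, cdf_eq_real, h2, ← probReal_compl_eq_one_sub measurableSet_Iic, compl_Iic]
    exact measureReal_congr Ioi_ae_eq_Ici.symm
  have hpos : 0 < q := by
    by_contra hneg
    have h1 := monotone_cdf (gaussianReal 0 1) (by linarith [not_lt.1 hneg] : q ≤ -q)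
    rw [hsymm, hq] at h1
    linarith
  refine ⟨hpos, ?_⟩
  have h1 : (gaussianReal 0 1).real (Icc (-q) q) = (gaussianReal 0 1).real (Ioc (-q) q) :=
    measureReal_congr Ioc_ae_eq_Icc.symm
  have h2 : Iic q \ Iic (-q) = Ioc (-q) q := by ext; simp [and_comm]
  rw [h1, ← h2, measureReal_sdiff (Iic_subset_Iic.2 (by linarith)) measurableSet_Iic,
    ← cdf_eq_real, ← cdf_eq_real, hsymm, hq]
  ring

/-- If `T n` is asymptotically centred normal with standard deviation `2 σ` and `A n` is a
consistent estimator of `σ²`, the interval `|T n| ≤ 2 √(A n) q` has the nominal asymptotic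
probability. -/
theorem tendsto_coverage {Ω : Type*} [MeasurableSpace Ω] {P : Measure Ω} [IsProbabilityMeasure P]
    {T A : ℕ → Ω → ℝ} {σ : ℝ} (hσ : 0 < σ)
    (hT : TendstoInDistribution T atTop (fun z : ℝ => 2 * σ * z) (fun _ => P) (gaussianReal 0 1))
    (hA : TendstoInMeasure P A atTop (fun _ => σ ^ 2)) (hAm : ∀ n, Measurable (A n))
    {α : ℝ} (hα0 : 0 < α) (hα1 : α < 1) :
    Tendsto (fun n => P.real {ω | |T n ω| ≤ 2 * √(A n ω) * stdNormalQuantile (1 - α / 2)})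
      atTop (𝓝 (1 - α)) := by
  obtain ⟨hq, hcov⟩ := gaussianReal_Icc_quantile hα0 hα1
  have hna := nullSingletonClass_gaussianReal (μ := 0) (v := 1) one_ne_zero
  set q := stdNormalQuantile (1 - α / 2)
  have hslutsky := hT.continuous_comp_prodMk_of_tendstoInMeasure_const
    (g := fun x : ℝ × ℝ => |x.1| - 2 * √x.2 * q) (by fun_prop) hA fun n => (hAm n).aemeasurable
  have hset : ∀ z : ℝ, |2 * σ * z| - 2 * √(σ ^ 2) * q = 2 * σ * (|z| - q) := by
    intro z
    rw [Real.sqrt_sq hσ.le, abs_mul, abs_of_pos (by positivity)]; ring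
  have hport := ProbabilityMeasure.tendsto_measure_of_null_frontier_of_tendsto' hslutsky.tendsto
    (E := Iic 0) ?_
  · change Tendsto _ _ (𝓝 ((gaussianReal 0 1).map
      (fun z : ℝ => |2 * σ * z| - 2 * √(σ ^ 2) * q) (Iic 0))) at hport
    have hport2 := (ENNReal.tendsto_toReal (measure_ne_top _ _)).comp hport
    have hlim : ((gaussianReal 0 1).map fun z : ℝ => |2 * σ * z| - 2 * √(σ ^ 2) * q).real (Iic 0)
        = 1 - α := by
      rw [map_measureReal_apply (by fun_prop) measurableSet_Iic, ← hcov]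
      congr 1
      ext z
      simp only [mem_preimage, mem_Iic, mem_Icc, hset, ← abs_le]
      constructor
      · intro h; by_contra hlt
        have : 0 < 2 * σ * (|z| - q) := by
          have := sub_pos.2 (not_le.1 hlt); positivity
        linarith
      · intro h; exact mul_nonpos_of_nonneg_of_nonpos (by positivity) (by linarith)
    rw [← hlim]
    refine hport2.congr fun n => ?_
    have hTA : AEMeasurable (fun ω => |T n ω| - 2 * √(A n ω) * q) P := by
      have h1 := hT.forall_aemeasurable n
      have h2 := hAm n
      fun_prop
    simp only [Function.comp_apply, ProbabilityMeasure.coe_mk, Measure.real]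
    rw [Measure.map_apply_of_aemeasurable hTA measurableSet_Iic]
    congr 2
    ext ω
    simp
  · simp only [frontier_Iic, ProbabilityMeasure.coe_mk]
    rw [Measure.map_apply (by fun_prop) (measurableSet_singleton _)]
    refine measure_mono_null (t := {q, -q}) (fun z hz => ?_) ?_
    · simp only [mem_preimage, mem_singleton_iff, hset] at hz
      have : |z| = q := by
        rcases mul_eq_zero.1 hz with h | h
        · exact absurd h (by positivity)
        · linarith
      exact eq_or_eq_neg_of_abs_eq this
    · exact (Set.toFinite _).measure_zero _

section Limit
variable {Ω S : Type*} [MeasurableSpace Ω] [MeasurableSpace S] {P : Measure Ω}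
  [IsProbabilityMeasure P] {ν : Measure S} [IsProbabilityMeasure ν] {X : ℕ → Ω → S}

/-- Asymptotic coverage of the jackknife confidence interval for `U`-statistics of order two with
varying kernels. The variance estimator `V` is given through its form in `jackknife_sum_sq_eq`, which
requires `3 ≤ n`. -/
theorem tendsto_jackknife_coverage (hX : ∀ i, Measurable (X i)) (hind : iIndepFun X P)
    (hlaw : ∀ i, P.map (X i) = ν) {H : ℕ → S × S → ℝ} (hHm : ∀ n, Measurable (H n))
    (hHs : ∀ n x y, H n (x, y) = H n (y, x)) (hH2 : ∀ᶠ n in atTop, MemLp (H n) 2 (ν.prod ν))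
    (hV : Tendsto (fun n : ℕ => (∫ z, H n z ^ 2 ∂(ν.prod ν)) / n) atTop (𝓝 0))
    {r : S → ℝ} (hrm : Measurable r) (hr : MemLp r 2 ν)
    (hb : Tendsto (fun n => ∫ x, (hajekProj ν (H n) x - r x) ^ 2 ∂ν) atTop (𝓝 0))
    (hθ : Tendsto (fun n : ℕ => √(n : ℝ) * (∫ x, hajekProj ν (H n) x ∂ν - ∫ x, r x ∂ν))
      atTop (𝓝 0)) (hvar : 0 < Var[r; ν]) {V : ℕ → Ω → ℝ}
    (hJ : ∀ n, 3 ≤ n → ∀ ω, V n ω = (n : ℝ) * ((n : ℝ) - 1) / ((n : ℝ) - 2) ^ 2 *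
      empVar n (rowMean (H n) n (fun i => X i ω)))
    {α : ℝ} (hα0 : 0 < α) (hα1 : α < 1) :
    Tendsto (fun n : ℕ => P.real {ω | ∫ x, r x ∂ν ∈ Icc
      (uStat (H n) (Finset.range n) (fun i => X i ω) -
        2 * √(V n ω) / √(n : ℝ) * stdNormalQuantile (1 - α / 2))
      (uStat (H n) (Finset.range n) (fun i => X i ω) +
        2 * √(V n ω) / √(n : ℝ) * stdNormalQuantile (1 - α / 2))}) atTop (𝓝 (1 - α)) := by
  set m := ∫ x, r x ∂ν with hm
  set σ := √(Var[r; ν]) with hσdef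
  have hσ : 0 < σ := Real.sqrt_pos.2 hvar
  have hσ2 : σ ^ 2 = Var[r; ν] := Real.sq_sqrt hvar.le
  set T : ℕ → Ω → ℝ := fun n ω =>
    √(n : ℝ) * (uStat (H n) (Finset.range n) (fun i => X i ω) - m) with hTdef
  have hum : ∀ n, Measurable fun ω => uStat (H n) (Finset.range n) (fun i => X i ω) := by
    intro n
    have := hHm n
    unfold uStat
    fun_prop
  have hCLT : TendstoInDistribution (fun (n : ℕ) ω => (√(n : ℝ))⁻¹ *
      (∑ i ∈ Finset.range n, 2 * r (X i ω) - n * P[fun ω => 2 * r (X 0 ω)])) atTop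
      (fun z : ℝ => 2 * σ * z) (fun _ => P) (gaussianReal 0 1) := by
    have hri : ∀ i, MemLp (fun ω => r (X i ω)) 2 P :=
      fun i => hr.comp_measurePreserving ⟨hX i, hlaw i⟩
    refine tendstoInDistribution_inv_sqrt_mul_sum_sub (X := fun i ω => 2 * r (X i ω)) ?_
      ((hri 0).const_mul 2) (hind.comp (fun _ x => 2 * r x) fun _ => hrm.const_mul 2) fun i =>
        (IdentDistrib.mk (hX i).aemeasurable (hX 0).aemeasurable
          ((hlaw i).trans (hlaw 0).symm)).comp (u := fun x => 2 * r x) (hrm.const_mul 2)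
    have hv : Var[fun ω => 2 * r (X 0 ω); P] = (2 * σ) ^ 2 := by
      rw [variance_const_mul, mul_pow, hσ2]
      congr 1
      have := variance_map (X := r) (Y := X 0) (μ := P) (by rw [hlaw]; exact hrm.aemeasurable)
        (hX 0).aemeasurable
      rw [hlaw] at this
      exact this.symm
    refine ⟨by fun_prop, ?_⟩
    rw [gaussianReal_map_const_mul]
    congr 1
    · simp
    · ext
      rw [hv]
      simp [Real.coe_toNNReal _ (sq_nonneg (2 * σ))]
  have hdiff := uStat_linearization hX hind hlaw hHm hHs hH2 hV hrm hr hb hθ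
  have hTd : TendstoInDistribution T atTop (fun z : ℝ => 2 * σ * z) (fun _ => P)
      (gaussianReal 0 1) := by
    have := hCLT.add_of_tendstoInMeasure_const hdiff ?_
    · refine TendstoInDistribution.congr (fun n => Eventually.of_forall fun ω => ?_)
        (Eventually.of_forall fun z => ?_) this
      · have h1 : ∫ ω, 2 * r (X 0 ω) ∂P = 2 * m := by
          rw [integral_const_mul, integral_comp_eq hX hlaw hrm]
        simp only [Pi.add_apply, hTdef, h1, ← Finset.mul_sum, Finset.sum_sub_distrib,
          Finset.sum_const, Finset.card_range, nsmul_eq_mul]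
        ring
      · simp
    · intro n
      have := hum n
      fun_prop
  set A : ℕ → Ω → ℝ := fun n ω => (n : ℝ) * ((n : ℝ) - 1) / ((n : ℝ) - 2) ^ 2 *
      empVar n (rowMean (H n) n (fun i => X i ω)) with hAdef
  have hAm : ∀ n, Measurable (A n) := by
    intro n
    have := hHm n
    unfold A empVar rowMean
    fun_prop
  have hA : TendstoInMeasure P A atTop (fun _ => σ ^ 2) := by
    rw [hσ2]
    refine TendstoInMeasure.mul_of_tendsto_one ?_
      (tendstoInMeasure_empVar_rowMean hX hind hlaw hHm hH2 hV hrm hr hb)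
    have h0 := tendsto_inv_atTop_nhds_zero_nat (𝕜 := ℝ)
    have h1 : Tendsto (fun n : ℕ => (1 - (n : ℝ)⁻¹) / (1 - 2 * (n : ℝ)⁻¹) ^ 2) atTop (𝓝 1) := by
      have := (h0.const_sub 1).div (((h0.const_mul 2).const_sub 1).pow 2) (by simp)
      simp only [mul_zero, sub_zero, one_pow, div_one] at this
      exact this
    refine h1.congr' ?_
    filter_upwards [eventually_ge_atTop 3] with n hn
    have hn' : (3 : ℝ) ≤ n := by exact_mod_cast hn
    have e1 : (n : ℝ) ≠ 0 := by linarith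
    have e3 : (n : ℝ) - 2 ≠ 0 := by linarith
    have e4 : 1 - 2 * (n : ℝ)⁻¹ ≠ 0 := by
      intro h; apply e3; field_simp at h; linarith
    field_simp
  refine (tendsto_coverage hσ hTd hA hAm hα0 hα1).congr' ?_
  filter_upwards [eventually_ge_atTop 3] with n hn
  congr 1
  ext ω
  have hs : 0 < √(n : ℝ) := Real.sqrt_pos.2 (by positivity)
  simp only [mem_ofPred_eq, mem_Icc, hTdef, hJ n hn ω]
  change |√(n : ℝ) * _| ≤ 2 * √(A n ω) * _ ↔ _ ∧ _
  rw [abs_mul, abs_of_pos hs]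
  have e : 2 * √(A n ω) / √(n : ℝ) * stdNormalQuantile (1 - α / 2)
      = (2 * √(A n ω) * stdNormalQuantile (1 - α / 2)) / √(n : ℝ) := by ring
  change _ ↔ _ - 2 * √(A n ω) / √(n : ℝ) * _ ≤ m ∧ m ≤ _ + 2 * √(A n ω) / √(n : ℝ) * _
  rw [e, mul_comm, ← le_div_iff₀ hs, abs_le]
  constructor <;> rintro ⟨h1, h2⟩ <;> constructor <;> linarith

end Limit

/-! ### Integration on the sphere -/

/-- Integration in polar coordinates on a Euclidean space. -/
theorem lintegral_polar {E : Type*} [NormedAddCommGroup E] [InnerProductSpace ℝ E]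
    [FiniteDimensional ℝ E] [MeasurableSpace E] [BorelSpace E] [Nontrivial E]
    {F : E → ENNReal} (hF : Measurable F) :
    ∫⁻ x, F x = ∫⁻ s : Metric.sphere (0 : E) 1, ∫⁻ r in Ioi (0 : ℝ),
      ENNReal.ofReal (r ^ (Module.finrank ℝ E - 1)) * F (r • (s : E))
        ∂(volume : Measure ℝ) ∂(volume : Measure E).toSphere := by
  have hmeas : Measurable fun q : Metric.sphere (0 : E) 1 × Ioi (0 : ℝ) =>
      F ((q.2 : ℝ) • (q.1 : E)) := by fun_prop
  have h1 : ∫⁻ x, F x = ∫⁻ x : ({(0)}ᶜ : Set E), F x ∂((volume : Measure E).comap (↑)) := by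
    rw [lintegral_subtype_comap (measurableSet_singleton _).compl F, restrict_compl_singleton]
  have h2 := (volume : Measure E).measurePreserving_homeomorphUnitSphereProd.lintegral_comp hmeas
  have h3 : ∀ x : ({(0)}ᶜ : Set E), (((homeomorphUnitSphereProd E x).2 : ℝ) •
      ((homeomorphUnitSphereProd E x).1 : E)) = x := by
    intro x
    have hx : ‖(x : E)‖ ≠ 0 := norm_ne_zero_iff.2 x.2
    simp [smul_smul, hx]
  simp only [h3] at h2
  rw [h1, h2, lintegral_prod _ hmeas.aemeasurable]
  refine lintegral_congr fun s => ?_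
  rw [Measure.volumeIoiPow, lintegral_withDensity_eq_lintegral_mul _ (by fun_prop) (by fun_prop)]
  exact lintegral_subtype_comap measurableSet_Ioi
    fun r : ℝ => ENNReal.ofReal (r ^ (Module.finrank ℝ E - 1)) * F (r • (s : E))

theorem toSphere_univ_eq {E : Type*} [NormedAddCommGroup E] [InnerProductSpace ℝ E]
    [FiniteDimensional ℝ E] [MeasurableSpace E] [BorelSpace E] [Nontrivial E] :
    (volume : Measure E).toSphere univ
      = ENNReal.ofReal (unitSphereArea (Module.finrank ℝ E)) := by
  have hpos : 0 < Module.finrank ℝ E := Module.finrank_pos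
  set m := Module.finrank ℝ E with hm
  have hm' : (0 : ℝ) < m := by exact_mod_cast hpos
  rw [Measure.toSphere_apply_univ, InnerProductSpace.volume_ball, ← hm, ENNReal.ofReal_one, one_pow,
    one_mul, ← ENNReal.ofReal_natCast, ← ENNReal.ofReal_mul hm'.le, unitSphereArea]
  congr 1
  rw [Real.Gamma_add_one (by positivity), Real.sqrt_eq_rpow, ← Real.rpow_natCast,
    ← Real.rpow_mul Real.pi_pos.le]
  have := (Real.Gamma_pos_of_pos (s := (m : ℝ) / 2) (by positivity)).ne'
  have e : (1 / 2 : ℝ) * m = m / 2 := by ring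
  rw [e]
  field_simp

theorem unitSphereArea_pos {m : ℝ} (hm : 0 < m) : 0 < unitSphereArea m := by
  have := Real.Gamma_pos_of_pos (s := m / 2) (by positivity)
  unfold unitSphereArea; positivity

section Sphere
variable {p : ℕ}

instance : IsFiniteMeasure (surfaceMeasure p) := by
  unfold surfaceMeasure; infer_instance

theorem measurableEmbedding_sphere_val :
    MeasurableEmbedding (Subtype.val : Metric.sphere (0 : EuclideanSpace ℝ (Fin p)) 1 → _) :=
  MeasurableEmbedding.subtype_coe (Metric.isClosed_sphere.measurableSet)

theorem surfaceMeasure_univ (hp : 1 ≤ p) :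
    surfaceMeasure p univ = ENNReal.ofReal (unitSphereArea p) := by
  have : Nonempty (Fin p) := ⟨⟨0, hp⟩⟩
  have : Nontrivial (EuclideanSpace ℝ (Fin p)) := inferInstance
  rw [surfaceMeasure, Measure.map_apply measurable_subtype_coe MeasurableSet.univ, preimage_univ,
    toSphere_univ_eq, finrank_euclideanSpace_fin]

theorem surfaceMeasure_real_univ (hp : 1 ≤ p) :
    (surfaceMeasure p).real univ = unitSphereArea p := by
  rw [Measure.real, surfaceMeasure_univ hp, ENNReal.toReal_ofReal]
  exact (unitSphereArea_pos (by exact_mod_cast hp)).le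

theorem ae_surfaceMeasure_norm : ∀ᵐ v ∂(surfaceMeasure p), ‖v‖ = 1 := by
  rw [surfaceMeasure, measurableEmbedding_sphere_val.ae_map_iff]
  exact Eventually.of_forall fun v => by simp

/-- A closed condition holding almost everywhere on the sphere holds everywhere. -/
theorem forall_sphere_of_ae {s : Set (EuclideanSpace ℝ (Fin p))}
    (hs : ∀ᵐ v ∂(surfaceMeasure p), v ∈ s)
    (hcl : IsClosed ((↑) ⁻¹' s : Set (Metric.sphere (0 : EuclideanSpace ℝ (Fin p)) 1)))
    {v : EuclideanSpace ℝ (Fin p)} (hv : ‖v‖ = 1) : v ∈ s := by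
  rw [surfaceMeasure, measurableEmbedding_sphere_val.ae_map_iff] at hs
  have h1 := (volume : Measure (EuclideanSpace ℝ (Fin p))).toSphere.dense_of_ae hs
  have h2 : closure ((↑) ⁻¹' s : Set (Metric.sphere (0 : EuclideanSpace ℝ (Fin p)) 1)) = univ :=
    h1.closure_eq
  rw [hcl.closure_eq] at h2
  have : (⟨v, by simpa using hv⟩ : Metric.sphere (0 : EuclideanSpace ℝ (Fin p)) 1) ∈
      ((↑) ⁻¹' s : Set (Metric.sphere (0 : EuclideanSpace ℝ (Fin p)) 1)) := h2 ▸ mem_univ _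
  exact this

/-- The radial mass of the unit ball, a factor that is cancelled in
`lintegral_surfaceMeasure_inner`. -/
theorem lintegral_Ioo_pow_ne {m : ℕ} :
    ∫⁻ r in Ioi (0 : ℝ), ENNReal.ofReal (r ^ m) * (Iio (1 : ℝ)).indicator 1 r ≠ 0 ∧
    ∫⁻ r in Ioi (0 : ℝ), ENNReal.ofReal (r ^ m) * (Iio (1 : ℝ)).indicator 1 r ≠ ⊤ := by
  have h : ∫⁻ r in Ioi (0 : ℝ), ENNReal.ofReal (r ^ m) * (Iio (1 : ℝ)).indicator 1 r
      = ENNReal.ofReal (1 / (m + 1)) := by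
    have h1 : ∀ r : ℝ, ENNReal.ofReal (r ^ m) * (Iio (1 : ℝ)).indicator 1 r
        = (Iio (1 : ℝ)).indicator (fun r => ENNReal.ofReal (r ^ m)) r := by
      intro r; by_cases hr : r ∈ Iio (1 : ℝ) <;> simp [hr]
    simp_rw [h1]
    rw [lintegral_indicator measurableSet_Iio, Measure.restrict_restrict measurableSet_Iio,
      inter_comm, Ioi_inter_Iio, Measure.restrict_congr_set Ioo_ae_eq_Ioc,
      ← ofReal_integral_eq_lintegral_ofReal (intervalIntegral.intervalIntegrable_pow _).1,
      ← intervalIntegral.integral_of_le zero_le_one]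
    · simp
    · filter_upwards [ae_restrict_mem measurableSet_Ioc] with y hy
      exact pow_nonneg hy.1.le _
  rw [h]
  exact ⟨by simp; positivity, ENNReal.ofReal_ne_top⟩

/-- Slicing the sphere along an axis: a function of the inner product with a fixed unit vector
is integrated in the colatitude. -/
theorem lintegral_surfaceMeasure_inner (hp : 2 ≤ p) {e : EuclideanSpace ℝ (Fin p)} (he : ‖e‖ = 1)
    {φ : ℝ → ENNReal} (hφ : Measurable φ) :
    ∫⁻ v, φ (inner ℝ e v) ∂(surfaceMeasure p)
      = ENNReal.ofReal (unitSphereArea ((p : ℝ) - 1)) *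
        ∫⁻ θ in Ioo 0 Real.pi, φ (Real.cos θ) * ENNReal.ofReal (Real.sin θ ^ (p - 2)) := by
  have : Nonempty (Fin p) := ⟨⟨0, by omega⟩⟩
  have : Nontrivial (EuclideanSpace ℝ (Fin p)) := inferInstance
  have hfin : Module.finrank ℝ (EuclideanSpace ℝ (Fin p)) = p :=
    finrank_euclideanSpace_fin
  set g : ℝ → ENNReal := (Iio (1 : ℝ)).indicator 1 with hg
  have hgm : Measurable g := measurable_one.indicator measurableSet_Iio
  set C := ∫⁻ r in Ioi (0 : ℝ), ENNReal.ofReal (r ^ (p - 1)) * g r with hC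
  obtain ⟨hC0, hCt⟩ : C ≠ 0 ∧ C ≠ ⊤ := lintegral_Ioo_pow_ne
  -- both sides, multiplied by `C`, are the integral of `Φ` over the whole space
  set Φ : ℝ → ℝ → ENNReal := fun x s => φ (x / √(x ^ 2 + s ^ 2)) * g (√(x ^ 2 + s ^ 2)) with hΦ
  have hΦm : Measurable fun q : ℝ × ℝ => Φ q.1 q.2 := by simp only [hΦ]; fun_prop
  set F : EuclideanSpace ℝ (Fin p) → ENNReal := fun y => φ (inner ℝ e y / ‖y‖) * g ‖y‖ with hF
  have hFm : Measurable F := by simp only [hF]; fun_prop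
  have hL : ∫⁻ y, F y = (∫⁻ v, φ (inner ℝ e v) ∂(surfaceMeasure p)) * C := by
    rw [lintegral_polar hFm, surfaceMeasure, lintegral_map (by fun_prop) measurable_subtype_coe,
      ← lintegral_mul_const _ (by fun_prop)]
    refine lintegral_congr fun s => ?_
    rw [hC, ← lintegral_const_mul _ (by fun_prop), hfin]
    refine setLIntegral_congr_fun measurableSet_Ioi fun r hr => ?_
    have hr : 0 < r := hr
    have hs : ‖(s : EuclideanSpace ℝ (Fin p))‖ = 1 := by simp
    simp only [hF, norm_smul, hs, mul_one, Real.norm_of_nonneg hr.le, inner_smul_right]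
    rw [mul_div_cancel_left₀ _ hr.ne']
    ring
  have hR : ∫⁻ y, F y = (ENNReal.ofReal (unitSphereArea ((p : ℝ) - 1)) *
        ∫⁻ θ in Ioo 0 Real.pi, φ (Real.cos θ) * ENNReal.ofReal (Real.sin θ ^ (p - 2))) * C := by
    set K : Submodule ℝ (EuclideanSpace ℝ (Fin p)) := Submodule.span ℝ {e} with hK
    have hKdim : Module.finrank ℝ Kᗮ = p - 1 := by
      have h1 := K.finrank_add_finrank_orthogonal
      have h2 : Module.finrank ℝ K = 1 := finrank_span_singleton (by rintro rfl; simp at he)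
      omega
    have hKnt : Nontrivial Kᗮ := Module.nontrivial_of_finrank_pos (R := ℝ) (by omega)
    -- the coordinates `ℝ × (ℝ e)ᗮ`
    have hmp : MeasurePreserving (fun q : ℝ × Kᗮ => q.1 • e + (q.2 : EuclideanSpace ℝ (Fin p))) := by
      have h1 : MeasurePreserving (LinearIsometryEquiv.toSpanUnitSingleton (𝕜 := ℝ) e he) :=
        LinearIsometryEquiv.measurePreserving _
      have h2 := (h1.prod (MeasurePreserving.id (volume : Measure Kᗮ)))
      have h3 := WithLp.volume_preserving_toLp K Kᗮ
      have h4 := K.orthogonalDecomposition.symm.measurePreserving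
      have h5 := h4.comp (h3.comp h2)
      have h6 : (fun q : ℝ × Kᗮ => q.1 • e + (q.2 : EuclideanSpace ℝ (Fin p)))
          = K.orthogonalDecomposition.symm ∘ WithLp.toLp 2 ∘
            Prod.map (LinearIsometryEquiv.toSpanUnitSingleton (𝕜 := ℝ) e he) id := by
        ext1 q
        simp
      rw [h6, Measure.volume_eq_prod]
      exact h5
    rw [← hmp.lintegral_comp hFm, Measure.volume_eq_prod, lintegral_prod _ (by fun_prop)]
    have hin : ∀ (x : ℝ) (z : Kᗮ), F (x • e + z) = Φ x ‖z‖ := by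
      intro x z
      have hez : inner ℝ e (z : EuclideanSpace ℝ (Fin p)) = 0 :=
        (Submodule.mem_orthogonal _ _).1 z.2 e (Submodule.mem_span_singleton_self e)
      have h1 : inner ℝ e (x • e + (z : EuclideanSpace ℝ (Fin p))) = x := by
        rw [inner_add_right, inner_smul_right, hez, real_inner_self_eq_norm_sq, he]; simp
      have h2 : ‖x • e + (z : EuclideanSpace ℝ (Fin p))‖ = √(x ^ 2 + ‖z‖ ^ 2) := by
        rw [eq_comm, Real.sqrt_eq_iff_mul_self_eq (by positivity) (by positivity),
          norm_add_mul_self_real, inner_smul_left, hez, norm_smul, he]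
        simp; ring
      simp only [hF, hΦ, h1, h2]
    simp only [hin]
    have hz : ∀ x : ℝ, ∫⁻ z : Kᗮ, Φ x ‖z‖ = ENNReal.ofReal (unitSphereArea ((p : ℝ) - 1)) *
        ∫⁻ s in Ioi (0 : ℝ), ENNReal.ofReal (s ^ (p - 2)) * Φ x s := by
      intro x
      rw [lintegral_polar (by fun_prop)]
      have h1 : ∀ s : Metric.sphere (0 : Kᗮ) 1, ∫⁻ r in Ioi (0 : ℝ),
          ENNReal.ofReal (r ^ (Module.finrank ℝ Kᗮ - 1)) * Φ x ‖r • (s : Kᗮ)‖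
          = ∫⁻ s in Ioi (0 : ℝ), ENNReal.ofReal (s ^ (p - 2)) * Φ x s := by
        intro s
        refine setLIntegral_congr_fun measurableSet_Ioi fun r hr => ?_
        have hr : 0 < r := hr
        have hs : ‖(s : Kᗮ)‖ = 1 := by simp
        simp only [norm_smul, hs, mul_one, Real.norm_of_nonneg hr.le, hKdim]
        rw [show p - 1 - 1 = p - 2 by omega]
      simp only [h1, lintegral_const]
      rw [toSphere_univ_eq, hKdim, Nat.cast_sub (by omega), mul_comm]
      simp
    simp only [hz]
    rw [lintegral_const_mul' _ _ ENNReal.ofReal_ne_top, mul_assoc]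
    congr 1
    -- polar coordinates in the half plane `s > 0`
    set G : ℝ × ℝ → ENNReal := fun q =>
      (Ioi (0 : ℝ)).indicator (fun s => ENNReal.ofReal (s ^ (p - 2)) * Φ q.1 s) q.2 with hG
    have hGm : Measurable G := by
      have h1 : G = (Prod.snd ⁻¹' (Ioi (0 : ℝ))).indicator
          (fun q : ℝ × ℝ => ENNReal.ofReal (q.2 ^ (p - 2)) * Φ q.1 q.2) := by
        ext q; simp [hG, indicator]
      rw [h1]
      exact Measurable.indicator (by fun_prop) (measurable_snd measurableSet_Ioi)
    have h1 : ∫⁻ x : ℝ, ∫⁻ s in Ioi (0 : ℝ), ENNReal.ofReal (s ^ (p - 2)) * Φ x s = ∫⁻ q, G q := by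
      rw [Measure.volume_eq_prod, lintegral_prod _ hGm.aemeasurable]
      refine lintegral_congr fun x => ?_
      rw [← lintegral_indicator measurableSet_Ioi]
    rw [h1, ← lintegral_comp_polarCoord_symm]
    have h2 : (volume : Measure (ℝ × ℝ)).restrict polarCoord.target
        = (volume.restrict (Ioi 0)).prod (volume.restrict (Ioo (-Real.pi) Real.pi)) := by
      rw [Measure.prod_restrict]; rfl
    have hGm2 : Measurable (fun q : ℝ × ℝ => ENNReal.ofReal q.1 • G (polarCoord.symm q)) := by
      have := continuous_polarCoord_symm.measurable
      fun_prop
    rw [h2, lintegral_prod _ hGm2.aemeasurable, hC, mul_comm, ← lintegral_mul_const _ (by fun_prop)]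
    refine setLIntegral_congr_fun measurableSet_Ioi fun r hr => ?_
    have hr : 0 < r := hr
    have h3 : ∀ θ ∈ Ioo (-Real.pi) Real.pi, ENNReal.ofReal r • G (polarCoord.symm (r, θ))
        = (Ioo 0 Real.pi).indicator (fun θ => ENNReal.ofReal (r ^ (p - 1)) * g r *
          (φ (Real.cos θ) * ENNReal.ofReal (Real.sin θ ^ (p - 2)))) θ := by
      intro θ hθ
      simp only [hG, polarCoord_symm_apply]
      by_cases hθ0 : 0 < θ
      · have hsin : 0 < Real.sin θ := Real.sin_pos_of_pos_of_lt_pi hθ0 hθ.2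
        have e1 : √((r * Real.cos θ) ^ 2 + (r * Real.sin θ) ^ 2) = r := by
          rw [Real.sqrt_eq_iff_mul_self_eq (by positivity) hr.le]
          nlinarith [Real.sin_sq_add_cos_sq θ]
        rw [indicator_of_mem (show r * Real.sin θ ∈ Ioi 0 from mul_pos hr hsin),
          indicator_of_mem (show θ ∈ Ioo 0 Real.pi from ⟨hθ0, hθ.2⟩)]
        simp only [hΦ, e1, smul_eq_mul]
        rw [mul_div_cancel_left₀ _ hr.ne', mul_pow, ENNReal.ofReal_mul (by positivity),
          show p - 1 = (p - 2) + 1 by omega, pow_succ, ENNReal.ofReal_mul (by positivity)]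
        ring
      · have hsin : Real.sin θ ≤ 0 :=
          Real.sin_nonpos_of_nonpos_of_neg_pi_le (not_lt.1 hθ0) hθ.1.le
        rw [indicator_of_notMem (by simpa using mul_nonpos_of_nonneg_of_nonpos hr.le hsin),
          indicator_of_notMem (by simp [hθ0])]
        simp
    rw [setLIntegral_congr_fun measurableSet_Ioo h3, lintegral_indicator measurableSet_Ioo,
      Measure.restrict_restrict measurableSet_Ioo, inter_eq_self_of_subset_left
        (Ioo_subset_Ioo_left (by linarith [Real.pi_pos])),
      lintegral_const_mul _ (by fun_prop)]
  exact (ENNReal.mul_left_inj hC0 hCt).1 (hL.symm.trans hR)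

end Sphere

/-! ### The Langevin kernel -/

theorem intervalIntegrable_one_sub_sq_rpow {a : ℝ} (ha : -1 < a) :
    IntervalIntegrable (fun t : ℝ => (1 - t ^ 2) ^ a) volume (-1) 1 := by
  have h1 : IntervalIntegrable (fun t : ℝ => (1 - t ^ 2) ^ a) volume 0 1 := by
    have h2 : IntervalIntegrable (fun t : ℝ => (1 - t) ^ a) volume 0 1 := by
      have := (intervalIntegral.intervalIntegrable_rpow' (a := 0) (b := 1) ha).comp_sub_left 1
      simpa using this.symm
    have h3 : ContinuousOn (fun t : ℝ => (1 + t) ^ a) (uIcc 0 1) := by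
      intro t ht
      rw [uIcc_of_le zero_le_one] at ht
      exact (ContinuousAt.rpow_const (by fun_prop) (Or.inl (by linarith [ht.1]))).continuousWithinAt
    refine (h2.continuousOn_mul h3).congr_uIoo ?_
    intro t ht
    rw [uIoo_of_le zero_le_one] at ht
    beta_reduce
    rw [← Real.mul_rpow (by linarith [ht.1]) (by linarith [ht.2])]
    congr 1; ring
  have h4 : IntervalIntegrable (fun t : ℝ => (1 - t ^ 2) ^ a) volume (-1) 0 := by
    have := (h1.comp_sub_left 0).symm
    simpa using this
  exact h4.trans h1

theorem besselI_pos {ν κ : ℝ} (hν : -(1 / 2) < ν) (hκ : 0 < κ) : 0 < besselI ν κ := by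
  have h1 : IntervalIntegrable (fun t : ℝ => Real.exp (κ * t) * (1 - t ^ 2) ^ (ν - 1 / 2))
      volume (-1) 1 :=
    (intervalIntegrable_one_sub_sq_rpow (by linarith)).continuousOn_mul (by fun_prop)
  have h2 : 0 < ∫ t in (-1 : ℝ)..1, Real.exp (κ * t) * (1 - t ^ 2) ^ (ν - 1 / 2) := by
    refine intervalIntegral.intervalIntegral_pos_of_pos_on h1 (fun t ht => ?_) (by norm_num)
    have : 0 < 1 - t ^ 2 := by nlinarith [ht.1, ht.2]
    positivity
  have h3 := Real.Gamma_pos_of_pos (s := ν + 1 / 2) (by linarith)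
  have h4 := Real.Gamma_pos_of_pos (s := 1 / 2) (by norm_num)
  unfold besselI
  positivity

/-- The colatitude density of the Langevin distribution, up to normalization. -/
noncomputable def colatWeight (p : ℕ) (κ θ : ℝ) : ℝ := Real.exp (κ * Real.cos θ) * Real.sin θ ^ (p - 2)

/-- The normalizing constant of `colatWeight`. -/
noncomputable def colatMass (p : ℕ) (κ : ℝ) : ℝ := ∫ θ in (0 : ℝ)..Real.pi, colatWeight p κ θ

theorem continuous_colatWeight (p : ℕ) (κ : ℝ) : Continuous (colatWeight p κ) := by
  unfold colatWeight; fun_prop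

theorem colatWeight_nonneg (p : ℕ) (κ : ℝ) {θ : ℝ} (hθ : θ ∈ Icc 0 Real.pi) :
    0 ≤ colatWeight p κ θ :=
  mul_nonneg (Real.exp_pos _).le (pow_nonneg (Real.sin_nonneg_of_mem_Icc hθ) _)

theorem colatMass_pos (p : ℕ) (κ : ℝ) : 0 < colatMass p κ := by
  refine intervalIntegral.intervalIntegral_pos_of_pos_on
    ((continuous_colatWeight p κ).intervalIntegrable _ _) (fun θ hθ => ?_) Real.pi_pos
  exact mul_pos (Real.exp_pos _) (pow_pos (Real.sin_pos_of_mem_Ioo hθ) _)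

/-- The normalized Langevin kernel `L(κ vᵀw) / c₁(κ)` on the sphere. -/
noncomputable def langevinKernel (p : ℕ) (κ : ℝ) (v w : EuclideanSpace ℝ (Fin p)) : ℝ :=
  langevin p κ (inner ℝ v w) / langevinConst p κ

/-- The Bessel factor cancels between `L` and `c₁`. -/
theorem langevinKernel_eq {p : ℕ} (hp : 2 ≤ p) {κ : ℝ} (hκ : 0 < κ)
    (v w : EuclideanSpace ℝ (Fin p)) :
    langevinKernel p κ v w
      = Real.exp (κ * inner ℝ v w) / (unitSphereArea ((p : ℝ) - 1) * colatMass p κ) := by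
  have hp' : (2 : ℝ) ≤ p := by exact_mod_cast hp
  have hc : 0 < κ ^ ((p : ℝ) / 2 - 1) * ((2 * Real.pi) ^ ((p : ℝ) / 2) *
      besselI ((p : ℝ) / 2 - 1) κ)⁻¹ := by
    have := besselI_pos (ν := (p : ℝ) / 2 - 1) (by linarith) hκ
    have := Real.pi_pos
    positivity
  unfold langevinKernel langevinConst langevin
  set c := κ ^ ((p : ℝ) / 2 - 1) * ((2 * Real.pi) ^ ((p : ℝ) / 2) *
      besselI ((p : ℝ) / 2 - 1) κ)⁻¹
  have h1 : ∫ θ in (0 : ℝ)..Real.pi, c * Real.exp (κ * Real.cos θ) * Real.sin θ ^ (p - 2)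
      = c * colatMass p κ := by
    rw [colatMass, ← intervalIntegral.integral_const_mul]
    simp only [colatWeight, mul_assoc]
  rw [h1, mul_left_comm, mul_div_mul_left _ _ hc.ne']

theorem langevinKernel_nonneg {p : ℕ} (hp : 2 ≤ p) {κ : ℝ} (hκ : 0 < κ)
    (v w : EuclideanSpace ℝ (Fin p)) : 0 ≤ langevinKernel p κ v w := by
  rw [langevinKernel_eq hp hκ]
  have h1 := colatMass_pos p κ
  have h2 := unitSphereArea_pos (m := (p : ℝ) - 1) (by
    have : (2 : ℝ) ≤ p := by exact_mod_cast hp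
    linarith)
  positivity

theorem langevinKernel_symm (p : ℕ) (κ : ℝ) (v w : EuclideanSpace ℝ (Fin p)) :
    langevinKernel p κ v w = langevinKernel p κ w v := by
  rw [langevinKernel, langevinKernel, real_inner_comm]

theorem measurable_langevinKernel (p : ℕ) (κ : ℝ) :
    Measurable fun q : EuclideanSpace ℝ (Fin p) × EuclideanSpace ℝ (Fin p) =>
      langevinKernel p κ q.1 q.2 := by
  unfold langevinKernel langevin
  fun_prop

theorem lintegral_langevinKernel_mul {p : ℕ} (hp : 2 ≤ p) {κ : ℝ} (hκ : 0 < κ)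
    {e : EuclideanSpace ℝ (Fin p)} (he : ‖e‖ = 1) {φ : ℝ → ℝ} (hφ : Continuous φ)
    (hφ0 : ∀ t ∈ Icc (-1 : ℝ) 1, 0 ≤ φ t) :
    ∫⁻ v, ENNReal.ofReal (langevinKernel p κ e v * φ (inner ℝ e v)) ∂(surfaceMeasure p)
      = ENNReal.ofReal
        ((∫ θ in (0 : ℝ)..Real.pi, φ (Real.cos θ) * colatWeight p κ θ) / colatMass p κ) := by
  have h1 := colatMass_pos p κ
  have h2 := unitSphereArea_pos (m := (p : ℝ) - 1) (by
    have : (2 : ℝ) ≤ p := by exact_mod_cast hp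
    linarith)
  simp_rw [langevinKernel_eq hp hκ]
  rw [lintegral_surfaceMeasure_inner hp he (φ := fun t => ENNReal.ofReal
    (Real.exp (κ * t) / (unitSphereArea ((p : ℝ) - 1) * colatMass p κ) * φ t)) (by fun_prop),
    ← lintegral_const_mul _ (by fun_prop)]
  have h3 : ∀ θ ∈ Ioo 0 Real.pi, ENNReal.ofReal (unitSphereArea ((p : ℝ) - 1)) *
      (ENNReal.ofReal (Real.exp (κ * Real.cos θ) / (unitSphereArea ((p : ℝ) - 1) * colatMass p κ)
        * φ (Real.cos θ)) * ENNReal.ofReal (Real.sin θ ^ (p - 2)))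
      = ENNReal.ofReal (φ (Real.cos θ) * colatWeight p κ θ / colatMass p κ) := by
    intro θ hθ
    have h4 := hφ0 _ (Real.cos_mem_Icc θ)
    rw [← ENNReal.ofReal_mul (by positivity), ← ENNReal.ofReal_mul h2.le, colatWeight]
    congr 1
    field_simp
  rw [setLIntegral_congr_fun measurableSet_Ioo h3, Measure.restrict_congr_set Ioo_ae_eq_Ioc,
    ← ofReal_integral_eq_lintegral_ofReal, ← intervalIntegral.integral_of_le Real.pi_pos.le,
    intervalIntegral.integral_div]
  · have : Continuous fun θ => φ (Real.cos θ) * colatWeight p κ θ / colatMass p κ :=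
      ((hφ.comp Real.continuous_cos).mul (continuous_colatWeight p κ)).div_const _
    exact (this.intervalIntegrable 0 Real.pi).1
  · filter_upwards [ae_restrict_mem measurableSet_Ioc] with θ hθ
    exact div_nonneg (mul_nonneg (hφ0 _ (Real.cos_mem_Icc θ))
      (colatWeight_nonneg p κ ⟨hθ.1.le, hθ.2⟩)) h1.le

theorem lintegral_langevinKernel {p : ℕ} (hp : 2 ≤ p) {κ : ℝ} (hκ : 0 < κ)
    {e : EuclideanSpace ℝ (Fin p)} (he : ‖e‖ = 1) :
    ∫⁻ v, ENNReal.ofReal (langevinKernel p κ e v) ∂(surfaceMeasure p) = 1 := by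
  have := lintegral_langevinKernel_mul hp hκ he (φ := fun _ => 1) continuous_const
    fun _ _ => zero_le_one
  simp only [mul_one, one_mul] at this
  rw [this, ← colatMass, div_self (colatMass_pos p κ).ne', ENNReal.ofReal_one]

/-- Laplace-type lower bound for the mass of the Langevin weight. -/
theorem colatMass_lower {p : ℕ} (hp : 2 ≤ p) :
    ∃ c > 0, ∀ κ ≥ 1, c * Real.exp κ * κ ^ (-(((p : ℝ) - 1) / 2)) ≤ colatMass p κ := by
  have hp' : (2 : ℝ) ≤ p := by exact_mod_cast hp
  have hpi := Real.pi_gt_three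
  refine ⟨Real.exp (-(1 / 2)) * (2 / Real.pi) ^ (p - 2) / (p - 1), ?_, fun κ hκ => ?_⟩
  · have : 0 < (p : ℝ) - 1 := by linarith
    positivity
  have hκ0 : 0 < κ := by linarith
  -- the mass is concentrated on colatitudes up to `κ^{-1/2}`, where `κ cos θ ≥ κ - 1/2`
  set δ := (√κ)⁻¹ with hδ
  have hδ0 : 0 < δ := by positivity
  have hδ1 : δ ≤ 1 := inv_le_one_of_one_le₀ (Real.one_le_sqrt.2 hκ)
  have hδκ : κ * δ ^ 2 = 1 := by
    rw [hδ, inv_pow, Real.sq_sqrt hκ0.le, mul_inv_cancel₀ hκ0.ne']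
  have hδp : κ ^ (-(((p : ℝ) - 1) / 2)) = δ ^ (p - 1) := by
    rw [hδ, Real.sqrt_eq_rpow, ← Real.rpow_neg hκ0.le, ← Real.rpow_natCast, ← Real.rpow_mul hκ0.le,
      Nat.cast_sub (by omega)]
    congr 1; push_cast; ring
  have h1 : ∫ θ in (0 : ℝ)..δ, Real.exp (κ - 1 / 2) * (2 / Real.pi) ^ (p - 2) * θ ^ (p - 2)
      ≤ ∫ θ in (0 : ℝ)..δ, colatWeight p κ θ := by
    refine intervalIntegral.integral_mono_on hδ0.le
      (Continuous.intervalIntegrable (by fun_prop) _ _)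
      ((continuous_colatWeight p κ).intervalIntegrable _ _) fun θ hθ => ?_
    have hs : 2 / Real.pi * θ ≤ Real.sin θ := Real.mul_le_sin hθ.1 (by linarith [hθ.2])
    have hc : κ - 1 / 2 ≤ κ * Real.cos θ := by
      have := Real.one_sub_sq_div_two_le_cos (x := θ)
      have h2 : θ ^ 2 ≤ δ ^ 2 := by gcongr; exacts [hθ.1, hθ.2]
      nlinarith
    rw [mul_assoc, ← mul_pow, colatWeight]
    have h3 : 0 ≤ 2 / Real.pi * θ := by have := hθ.1; positivity
    gcongr
  have h2 : ∫ θ in (0 : ℝ)..δ, colatWeight p κ θ ≤ colatMass p κ := by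
    refine intervalIntegral.integral_mono_interval le_rfl hδ0.le (by linarith) ?_
      ((continuous_colatWeight p κ).intervalIntegrable _ _)
    filter_upwards [ae_restrict_mem measurableSet_Ioc] with θ hθ
    exact colatWeight_nonneg p κ ⟨hθ.1.le, hθ.2⟩
  refine le_trans (le_of_eq ?_) (h1.trans h2)
  rw [intervalIntegral.integral_const_mul, integral_pow, hδp]
  have e1 : p - 2 + 1 = p - 1 := by omega
  have e2 : ((p - 2 : ℕ) : ℝ) + 1 = (p : ℝ) - 1 := by
    rw [Nat.cast_sub hp]; push_cast; ring
  rw [e1, e2, zero_pow (by omega), sub_zero, show κ - 1 / 2 = -(1 / 2) + κ by ring, Real.exp_add]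
  ring

/-- The kernel is largest at `w = v`, where it is `e^κ` over a mass of order at least
`e^κ κ^{-(p-1)/2}`. -/
theorem langevinKernel_le {p : ℕ} (hp : 2 ≤ p) :
    ∃ C > 0, ∀ κ ≥ 1, ∀ v w : EuclideanSpace ℝ (Fin p), ‖v‖ = 1 → ‖w‖ = 1 →
      langevinKernel p κ v w ≤ C * κ ^ (((p : ℝ) - 1) / 2) := by
  obtain ⟨c, hc, hlow⟩ := colatMass_lower hp
  have h2 := unitSphereArea_pos (m := (p : ℝ) - 1) (by
    have : (2 : ℝ) ≤ p := by exact_mod_cast hp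
    linarith)
  refine ⟨(unitSphereArea ((p : ℝ) - 1) * c)⁻¹, by positivity, fun κ hκ v w hv hw => ?_⟩
  have hκ0 : 0 < κ := by linarith
  have hin : inner ℝ v w ≤ 1 := by
    have := real_inner_le_norm v w
    rwa [hv, hw, one_mul] at this
  have h3 := hlow κ hκ
  rw [langevinKernel_eq hp hκ0, div_le_iff₀ (mul_pos h2 (colatMass_pos p κ))]
  calc Real.exp (κ * inner ℝ v w) ≤ Real.exp κ := Real.exp_le_exp.2 (by nlinarith)
    _ = (unitSphereArea ((p : ℝ) - 1) * c)⁻¹ * κ ^ (((p : ℝ) - 1) / 2) *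
      (unitSphereArea ((p : ℝ) - 1) * (c * Real.exp κ * κ ^ (-(((p : ℝ) - 1) / 2)))) := by
        rw [Real.rpow_neg hκ0.le]
        have := Real.rpow_pos_of_pos hκ0 (((p : ℝ) - 1) / 2)
        field_simp
    _ ≤ _ := by gcongr

/-- A consequence of `κ E sin² θ = (p - 1) E cos θ`, which is an integration by parts in the
colatitude. -/
theorem mul_integral_sin_sq_colatWeight_le {p : ℕ} (hp : 2 ≤ p) (κ : ℝ) :
    κ * ∫ θ in (0 : ℝ)..Real.pi, Real.sin θ ^ 2 * colatWeight p κ θ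
      ≤ ((p : ℝ) - 1) * colatMass p κ := by
  have hp' : (2 : ℝ) ≤ p := by exact_mod_cast hp
  have hw := continuous_colatWeight p κ
  have hderiv : ∀ θ ∈ uIcc 0 Real.pi, HasDerivAt
      (fun θ => Real.sin θ ^ (p - 1) * Real.exp (κ * Real.cos θ))
      (((p : ℝ) - 1) * (Real.cos θ * colatWeight p κ θ)
        - κ * (Real.sin θ ^ 2 * colatWeight p κ θ)) θ := by
    intro θ _
    have h1 := ((Real.hasDerivAt_sin θ).pow (p - 1)).mul
      (((Real.hasDerivAt_cos θ).const_mul κ).exp)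
    refine h1.congr_deriv ?_
    simp only [colatWeight]
    rw [show p - 1 = p - 2 + 1 by omega]
    have e2 : ((p - 2 : ℕ) : ℝ) = (p : ℝ) - 2 := by
      rw [Nat.cast_sub hp]; push_cast; ring
    simp only [Pi.pow_apply, add_tsub_cancel_right, Nat.cast_add, Nat.cast_one, e2]
    ring
  have i1 : IntervalIntegrable (fun θ => ((p : ℝ) - 1) * (Real.cos θ * colatWeight p κ θ))
      volume 0 Real.pi := Continuous.intervalIntegrable (by fun_prop) _ _
  have i2 : IntervalIntegrable (fun θ => κ * (Real.sin θ ^ 2 * colatWeight p κ θ))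
      volume 0 Real.pi := Continuous.intervalIntegrable (by fun_prop) _ _
  have h2 := intervalIntegral.integral_eq_sub_of_hasDerivAt hderiv (i1.sub i2)
  rw [intervalIntegral.integral_sub i1 i2, intervalIntegral.integral_const_mul,
    intervalIntegral.integral_const_mul, Real.sin_pi, Real.sin_zero,
    zero_pow (by omega)] at h2
  have h3 : ∫ θ in (0 : ℝ)..Real.pi, Real.cos θ * colatWeight p κ θ ≤ colatMass p κ := by
    refine intervalIntegral.integral_mono_on Real.pi_pos.le
      (Continuous.intervalIntegrable (by fun_prop) _ _) (hw.intervalIntegrable _ _) fun θ hθ => ?_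
    have := colatWeight_nonneg p κ hθ
    nlinarith [Real.cos_le_one θ]
  have h4 := mul_le_mul_of_nonneg_left h3 (by linarith : 0 ≤ (p : ℝ) - 1)
  linarith

/-- The mean squared distance from the mode of the Langevin distribution is of order `1 / κ`. On the
upper hemisphere `1 - cos θ ≤ sin² θ`, which is integrated by parts. -/
theorem lintegral_langevinKernel_mul_dist_sq_le {p : ℕ} (hp : 2 ≤ p) :
    ∃ C > 0, ∀ᶠ κ in atTop, ∀ e : EuclideanSpace ℝ (Fin p), ‖e‖ = 1 →
      ∫⁻ v, ENNReal.ofReal (langevinKernel p κ e v * ‖e - v‖ ^ 2) ∂(surfaceMeasure p)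
        ≤ ENNReal.ofReal (C / κ) := by
  have hp' : (2 : ℝ) ≤ p := by exact_mod_cast hp
  obtain ⟨c, hc, hlow⟩ := colatMass_lower hp
  refine ⟨2 * p, by positivity, ?_⟩
  -- the lower hemisphere has exponentially small relative weight
  have hsmall : ∀ᶠ κ in atTop, 2 * Real.pi * κ ≤ colatMass p κ := by
    have h1 := tendsto_rpow_mul_exp_neg_mul_atTop_nhds_zero (((p : ℝ) - 1) / 2 + 1) 1 one_pos
    filter_upwards [h1.eventually_lt_const (u := c / (2 * Real.pi))
      (by have := Real.pi_pos; positivity), eventually_ge_atTop 1] with κ h2 hκ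
    refine le_trans ?_ (hlow κ hκ)
    have hκ0 : 0 < κ := by linarith
    have hr := Real.rpow_pos_of_pos hκ0 (((p : ℝ) - 1) / 2)
    rw [lt_div_iff₀ (by have := Real.pi_pos; positivity), Real.rpow_add hκ0, Real.rpow_one, neg_mul,
      one_mul, Real.exp_neg] at h2
    rw [Real.rpow_neg hκ0.le]
    have he := Real.exp_pos κ
    rw [← div_eq_mul_inv, le_div_iff₀ hr]
    have h3 : κ ^ (((p : ℝ) - 1) / 2) * κ * (Real.exp κ)⁻¹ * (2 * Real.pi)
        = (2 * Real.pi * κ * κ ^ (((p : ℝ) - 1) / 2)) / Real.exp κ := by field_simp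
    rw [h3, div_lt_iff₀ he] at h2
    exact h2.le
  filter_upwards [hsmall, eventually_ge_atTop 1] with κ hκs hκ e he
  have hκ0 : 0 < κ := by linarith
  have hI := colatMass_pos p κ
  have hw := continuous_colatWeight p κ
  have h1 : ∀ᵐ v ∂(surfaceMeasure p), ENNReal.ofReal (langevinKernel p κ e v * ‖e - v‖ ^ 2)
      = ENNReal.ofReal (langevinKernel p κ e v * (2 * (1 - inner ℝ e v))) := by
    filter_upwards [ae_surfaceMeasure_norm] with v hv
    rw [norm_sub_sq_real, he, hv]
    congr 2; ring
  rw [lintegral_congr_ae h1, lintegral_langevinKernel_mul hp hκ0 he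
    (φ := fun t => 2 * (1 - t)) (by fun_prop) fun t ht => by linarith [ht.2]]
  refine ENNReal.ofReal_le_ofReal ?_
  rw [div_le_div_iff₀ hI hκ0]
  have h2 : ∫ θ in (0 : ℝ)..Real.pi, 2 * (1 - Real.cos θ) * colatWeight p κ θ
      ≤ ∫ θ in (0 : ℝ)..Real.pi, (2 * (Real.sin θ ^ 2 * colatWeight p κ θ) + 4) := by
    refine intervalIntegral.integral_mono_on Real.pi_pos.le
      (Continuous.intervalIntegrable (by fun_prop) _ _)
      (Continuous.intervalIntegrable (by fun_prop) _ _) fun θ hθ => ?_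
    have hw0 := colatWeight_nonneg p κ hθ
    have hc1 := Real.cos_le_one θ
    have hc2 := Real.neg_one_le_cos θ
    have hs := Real.sin_sq_add_cos_sq θ
    rcases le_total 0 (Real.cos θ) with h0 | h0
    · have : 1 - Real.cos θ ≤ Real.sin θ ^ 2 := by nlinarith
      nlinarith
    · have hw1 : colatWeight p κ θ ≤ 1 := by
        unfold colatWeight
        refine mul_le_one₀ ?_ (pow_nonneg (Real.sin_nonneg_of_mem_Icc hθ) _)
          (pow_le_one₀ (Real.sin_nonneg_of_mem_Icc hθ) (Real.sin_le_one θ))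
        rw [Real.exp_le_one_iff]
        nlinarith
      nlinarith [mul_nonneg (sq_nonneg (Real.sin θ)) hw0]
  rw [intervalIntegral.integral_add (Continuous.intervalIntegrable (by fun_prop) _ _)
    (by simp), intervalIntegral.integral_const_mul, intervalIntegral.integral_const] at h2
  simp only [sub_zero, smul_eq_mul] at h2
  have h3 := mul_integral_sin_sq_colatWeight_le hp κ
  nlinarith

/-! ### Glaeser's inequality and the angular Hessian -/

/-- Uniform continuity bounds the oscillation over an interval by the number of steps that cross it. -/
theorem norm_sub_le_of_chain {V : Type*} [SeminormedAddCommGroup V] {g : ℝ → V} {N : ℕ}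
    (hN : 0 < N) (hg : ∀ s ∈ Icc (0 : ℝ) 1, ∀ t ∈ Icc (0 : ℝ) 1, |s - t| ≤ 1 / N →
      ‖g s - g t‖ ≤ 1) : ‖g 1 - g 0‖ ≤ N := by
  have hN' : (0 : ℝ) < N := by exact_mod_cast hN
  have : ∀ k : ℕ, k ≤ N → ‖g (k / N) - g 0‖ ≤ k := by
    intro k
    induction k with
    | zero => simp
    | succ k ih =>
      intro hk
      have hk' : ((k : ℝ) + 1) ≤ N := by exact_mod_cast hk
      have h1 := ih (by omega)
      have h2 := hg (((k + 1 : ℕ) : ℝ) / N)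
        ⟨by positivity, by rw [div_le_one hN']; push_cast; exact hk'⟩ ((k : ℝ) / N)
        ⟨by positivity, by rw [div_le_one hN']; linarith⟩
        (by rw [← sub_div, abs_of_nonneg] <;> push_cast <;> simp)
      have h3 := norm_add_le (g (((k + 1 : ℕ) : ℝ) / N) - g ((k : ℝ) / N)) (g (k / N) - g 0)
      rw [sub_add_sub_cancel] at h3
      push_cast at *
      linarith
  have h := this N le_rfl
  rwa [div_self hN'.ne'] at h

/-- Taylor's formula with the convenient constant `C` in place of `C / 2`. -/
theorem abs_taylor_le {φ dφ ddφ : ℝ → ℝ} {I : Set ℝ} (hI : Convex ℝ I)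
    (h1 : ∀ x ∈ I, HasDerivAt φ (dφ x) x) (h2 : ∀ x ∈ I, HasDerivAt dφ (ddφ x) x) {C : ℝ}
    (hC : ∀ x ∈ I, |ddφ x| ≤ C) {x y : ℝ} (hx : x ∈ I) (hy : y ∈ I) :
    |φ y - φ x - dφ x * (y - x)| ≤ C * (y - x) ^ 2 := by
  have hd : ∀ z ∈ I, |dφ z - dφ x| ≤ C * |z - x| := fun z hz =>
    hI.norm_image_sub_le_of_norm_hasDerivWithin_le (fun w hw => (h2 w hw).hasDerivWithinAt)
      (fun w hw => hC w hw) hx hz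
  have hsub : uIcc x y ⊆ I := hI.ordConnected.uIcc_subset hx hy
  have hC0 : 0 ≤ C := (abs_nonneg _).trans (hC x hx)
  have h3 := (convex_uIcc x y).norm_image_sub_le_of_norm_hasDerivWithin_le
    (f := fun z => φ z - dφ x * (z - x)) (f' := fun z => dφ z - dφ x) (C := C * |y - x|)
    (fun z hz => by
      have := ((h1 z (hsub hz)).sub (((hasDerivAt_id z).sub_const x).const_mul (dφ x)))
      simp only [mul_one] at this
      exact this.hasDerivWithinAt)
    (fun z hz => (hd z (hsub hz)).trans
      (mul_le_mul_of_nonneg_left (abs_sub_left_of_mem_uIcc hz) hC0)) left_mem_uIcc right_mem_uIcc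
  simp only [sub_self, mul_zero, sub_zero, Real.norm_eq_abs] at h3
  rw [← sq_abs (y - x), sq, ← mul_assoc]
  convert h3 using 2
  ring

/-- Glaeser's inequality in difference form: the square root of a nonnegative function with bounded
second derivative is Lipschitz. The second order bound enters through Taylor's formula; the
points `a - φ' a / (2 C)` and `b - φ' b / (2 C)`, at which the Taylor parabolas are minimal, are
required to stay in the domain. -/
theorem glaeser_sq_sub_le {φ dφ : ℝ → ℝ} {I : Set ℝ} {C : ℝ} (hC : 0 < C)
    (hT : ∀ x ∈ I, ∀ y ∈ I, |φ y - φ x - dφ x * (y - x)| ≤ C * (y - x) ^ 2)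
    (h0 : ∀ x ∈ I, 0 ≤ φ x) {a b : ℝ} (ha : a ∈ I) (hb : b ∈ I)
    (ha' : a - dφ a / (2 * C) ∈ I) (hb' : b - dφ b / (2 * C) ∈ I) :
    (φ a - φ b) ^ 2 ≤ 10 * C * (a - b) ^ 2 * (φ a + φ b) := by
  have hder : ∀ x ∈ I, x - dφ x / (2 * C) ∈ I → dφ x ^ 2 ≤ 4 * C * φ x := by
    intro x hx hx'
    have h1 := (abs_le.1 (hT x hx _ hx')).2
    have h2 := h0 _ hx'
    have h3 : x - dφ x / (2 * C) - x = -(dφ x / (2 * C)) := by ring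
    rw [h3] at h1
    have h4 : dφ x * -(dφ x / (2 * C)) = -(dφ x ^ 2 / (2 * C)) := by ring
    have h5 : C * (-(dφ x / (2 * C))) ^ 2 = dφ x ^ 2 / (2 * C) / 2 := by
      field_simp
    rw [h4, h5] at h1
    have h6 : dφ x ^ 2 / (2 * C) / 2 ≤ φ x := by linarith
    rw [div_div, div_le_iff₀ (by positivity)] at h6
    linarith
  wlog hab : φ a ≤ φ b generalizing a b
  · have := this hb ha hb' ha' (le_of_not_ge hab)
    calc _ = (φ b - φ a) ^ 2 := by ring
      _ ≤ _ := this
      _ = _ := by ring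
  have hd := hder b hb hb'
  have ht := (abs_le.1 (hT b hb a ha)).1
  have hφa := h0 a ha
  have hφb := h0 b hb
  set t := a - b
  set D := φ b - φ a with hD
  have hD0 : 0 ≤ D := sub_nonneg.2 hab
  have hDb : D ≤ φ b := by linarith
  have h1 : D ≤ -(dφ b * t) + C * t ^ 2 := by linarith
  have e : (φ a - φ b) ^ 2 = D ^ 2 := by rw [hD]; ring
  rw [e]
  have ht2 : 0 ≤ C * t ^ 2 := by positivity
  have key : D ^ 2 ≤ 10 * C * t ^ 2 * φ b := by
    rcases le_total (C * t ^ 2) (φ b) with h | h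
    · have h2 : D ^ 2 ≤ (-(dφ b * t) + C * t ^ 2) ^ 2 := pow_le_pow_left₀ hD0 h1 2
      have h3 : (-(dφ b * t) + C * t ^ 2) ^ 2 ≤ 2 * (dφ b ^ 2 * t ^ 2) + 2 * (C * t ^ 2) ^ 2 := by
        nlinarith [sq_nonneg (dφ b * t + C * t ^ 2)]
      have h4 : dφ b ^ 2 * t ^ 2 ≤ 4 * C * φ b * t ^ 2 :=
        mul_le_mul_of_nonneg_right hd (sq_nonneg t)
      have h5 : (C * t ^ 2) ^ 2 ≤ (C * t ^ 2) * φ b := by nlinarith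
      linarith
    · have h2 : D ^ 2 ≤ φ b * φ b := by nlinarith
      have h3 : φ b * φ b ≤ C * t ^ 2 * φ b := mul_le_mul_of_nonneg_right h hφb
      nlinarith [mul_nonneg ht2 hφb]
  have : 0 ≤ 10 * C * t ^ 2 * φ a := by positivity
  linarith

section Angular
variable {p : ℕ} {f : ℝ → EuclideanSpace ℝ (Fin p) → ℝ}

theorem direction_of_norm_one {v : EuclideanSpace ℝ (Fin p)} (hv : ‖v‖ = 1) : direction v = v := by
  simp [direction, hv]

theorem rayExtension_of_norm_one {v : EuclideanSpace ℝ (Fin p)} (hv : ‖v‖ = 1) (u : ℝ) :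
    rayExtension f u v = f u v := by
  rw [rayExtension, direction_of_norm_one hv]

theorem isOpen_polarDomain :
    IsOpen (Ioi (0 : ℝ) ×ˢ ({0}ᶜ : Set (EuclideanSpace ℝ (Fin p)))) :=
  isOpen_Ioi.prod isOpen_compl_singleton

theorem hasFDerivAt_rayExtension (hf : DensityAssumption f) {u : ℝ} (hu : 0 < u)
    {y : EuclideanSpace ℝ (Fin p)} (hy : y ≠ 0) :
    HasFDerivAt (rayExtension f u) (fderiv ℝ (rayExtension f u) y) y ∧
    HasFDerivAt (fderiv ℝ (rayExtension f u)) (angularHessian f u y) y := by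
  set F := fun x : ℝ × EuclideanSpace ℝ (Fin p) => rayExtension f x.1 x.2 with hF
  have hd : ∀ z : EuclideanSpace ℝ (Fin p), z ≠ 0 → HasFDerivAt (rayExtension f u)
      ((fderiv ℝ F (u, z)).comp (ContinuousLinearMap.inr ℝ ℝ (EuclideanSpace ℝ (Fin p)))) z := by
    intro z hz
    have h1 : HasFDerivAt F (fderiv ℝ F (u, z)) (u, z) :=
      (hf.differentiable.differentiableAt (isOpen_polarDomain.mem_nhds (mk_mem_prod hu hz))).hasFDerivAt
    exact h1.comp z (hasFDerivAt_prodMk_right u z)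
  have hy' : ∀ᶠ z in 𝓝 y, z ≠ 0 := isOpen_compl_singleton.mem_nhds hy
  have heq : fderiv ℝ (rayExtension f u) =ᶠ[𝓝 y] fun z => (fderiv ℝ F (u, z)).comp
      (ContinuousLinearMap.inr ℝ ℝ (EuclideanSpace ℝ (Fin p))) := by
    filter_upwards [hy'] with z hz using (hd z hz).fderiv
  have h2 : DifferentiableAt ℝ (fderiv ℝ F) (u, y) :=
    hf.twice_differentiable.differentiableAt (isOpen_polarDomain.mem_nhds (mk_mem_prod hu hy))
  have h3 : DifferentiableAt ℝ (fun z => (fderiv ℝ F (u, z)).comp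
      (ContinuousLinearMap.inr ℝ ℝ (EuclideanSpace ℝ (Fin p)))) y := by
    have h4 : DifferentiableAt ℝ (fun z => fderiv ℝ F (u, z)) y :=
      h2.comp y (hasFDerivAt_prodMk_right u y).differentiableAt
    exact h4.clm_comp (differentiableAt_const _)
  exact ⟨(hd y hy).differentiableAt.hasFDerivAt, (h3.congr_of_eventuallyEq heq).hasFDerivAt⟩

theorem hasDerivAt_radial (hf : DensityAssumption f) {v : EuclideanSpace ℝ (Fin p)}
    (hv : ‖v‖ = 1) {u : ℝ} (hu : 0 < u) :
    HasDerivAt (fun r => f r v) (deriv (fun r => f r v) u) u ∧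
    HasDerivAt (deriv (fun r => f r v)) (radialSecondDeriv f u v) u := by
  have hv0 : v ≠ 0 := by rintro rfl; simp at hv
  set F := fun x : ℝ × EuclideanSpace ℝ (Fin p) => rayExtension f x.1 x.2 with hF
  have hfun : (fun r => f r v) = fun r => F (r, v) := by
    ext r; simp only [hF, rayExtension_of_norm_one hv]
  have hd : ∀ r > 0, HasDerivAt (fun r => f r v) (fderiv ℝ F (r, v) (1, 0)) r := by
    intro r hr
    have h1 : HasFDerivAt F (fderiv ℝ F (r, v)) (r, v) :=
      (hf.differentiable.differentiableAt (isOpen_polarDomain.mem_nhds (mk_mem_prod hr hv0))).hasFDerivAt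
    rw [hfun]
    exact h1.comp_hasDerivAt r ((hasDerivAt_id r).prodMk (hasDerivAt_const r v))
  have heq : deriv (fun r => f r v) =ᶠ[𝓝 u] fun r => fderiv ℝ F (r, v) (1, 0) := by
    filter_upwards [Ioi_mem_nhds hu] with r hr using (hd r hr).deriv
  have h2 : DifferentiableAt ℝ (fderiv ℝ F) (u, v) :=
    hf.twice_differentiable.differentiableAt (isOpen_polarDomain.mem_nhds (mk_mem_prod hu hv0))
  have h3 : DifferentiableAt ℝ (fun r => fderiv ℝ F (r, v) (1, 0)) u := by
    have h4 : DifferentiableAt ℝ (fun r => fderiv ℝ F (r, v)) u :=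
      h2.comp u ((hasDerivAt_id u).prodMk (hasDerivAt_const u v)).differentiableAt
    exact h4.clm_apply (differentiableAt_const _)
  exact ⟨(hd u hu).differentiableAt.hasDerivAt, (h3.congr_of_eventuallyEq heq).hasDerivAt⟩

/-- Euler's relation: the derivative along the ray vanishes. -/
theorem fderiv_rayExtension_self (hf : DensityAssumption f) {u : ℝ} (hu : 0 < u)
    {y : EuclideanSpace ℝ (Fin p)} (hy : y ≠ 0) : fderiv ℝ (rayExtension f u) y y = 0 := by
  have h1 : HasDerivAt (fun t : ℝ => rayExtension f u (t • y))
      (fderiv ℝ (rayExtension f u) y y) 1 := by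
    have h2 := (hasFDerivAt_rayExtension hf hu hy).1
    have h3 : HasDerivAt (fun t : ℝ => t • y) y 1 := by
      simpa using (hasDerivAt_id (1 : ℝ)).smul_const y
    rw [← one_smul ℝ y] at h2
    have h5 := h2.comp_hasDerivAt (1 : ℝ) h3
    simp only [one_smul] at h5
    exact h5
  have h4 : (fun t : ℝ => rayExtension f u (t • y)) =ᶠ[𝓝 1] fun _ => rayExtension f u y := by
    filter_upwards [Ioi_mem_nhds one_pos] with t ht
    have ht : 0 < t := ht
    have hn : ‖y‖ ≠ 0 := norm_ne_zero_iff.2 hy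
    simp only [rayExtension, direction, norm_smul, Real.norm_of_nonneg ht.le, smul_smul]
    congr 2
    field_simp
  exact h1.unique ((hasDerivAt_const (1 : ℝ) _).congr_of_eventuallyEq h4)

/-- The extension is homogeneous of degree zero, so its Hessian vanishes along the ray. -/
theorem angularHessian_self_self (hf : DensityAssumption f) {u : ℝ} (hu : 0 < u)
    {v : EuclideanSpace ℝ (Fin p)} (hv : v ≠ 0) : angularHessian f u v v v = 0 := by
  have h1 : HasDerivAt (fun t : ℝ => fderiv ℝ (rayExtension f u) (t • v) (t • v))
      (angularHessian f u v v v + fderiv ℝ (rayExtension f u) v v) 1 := by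
    have h2 := (hasFDerivAt_rayExtension hf hu hv).2
    have h3 : HasDerivAt (fun t : ℝ => t • v) v 1 := by
      simpa using (hasDerivAt_id (1 : ℝ)).smul_const v
    rw [← one_smul ℝ v] at h2
    have h5 := h2.comp_hasDerivAt (1 : ℝ) h3
    have h6 := h5.clm_apply h3
    simpa using h6
  have h4 : (fun t : ℝ => fderiv ℝ (rayExtension f u) (t • v) (t • v)) =ᶠ[𝓝 1] fun _ => 0 := by
    filter_upwards [Ioi_mem_nhds one_pos] with t ht
    exact fderiv_rayExtension_self hf hu (smul_ne_zero (ne_of_gt ht) hv)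
  have h7 := h1.unique ((hasDerivAt_const (1 : ℝ) (0 : ℝ)).congr_of_eventuallyEq h4)
  rwa [fderiv_rayExtension_self hf hu hv, add_zero] at h7

/-- The great circle through `v` in the direction `ξ`. -/
noncomputable def greatCircle (v ξ : EuclideanSpace ℝ (Fin p)) (θ : ℝ) : EuclideanSpace ℝ (Fin p) :=
  Real.cos θ • v + Real.sin θ • ξ

theorem hasDerivAt_greatCircle (v ξ : EuclideanSpace ℝ (Fin p)) (θ : ℝ) :
    HasDerivAt (greatCircle v ξ) (greatCircle ξ (-v) θ) θ := by
  have h := ((Real.hasDerivAt_cos θ).smul_const v).add ((Real.hasDerivAt_sin θ).smul_const ξ)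
  refine h.congr_deriv ?_
  simp only [greatCircle, smul_neg, neg_smul]
  abel

theorem norm_greatCircle {v ξ : EuclideanSpace ℝ (Fin p)} (hv : ‖v‖ = 1) (hξ : ‖ξ‖ = 1)
    (hvξ : inner ℝ v ξ = 0) (θ : ℝ) : ‖greatCircle v ξ θ‖ = 1 := by
  have h : ‖greatCircle v ξ θ‖ * ‖greatCircle v ξ θ‖ = 1 := by
    rw [greatCircle, norm_add_mul_self_real, inner_smul_left, inner_smul_right, hvξ, norm_smul,
      norm_smul, hv, hξ]
    simp only [Real.norm_eq_abs, mul_one, mul_zero, add_zero, abs_mul_abs_self]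
    nlinarith [Real.sin_sq_add_cos_sq θ]
  nlinarith [norm_nonneg (greatCircle v ξ θ)]

theorem norm_greatCircle_sub_le {v ξ : EuclideanSpace ℝ (Fin p)} (hv : ‖v‖ = 1) (hξ : ‖ξ‖ = 1)
    (hvξ : inner ℝ v ξ = 0) (s t : ℝ) : ‖greatCircle v ξ s - greatCircle v ξ t‖ ≤ |s - t| := by
  have := convex_univ.norm_image_sub_le_of_norm_hasDerivWithin_le (f := greatCircle v ξ)
    (f' := greatCircle ξ (-v)) (C := 1)
    (fun x _ => (hasDerivAt_greatCircle v ξ x).hasDerivWithinAt)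
    (fun x _ => (norm_greatCircle hξ (by simpa using hv)
      (by rw [inner_neg_right, real_inner_comm, hvξ, neg_zero]) x).le)
    (mem_univ t) (mem_univ s)
  simpa using this

/-- Along a great circle, the density has the second derivative given by the angular Hessian. -/
theorem hasDerivAt_along_greatCircle (hf : DensityAssumption f) {u : ℝ} (hu : 0 < u)
    {v ξ : EuclideanSpace ℝ (Fin p)} (hv : ‖v‖ = 1) (hξ : ‖ξ‖ = 1) (hvξ : inner ℝ v ξ = 0)
    (θ : ℝ) :
    HasDerivAt (fun θ => f u (greatCircle v ξ θ))
      (fderiv ℝ (rayExtension f u) (greatCircle v ξ θ) (greatCircle ξ (-v) θ)) θ ∧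
    HasDerivAt (fun θ => fderiv ℝ (rayExtension f u) (greatCircle v ξ θ) (greatCircle ξ (-v) θ))
      (angularHessian f u (greatCircle v ξ θ) (greatCircle ξ (-v) θ) (greatCircle ξ (-v) θ)) θ := by
  have hn := norm_greatCircle hv hξ hvξ
  have hne : greatCircle v ξ θ ≠ 0 := by
    intro h; have := hn θ; rw [h, norm_zero] at this; exact zero_ne_one this
  obtain ⟨h1, h2⟩ := hasFDerivAt_rayExtension hf hu hne
  have hfun : (fun θ => f u (greatCircle v ξ θ)) = fun θ => rayExtension f u (greatCircle v ξ θ) := by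
    ext θ; rw [rayExtension_of_norm_one (hn θ)]
  refine ⟨?_, ?_⟩
  · rw [hfun]
    exact h1.comp_hasDerivAt θ (hasDerivAt_greatCircle v ξ θ)
  · have h3 := (h2.comp_hasDerivAt θ (hasDerivAt_greatCircle v ξ θ)).clm_apply
      (hasDerivAt_greatCircle ξ (-v) θ)
    refine h3.congr_deriv ?_
    have h4 : greatCircle (-v) (-ξ) θ = -greatCircle v ξ θ := by
      simp [greatCircle, add_comm]
    rw [h4, map_neg]
    simp [fderiv_rayExtension_self hf hu hne]

/-- Two unit vectors are joined by a great circle, at an angle comparable with their distance. -/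
theorem exists_greatCircle_eq (hp : 2 ≤ p) {v w : EuclideanSpace ℝ (Fin p)} (hv : ‖v‖ = 1)
    (hw : ‖w‖ = 1) : ∃ ξ : EuclideanSpace ℝ (Fin p), ‖ξ‖ = 1 ∧ inner ℝ v ξ = 0 ∧
      ∃ θ ∈ Icc 0 Real.pi, greatCircle v ξ θ = w ∧ θ ≤ Real.pi / 2 * ‖v - w‖ := by
  set c : ℝ := inner ℝ v w with hc
  have hc1 : c ≤ 1 := by have := real_inner_le_norm v w; rwa [hv, hw, one_mul] at this
  have hc2 : -1 ≤ c := by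
    have := neg_le_of_abs_le (abs_real_inner_le_norm v w); rwa [hv, hw, one_mul] at this
  set z := w - c • v with hz
  have hvz : inner ℝ v z = 0 := by
    rw [hz, inner_sub_right, inner_smul_right, real_inner_self_eq_norm_sq, hv, ← hc]; ring
  have hzn : ‖z‖ = √(1 - c ^ 2) := by
    rw [eq_comm, Real.sqrt_eq_iff_mul_self_eq (by nlinarith) (norm_nonneg _), ← sq, hz,
      norm_sub_sq_real, inner_smul_right, real_inner_comm, ← hc, norm_smul, hv, hw, mul_one,
      Real.norm_eq_abs, sq_abs]
    ring
  obtain ⟨ξ, hξ, hvξ, hzξ⟩ : ∃ ξ : EuclideanSpace ℝ (Fin p), ‖ξ‖ = 1 ∧ inner ℝ v ξ = 0 ∧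
      ‖z‖ • ξ = z := by
    by_cases h0 : z = 0
    · set K : Submodule ℝ (EuclideanSpace ℝ (Fin p)) := Submodule.span ℝ {v} with hK
      have hKdim : 0 < Module.finrank ℝ Kᗮ := by
        have h1 := K.finrank_add_finrank_orthogonal
        have h2 : Module.finrank ℝ K = 1 := finrank_span_singleton (by rintro rfl; simp at hv)
        rw [finrank_euclideanSpace_fin] at h1
        omega
      have := Module.nontrivial_of_finrank_pos hKdim
      obtain ⟨η, hη⟩ := exists_ne (0 : Kᗮ)
      have hη' : ‖(η : EuclideanSpace ℝ (Fin p))‖ ≠ 0 := by simpa using hη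
      refine ⟨‖(η : EuclideanSpace ℝ (Fin p))‖⁻¹ • η, ?_, ?_, by simp [h0]⟩
      · rw [norm_smul, norm_inv, norm_norm, inv_mul_cancel₀ hη']
      · rw [inner_smul_right, (Submodule.mem_orthogonal _ _).1 η.2 v
          (Submodule.mem_span_singleton_self v), mul_zero]
    · have h1 : ‖z‖ ≠ 0 := norm_ne_zero_iff.2 h0
      refine ⟨‖z‖⁻¹ • z, ?_, ?_, ?_⟩
      · rw [norm_smul, norm_inv, norm_norm, inv_mul_cancel₀ h1]
      · rw [inner_smul_right, hvz, mul_zero]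
      · rw [smul_smul, mul_inv_cancel₀ h1, one_smul]
  refine ⟨ξ, hξ, hvξ, Real.arccos c, ⟨Real.arccos_nonneg c, Real.arccos_le_pi c⟩, ?_, ?_⟩
  · rw [greatCircle, Real.cos_arccos hc2 hc1, Real.sin_arccos, ← hzn, hzξ, hz]
    abel
  · set θ := Real.arccos c
    have h0 : 0 ≤ θ := Real.arccos_nonneg c
    have hpi : θ ≤ Real.pi := Real.arccos_le_pi c
    have hs : 2 / Real.pi * (θ / 2) ≤ Real.sin (θ / 2) := Real.mul_le_sin (by linarith) (by linarith)
    have hcos : Real.cos θ = c := Real.cos_arccos hc2 hc1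
    have hn : ‖v - w‖ ^ 2 = (2 * Real.sin (θ / 2)) ^ 2 := by
      rw [norm_sub_sq_real, hv, hw, ← hc, ← hcos, mul_pow, Real.sin_sq_eq_half_sub]
      rw [show 2 * (θ / 2) = θ by ring]; ring
    have hs0 : 0 ≤ Real.sin (θ / 2) := Real.sin_nonneg_of_nonneg_of_le_pi (by linarith) (by linarith)
    have hn' : ‖v - w‖ = 2 * Real.sin (θ / 2) := by
      rwa [sq_eq_sq₀ (norm_nonneg _) (by positivity)] at hn
    rw [hn']
    have hpos := Real.pi_pos
    have h7 : 2 / Real.pi * (θ / 2) = θ / Real.pi := by ring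
    rw [h7, div_le_iff₀ hpos] at hs
    linarith

/-- The tangential part of the angular Hessian is bounded. The trace of the Hessian over the plane of
a great circle is the sum of the second derivatives of the density at two points of the circle at a
right angle, up to the oscillation of the Hessian. By periodicity this sum vanishes somewhere. -/
theorem exists_angularHessian_bound (hf : DensityAssumption f) :
    ∃ C > 0, ∀ u > 0, ∀ v ξ : EuclideanSpace ℝ (Fin p), ‖v‖ = 1 → ‖ξ‖ = 1 → inner ℝ v ξ = 0 →
      |angularHessian f u v ξ ξ| ≤ C := by
  obtain ⟨δ, hδ, hH⟩ := hf.angular 1 one_pos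
  -- all angles in use are below `2 π + π / 2 < 10`
  obtain ⟨N, hN⟩ := exists_nat_gt (10 / δ)
  have hN0 : (0 : ℝ) < N := lt_trans (by positivity) hN
  have hN0' : 0 < N := by exact_mod_cast hN0
  refine ⟨2 * N, by positivity, fun u hu v ξ hv hξ hvξ => ?_⟩
  have hn := norm_greatCircle hv hξ hvξ
  have hosc : ∀ θ ∈ Icc (0 : ℝ) 10,
      ‖angularHessian f u (greatCircle v ξ θ) - angularHessian f u v‖ ≤ N := by
    intro θ hθ
    have h0 : greatCircle v ξ (0 * θ) = v := by simp [greatCircle]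
    have := norm_sub_le_of_chain (g := fun t => angularHessian f u (greatCircle v ξ (t * θ))) hN0'
      (fun s hs t ht hst => (hH u hu _ _ (hn _) (hn _) ?_).le)
    · simpa only [one_mul, h0] using this
    · refine (norm_greatCircle_sub_le hv hξ hvξ _ _).trans_lt ?_
      rw [← sub_mul, abs_mul, abs_of_nonneg hθ.1]
      have h1 : |s - t| * θ ≤ 1 / N * 10 :=
        mul_le_mul hst hθ.2 hθ.1 (by positivity)
      refine h1.trans_lt ?_
      rw [div_lt_iff₀ hδ] at hN
      rw [one_div, inv_mul_lt_iff₀ hN0]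
      exact hN
  -- Rolle's theorem for the sum of the derivatives at `θ` and `θ + π / 2`
  set dφ : ℝ → ℝ := fun θ => fderiv ℝ (rayExtension f u) (greatCircle v ξ θ)
    (greatCircle ξ (-v) θ) with hdφ
  set ddφ : ℝ → ℝ := fun θ => angularHessian f u (greatCircle v ξ θ) (greatCircle ξ (-v) θ)
    (greatCircle ξ (-v) θ) with hddφ
  have hd2 : ∀ θ, HasDerivAt dφ (ddφ θ) θ := fun θ =>
    (hasDerivAt_along_greatCircle hf hu hv hξ hvξ θ).2
  have hper : ∀ θ, dφ (θ + 2 * Real.pi) = dφ θ := by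
    intro θ; simp only [hdφ, greatCircle, Real.cos_add_two_pi, Real.sin_add_two_pi]
  have hshift : ∀ θ, HasDerivAt (fun θ => dφ θ + dφ (θ + Real.pi / 2))
      (ddφ θ + ddφ (θ + Real.pi / 2)) θ := fun θ =>
    (hd2 θ).add ((hd2 (θ + Real.pi / 2)).comp_add_const θ (Real.pi / 2))
  obtain ⟨θ, hθ, h0⟩ := exists_hasDerivAt_eq_zero (f := fun θ => dφ θ + dφ (θ + Real.pi / 2))
    (f' := fun θ => ddφ θ + ddφ (θ + Real.pi / 2)) (a := 0) (b := 2 * Real.pi)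
    (by have := Real.pi_pos; positivity)
    (fun θ _ => (hshift θ).continuousAt.continuousWithinAt)
    (by
      have h1 := hper 0
      have h2 := hper (Real.pi / 2)
      rw [zero_add] at h1
      rw [h1, zero_add, add_comm (2 * Real.pi), h2]) (fun θ _ => hshift θ)
  have hpi := Real.pi_lt_d2
  have hpi0 := Real.pi_pos
  have b1 := hosc θ ⟨hθ.1.le, by linarith [hθ.2]⟩
  have b2 := hosc (θ + Real.pi / 2) ⟨by linarith [hθ.1], by linarith [hθ.2]⟩
  have e1 : greatCircle ξ (-v) (θ + Real.pi / 2) = -greatCircle v ξ θ := by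
    simp only [greatCircle, Real.cos_add_pi_div_two, Real.sin_add_pi_div_two]
    simp [add_comm]
  have hn' : ‖greatCircle ξ (-v) θ‖ = 1 := norm_greatCircle hξ (by simpa using hv)
      (by rw [inner_neg_right, real_inner_comm, hvξ, neg_zero]) θ
  have happ : ∀ (A : EuclideanSpace ℝ (Fin p) →L[ℝ] EuclideanSpace ℝ (Fin p) →L[ℝ] ℝ)
      (z : EuclideanSpace ℝ (Fin p)), ‖z‖ = 1 → |A z z| ≤ ‖A‖ := by
    intro A z hz
    have := A.le_opNorm₂ z z
    rwa [hz, mul_one, mul_one] at this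
  have c1 := (happ _ _ hn').trans b1
  have c2 := (happ _ _ (hn θ)).trans b2
  have hvne : v ≠ 0 := by rintro rfl; simp at hv
  have htrace : angularHessian f u v ξ ξ
      = angularHessian f u v (greatCircle ξ (-v) θ) (greatCircle ξ (-v) θ)
        + angularHessian f u v (greatCircle v ξ θ) (greatCircle v ξ θ) := by
    have h1 := angularHessian_self_self hf hu hvne
    have h2 := Real.sin_sq_add_cos_sq θ
    simp only [greatCircle, map_add, map_smul, map_neg, add_apply,
      smul_apply, neg_apply, smul_eq_mul, h1, smul_neg]
    linear_combination (-(angularHessian f u v ξ ξ)) * h2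
  simp only [hddφ, e1, map_neg, neg_apply, neg_neg] at h0
  simp only [sub_apply] at c1 c2
  rw [htrace]
  rw [abs_le] at *
  constructor <;> linarith [c1.1, c1.2, c2.1, c2.2]

end Angular

/-! ### Uniform bounds for the density -/

section Bounds
variable {p : ℕ} {f : ℝ → EuclideanSpace ℝ (Fin p) → ℝ}

/-- Glaeser's inequality along the great circle that joins two directions. There is no boundary, so
the constant is uniform in the radius. -/
theorem exists_angular_glaeser (hp : 2 ≤ p) (hf : DensityAssumption f)
    (h0 : ∀ u > 0, ∀ v, ‖v‖ = 1 → 0 ≤ f u v) :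
    ∃ C > 0, ∀ u > 0, ∀ v w : EuclideanSpace ℝ (Fin p), ‖v‖ = 1 → ‖w‖ = 1 →
      (f u v - f u w) ^ 2 ≤ C * ‖v - w‖ ^ 2 * (f u v + f u w) := by
  obtain ⟨C, hC, hH⟩ := exists_angularHessian_bound hf
  have hpi := Real.pi_pos
  refine ⟨10 * C * (Real.pi / 2) ^ 2, by positivity, fun u hu v w hv hw => ?_⟩
  obtain ⟨ξ, hξ, hvξ, θ, hθ, hcirc, hle⟩ := exists_greatCircle_eq hp hv hw
  have hn := norm_greatCircle hv hξ hvξ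
  have hn' := norm_greatCircle (v := ξ) (ξ := -v) hξ (by simpa using hv)
      (by rw [inner_neg_right, real_inner_comm, hvξ, neg_zero])
  have horth : ∀ t, inner ℝ (greatCircle v ξ t) (greatCircle ξ (-v) t) = 0 := by
    intro t
    simp only [greatCircle, inner_add_left, inner_add_right, inner_smul_left, inner_smul_right,
      inner_neg_right, hvξ, real_inner_comm v ξ, real_inner_self_eq_norm_sq, hv, hξ]
    simp; ring
  have hT := fun x y => abs_taylor_le convex_univ
    (fun t _ => (hasDerivAt_along_greatCircle hf hu hv hξ hvξ t).1)
    (fun t _ => (hasDerivAt_along_greatCircle hf hu hv hξ hvξ t).2)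
    (fun t _ => hH u hu _ _ (hn t) (hn' t) (horth t)) (mem_univ x) (mem_univ y)
  have h := glaeser_sq_sub_le hC (fun x _ y _ => hT x y) (fun t _ => h0 u hu _ (hn t))
    (mem_univ 0) (mem_univ θ) (mem_univ _) (mem_univ _)
  have hz : greatCircle v ξ 0 = v := by simp [greatCircle]
  rw [hcirc, hz] at h
  refine h.trans ?_
  have hs : 0 ≤ f u v + f u w := add_nonneg (h0 u hu v hv) (h0 u hu w hw)
  have hθ2 : (0 - θ) ^ 2 ≤ (Real.pi / 2) ^ 2 * ‖v - w‖ ^ 2 := by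
    rw [zero_sub, neg_sq, ← mul_pow]
    exact pow_le_pow_left₀ hθ.1 hle 2
  refine mul_le_mul_of_nonneg_right ?_ hs
  rw [mul_assoc (10 * C)]
  exact mul_le_mul_of_nonneg_left hθ2 (by positivity)

/-- A density cannot be large throughout a slab of unit width. -/
theorem exists_small_in_slab (hp : 2 ≤ p)
    (hmass : ∫⁻ x, ENNReal.ofReal (f x.1 x.2) ∂(polarMeasure p) ≤ 1) {a : ℝ} (ha : 0 ≤ a) :
    ∃ u ∈ Ioo a (a + 1), ∃ v, ‖v‖ = 1 ∧ f u v ≤ 2 / unitSphereArea p := by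
  have hA : 0 < unitSphereArea p := unitSphereArea_pos (by
    have : (2 : ℝ) ≤ p := by exact_mod_cast hp
    linarith)
  by_contra! hcon
  set s : Set (ℝ × EuclideanSpace ℝ (Fin p)) := Ioo a (a + 1) ×ˢ univ with hs
  have hsm : MeasurableSet s := measurableSet_Ioo.prod MeasurableSet.univ
  have hsub : Ioo a (a + 1) ⊆ Ioi (0 : ℝ) := fun x hx => lt_of_le_of_lt ha hx.1
  have hμs : polarMeasure p s = ENNReal.ofReal (unitSphereArea p) := by
    rw [hs, polarMeasure, Measure.prod_prod, surfaceMeasure_univ (by omega),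
      Measure.restrict_apply measurableSet_Ioo,
      inter_eq_self_of_subset_left hsub, Real.volume_Ioo]
    simp
  have hae : ∀ᵐ x ∂(polarMeasure p), ‖x.2‖ = 1 :=
    Measure.quasiMeasurePreserving_snd.ae ae_surfaceMeasure_norm
  have h1 : ∫⁻ x in s, ENNReal.ofReal (2 / unitSphereArea p) ∂(polarMeasure p)
      ≤ ∫⁻ x in s, ENNReal.ofReal (f x.1 x.2) ∂(polarMeasure p) := by
    refine setLIntegral_mono_ae' hsm ?_
    filter_upwards [hae] with x hx hxs
    exact ENNReal.ofReal_le_ofReal (hcon x.1 hxs.1 x.2 hx).le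
  have h2 := h1.trans ((setLIntegral_le_lintegral _ _).trans hmass)
  rw [setLIntegral_const, hμs, ← ENNReal.ofReal_mul (by positivity), div_mul_cancel₀ _ hA.ne'] at h2
  norm_num at h2

/-- The angular regularity spreads a bound at one point of a slab to the whole sphere of that radius. -/
theorem exists_small_slice (hp : 2 ≤ p) (hf : DensityAssumption f)
    (h0 : ∀ u > 0, ∀ v, ‖v‖ = 1 → 0 ≤ f u v)
    (hmass : ∫⁻ x, ENNReal.ofReal (f x.1 x.2) ∂(polarMeasure p) ≤ 1) :
    ∃ B > 0, ∀ a ≥ 0, ∃ u ∈ Ioo a (a + 1), ∀ v, ‖v‖ = 1 → f u v ≤ B := by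
  have hA : 0 < unitSphereArea p := unitSphereArea_pos (by
    have : (2 : ℝ) ≤ p := by exact_mod_cast hp
    linarith)
  obtain ⟨C, hC, hG⟩ := exists_angular_glaeser hp hf h0
  refine ⟨3 * (2 / unitSphereArea p) + 4 * C, by positivity, fun a ha => ?_⟩
  obtain ⟨u, hu, w, hw, hfw⟩ := exists_small_in_slab hp hmass ha
  refine ⟨u, hu, fun v hv => ?_⟩
  have hu0 : 0 < u := lt_of_le_of_lt ha hu.1
  have h1 := hG u hu0 v w hv hw
  have hy := h0 u hu0 w hw
  have hx := h0 u hu0 v hv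
  have hn : ‖v - w‖ ^ 2 ≤ 4 := by
    have := norm_sub_le v w
    rw [hv, hw] at this
    nlinarith [norm_nonneg (v - w)]
  have h2 : (f u v - f u w) ^ 2 ≤ 4 * C * (f u v + f u w) := by
    refine h1.trans (mul_le_mul_of_nonneg_right ?_ (by linarith))
    nlinarith
  set b := 2 / unitSphereArea p
  have hCpos : 0 ≤ 4 * C := by linarith
  by_contra! hlt
  have h3 : 4 * C + 2 * f u w < f u v - f u w := by linarith
  nlinarith [mul_pos (sub_pos.2 h3) (lt_of_le_of_lt (by linarith : 0 ≤ 4 * C + 2 * f u w) h3)]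

/-- The density and its first two radial derivatives are bounded. -/
theorem exists_radial_bounds (hp : 2 ≤ p) (hf : DensityAssumption f)
    (h0 : ∀ u > 0, ∀ v, ‖v‖ = 1 → 0 ≤ f u v)
    (hmass : ∫⁻ x, ENNReal.ofReal (f x.1 x.2) ∂(polarMeasure p) ≤ 1) :
    ∃ C > 0, ∀ u > 0, ∀ v, ‖v‖ = 1 → f u v ≤ C ∧ |deriv (fun r => f r v) u| ≤ C ∧
      |radialSecondDeriv f u v| ≤ C := by
  obtain ⟨B, hB, hslice⟩ := exists_small_slice hp hf h0 hmass
  obtain ⟨δ, hδ, hR⟩ := hf.radial 1 one_pos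
  obtain ⟨N, hN⟩ := exists_nat_gt (8 / δ)
  have hN0 : (0 : ℝ) < N := lt_trans (by positivity) hN
  have hN0' : 0 < N := by exact_mod_cast hN0
  refine ⟨2 * B + 8 * (2 * B + N), by positivity, fun u hu v hv => ?_⟩
  have hosc : ∀ r > 0, ∀ s > 0, |r - s| ≤ 8 →
      |radialSecondDeriv f r v - radialSecondDeriv f s v| ≤ N := by
    intro r hr s hs hrs
    have := norm_sub_le_of_chain (g := fun t => radialSecondDeriv f (s + t * (r - s)) v) hN0'
      (fun x hx y hy hxy => (hR v hv _ ?_ _ ?_ ?_).le)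
    · simpa using this
    · nlinarith [hx.1, hx.2, mul_nonneg hx.1 hr.le, mul_nonneg (sub_nonneg.2 hx.2) hs.le]
    · nlinarith [hy.1, hy.2, mul_nonneg hy.1 hr.le, mul_nonneg (sub_nonneg.2 hy.2) hs.le]
    · rw [add_sub_add_left_eq_sub, ← sub_mul, abs_mul]
      have h1 : |x - y| * |r - s| ≤ 1 / N * 8 := mul_le_mul hxy hrs (abs_nonneg _) (by positivity)
      refine h1.trans_lt ?_
      rw [div_lt_iff₀ hδ] at hN
      rw [one_div, inv_mul_lt_iff₀ hN0]
      exact hN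
  -- four radii at which the density is bounded control two first derivatives and, through these, one
  -- second derivative at `z`; the oscillation bound transfers it to `u`
  obtain ⟨x1, hx1, f1⟩ := hslice u hu.le
  obtain ⟨x2, hx2, f2⟩ := hslice (u + 2) (by linarith)
  obtain ⟨x3, hx3, f3⟩ := hslice (u + 4) (by linarith)
  obtain ⟨x4, hx4, f4⟩ := hslice (u + 6) (by linarith)
  simp only [mem_Ioo] at hx1 hx2 hx3 hx4
  have hd1 : ∀ x > 0, HasDerivAt (fun r => f r v) (deriv (fun r => f r v) x) x :=
    fun x hx => (hasDerivAt_radial hf hv hx).1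
  have hd2 : ∀ x > 0, HasDerivAt (deriv (fun r => f r v)) (radialSecondDeriv f x v) x :=
    fun x hx => (hasDerivAt_radial hf hv hx).2
  have hslope : ∀ a b : ℝ, 0 < a → a + 1 ≤ b → f a v ≤ B → f b v ≤ B →
      ∃ y ∈ Ioo a b, |deriv (fun r => f r v) y| ≤ B := by
    intro a b ha hab fa fb
    obtain ⟨y, hy, hyeq⟩ := exists_hasDerivAt_eq_slope (fun r => f r v) _ (by linarith : a < b)
      (fun x hx => (hd1 x (by linarith [hx.1])).continuousAt.continuousWithinAt)
      (fun x hx => hd1 x (by linarith [hx.1]))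
    refine ⟨y, hy, ?_⟩
    have h1 := h0 a ha v hv
    have h2 := h0 b (by linarith) v hv
    rw [hyeq, abs_div, abs_of_pos (by linarith : 0 < b - a), div_le_iff₀ (by linarith)]
    have h3 : |f b v - f a v| ≤ B := by rw [abs_le]; constructor <;> linarith
    nlinarith
  obtain ⟨y1, hy1, g1⟩ := hslope x1 x2 (by linarith) (by linarith) (f1 v hv) (f2 v hv)
  obtain ⟨y2, hy2, g2⟩ := hslope x3 x4 (by linarith) (by linarith) (f3 v hv) (f4 v hv)
  simp only [mem_Ioo] at hy1 hy2
  obtain ⟨z, hz, hzeq⟩ := exists_hasDerivAt_eq_slope (deriv (fun r => f r v)) _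
    (by linarith : y1 < y2)
    (fun x hx => (hd2 x (by linarith [hx.1])).continuousAt.continuousWithinAt)
    (fun x hx => hd2 x (by linarith [hx.1]))
  simp only [mem_Ioo] at hz
  have hzb : |radialSecondDeriv f z v| ≤ 2 * B := by
    rw [hzeq, abs_div, abs_of_pos (by linarith : 0 < y2 - y1), div_le_iff₀ (by linarith)]
    have := abs_sub (deriv (fun r => f r v) y2) (deriv (fun r => f r v) y1)
    nlinarith
  have hdd : ∀ x ∈ Icc u (u + 8), |radialSecondDeriv f x v| ≤ 2 * B + N := by
    intro x hx
    have h1 := hosc x (by linarith [hx.1]) z (by linarith)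
      (by rw [abs_le]; constructor <;> linarith [hx.1, hx.2])
    have h2 := abs_sub_abs_le_abs_sub (radialSecondDeriv f x v) (radialSecondDeriv f z v)
    linarith
  have hd : ∀ x ∈ Icc u (u + 4), |deriv (fun r => f r v) x| ≤ B + 4 * (2 * B + N) := by
    intro x hx
    have h1 := (convex_Icc u (u + 8)).norm_image_sub_le_of_norm_hasDerivWithin_le
      (fun t ht => (hd2 t (by linarith [ht.1])).hasDerivWithinAt) hdd
      (x := y1) (y := x) ⟨by linarith, by linarith⟩ ⟨hx.1, by linarith [hx.2]⟩
    rw [Real.norm_eq_abs, Real.norm_eq_abs] at h1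
    have h2 : |x - y1| ≤ 4 := by rw [abs_le]; constructor <;> linarith [hx.1, hx.2]
    have h3 := abs_sub_abs_le_abs_sub (deriv (fun r => f r v) x) (deriv (fun r => f r v) y1)
    have h4 : (2 * B + N) * |x - y1| ≤ (2 * B + N) * 4 :=
      mul_le_mul_of_nonneg_left h2 (by positivity)
    linarith
  refine ⟨?_, ?_, ?_⟩
  · have h1 := (convex_Icc u (u + 4)).norm_image_sub_le_of_norm_hasDerivWithin_le
      (fun t ht => (hd1 t (by linarith [ht.1])).hasDerivWithinAt) hd
      (x := x1) (y := u) ⟨by linarith, by linarith⟩ ⟨le_rfl, by linarith⟩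
    rw [Real.norm_eq_abs, Real.norm_eq_abs] at h1
    have h2 : |u - x1| ≤ 1 := by rw [abs_le]; constructor <;> linarith
    have h3 := le_abs_self (f u v - f x1 v)
    have h4 : (B + 4 * (2 * B + N)) * |u - x1| ≤ (B + 4 * (2 * B + N)) * 1 :=
      mul_le_mul_of_nonneg_left h2 (by positivity)
    have h5 := f1 v hv
    linarith
  · have := hd u ⟨le_rfl, by linarith⟩
    linarith
  · have := hdd u ⟨le_rfl, by linarith⟩
    linarith

/-- Quantitative regularity of the density: boundedness, Lipschitz continuity in the radius, and
Lipschitz continuity of its square root, radially away from the origin and in the direction. -/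
theorem exists_density_bounds (hp : 2 ≤ p) (hf : DensityAssumption f)
    (h0 : ∀ u > 0, ∀ v, ‖v‖ = 1 → 0 ≤ f u v)
    (hmass : ∫⁻ x, ENNReal.ofReal (f x.1 x.2) ∂(polarMeasure p) ≤ 1) :
    ∃ C > 0, (∀ u > 0, ∀ v, ‖v‖ = 1 → f u v ≤ C) ∧
      (∀ u > 0, ∀ u' > 0, ∀ v, ‖v‖ = 1 → |f u v - f u' v| ≤ C * |u - u'|) ∧
      (∀ u ≥ 1, ∀ u' ≥ 1, ∀ v, ‖v‖ = 1 →
        (f u v - f u' v) ^ 2 ≤ C * (u - u') ^ 2 * (f u v + f u' v)) ∧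
      (∀ u > 0, ∀ v w, ‖v‖ = 1 → ‖w‖ = 1 →
        (f u v - f u w) ^ 2 ≤ C * ‖v - w‖ ^ 2 * (f u v + f u w)) := by
  obtain ⟨C1, hC1, hang⟩ := exists_angular_glaeser hp hf h0
  obtain ⟨C2, hC2, hrad⟩ := exists_radial_bounds hp hf h0 hmass
  refine ⟨C1 + 10 * C2, by positivity, fun u hu v hv => ?_, fun u hu u' hu' v hv => ?_,
    fun u hu u' hu' v hv => ?_, fun u hu v w hv hw => ?_⟩
  · have := (hrad u hu v hv).1
    linarith
  · have h1 := (convex_Ioi (0 : ℝ)).norm_image_sub_le_of_norm_hasDerivWithin_le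
      (fun t ht => (hasDerivAt_radial hf hv ht).1.hasDerivWithinAt)
      (fun t ht => (hrad t ht v hv).2.1) (mem_Ioi.2 hu') (mem_Ioi.2 hu)
    refine le_trans h1 (mul_le_mul_of_nonneg_right (by linarith) (abs_nonneg _))
  · -- the restriction to radii above `1` keeps the minimum of the Taylor parabola positive
    have hpos : ∀ x ≥ (1 : ℝ), x - deriv (fun r => f r v) x / (2 * C2) ∈ Ioi (0 : ℝ) := by
      intro x hx
      have h1 := (hrad x (by linarith) v hv).2.1
      have h2 : deriv (fun r => f r v) x / (2 * C2) ≤ 1 / 2 := by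
        rw [div_le_iff₀ (by positivity)]; linarith [le_abs_self (deriv (fun r => f r v) x)]
      rw [mem_Ioi]; linarith
    have h := glaeser_sq_sub_le (φ := fun r => f r v) (I := Ioi 0) hC2
      (fun x hx y hy => abs_taylor_le (convex_Ioi 0)
        (fun t ht => (hasDerivAt_radial hf hv ht).1) (fun t ht => (hasDerivAt_radial hf hv ht).2)
        (fun t ht => (hrad t ht v hv).2.2) hx hy)
      (fun x hx => h0 x hx v hv) (mem_Ioi.2 (by linarith : 0 < u)) (mem_Ioi.2 (by linarith : 0 < u'))
      (hpos u hu) (hpos u' hu')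
    refine h.trans ?_
    have hs : 0 ≤ f u v + f u' v :=
      add_nonneg (h0 u (by linarith) v hv) (h0 u' (by linarith) v hv)
    refine mul_le_mul_of_nonneg_right (mul_le_mul_of_nonneg_right (by linarith) (sq_nonneg _)) hs
  · refine (hang u hu v w hv hw).trans ?_
    have hs : 0 ≤ f u v + f u w := add_nonneg (h0 u hu v hv) (h0 u hu w hw)
    exact mul_le_mul_of_nonneg_right (mul_le_mul_of_nonneg_right (by linarith) (sq_nonneg _)) hs

end Bounds

/-! ### The deviation of the density from spherical symmetry -/

section Ambient
variable {p : ℕ} {f : ℝ → EuclideanSpace ℝ (Fin p) → ℝ}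

/-- The product of Lebesgue measure on the whole line with the surface measure. Extending the radius
to negative values makes convolution in the radius a symmetric Markov operator. -/
noncomputable def cylMeasure (p : ℕ) : Measure (ℝ × EuclideanSpace ℝ (Fin p)) :=
  (volume : Measure ℝ).prod (surfaceMeasure p)

instance : SigmaFinite (cylMeasure p) := by unfold cylMeasure; infer_instance

theorem ae_cylMeasure_norm : ∀ᵐ x ∂(cylMeasure p), ‖x.2‖ = 1 :=
  Measure.quasiMeasurePreserving_snd.ae ae_surfaceMeasure_norm

theorem polarMeasure_eq_restrict :
    polarMeasure p = (cylMeasure p).restrict (Ioi 0 ×ˢ univ) := by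
  rw [polarMeasure, cylMeasure, ← Measure.prod_restrict, Measure.restrict_univ]

/-- The function `f` is a probability density on `ℝ⁺ × S^{p-1}`. -/
structure IsPolarDensity (f : ℝ → EuclideanSpace ℝ (Fin p) → ℝ) : Prop where
  nonneg : ∀ u > 0, ∀ v, ‖v‖ = 1 → 0 ≤ f u v
  mass : ∫⁻ x, ENNReal.ofReal (f x.1 x.2) ∂(polarMeasure p) = 1

/-- The density `f`, extended by zero from `ℝ⁺ × S^{p-1}`. -/
noncomputable def polarExt (f : ℝ → EuclideanSpace ℝ (Fin p) → ℝ)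
    (x : ℝ × EuclideanSpace ℝ (Fin p)) : ℝ :=
  (Ioi (0 : ℝ) ×ˢ Metric.sphere (0 : EuclideanSpace ℝ (Fin p)) 1).indicator
    (fun x => f x.1 x.2) x

/-- The spherical mean of the density, `f_U / ω_{p-1}`. -/
noncomputable def radialMean (f : ℝ → EuclideanSpace ℝ (Fin p) → ℝ) (u : ℝ) : ℝ :=
  (unitSphereArea p)⁻¹ * ∫ v, polarExt f (u, v) ∂(surfaceMeasure p)

/-- The deviation `f - f_U / ω_{p-1}` of the density from spherical symmetry. -/
noncomputable def devPart (f : ℝ → EuclideanSpace ℝ (Fin p) → ℝ)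
    (x : ℝ × EuclideanSpace ℝ (Fin p)) : ℝ := polarExt f x - radialMean f x.1

theorem unitSphereArea_natCast_pos (hp : 2 ≤ p) : 0 < unitSphereArea p :=
  unitSphereArea_pos (by
    have : (2 : ℝ) ≤ p := by exact_mod_cast hp
    linarith)

theorem polarExt_apply {u : ℝ} (hu : 0 < u) {v : EuclideanSpace ℝ (Fin p)} (hv : ‖v‖ = 1) :
    polarExt f (u, v) = f u v :=
  indicator_of_mem (s := Ioi (0 : ℝ) ×ˢ Metric.sphere (0 : EuclideanSpace ℝ (Fin p)) 1)
    (mk_mem_prod (mem_Ioi.2 hu) (by simpa using hv)) _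

theorem polarExt_of_nonpos {u : ℝ} (hu : u ≤ 0) (v : EuclideanSpace ℝ (Fin p)) :
    polarExt f (u, v) = 0 :=
  indicator_of_notMem (fun h => absurd h.1 (not_lt.2 hu)) _

theorem radialMean_of_nonpos {u : ℝ} (hu : u ≤ 0) : radialMean f u = 0 := by
  simp [radialMean, polarExt_of_nonpos hu]

theorem devPart_of_nonpos {u : ℝ} (hu : u ≤ 0) (v : EuclideanSpace ℝ (Fin p)) :
    devPart f (u, v) = 0 := by
  simp [devPart, polarExt_of_nonpos hu, radialMean_of_nonpos hu]

theorem polarExt_nonneg (hd : IsPolarDensity f) (x : ℝ × EuclideanSpace ℝ (Fin p)) :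
    0 ≤ polarExt f x :=
  indicator_nonneg (fun x hx => hd.nonneg x.1 hx.1 x.2 (by simpa using hx.2)) x

theorem measurableSet_polarSet :
    MeasurableSet (Ioi (0 : ℝ) ×ˢ Metric.sphere (0 : EuclideanSpace ℝ (Fin p)) 1) :=
  measurableSet_Ioi.prod Metric.isClosed_sphere.measurableSet

theorem measurable_polarExt (hf : DensityAssumption f) : Measurable (polarExt f) := by
  classical
  have h1 : polarExt f = (Ioi (0 : ℝ) ×ˢ Metric.sphere (0 : EuclideanSpace ℝ (Fin p)) 1).piecewise
      (fun x => rayExtension f x.1 x.2) (fun _ => 0) := by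
    ext x
    by_cases hx : x ∈ Ioi (0 : ℝ) ×ˢ Metric.sphere (0 : EuclideanSpace ℝ (Fin p)) 1
    · rw [piecewise_eq_of_mem _ _ _ hx, polarExt, indicator_of_mem hx,
        rayExtension_of_norm_one (by simpa using hx.2)]
    · rw [piecewise_eq_of_notMem _ _ _ hx, polarExt, indicator_of_notMem hx]
  rw [h1]
  refine ContinuousOn.measurable_piecewise ?_ continuousOn_const measurableSet_polarSet
  refine hf.differentiable.continuousOn.mono (prod_mono le_rfl fun v hv => ?_)
  rw [mem_sphere_zero_iff_norm] at hv
  intro h0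
  rw [mem_singleton_iff.1 h0, norm_zero] at hv
  exact zero_ne_one hv

theorem lintegral_polarExt (hd : IsPolarDensity f) :
    ∫⁻ x, ENNReal.ofReal (polarExt f x) ∂(cylMeasure p) = 1 := by
  rw [← hd.mass, polarMeasure_eq_restrict,
    ← lintegral_indicator (measurableSet_Ioi.prod MeasurableSet.univ)]
  refine lintegral_congr_ae ?_
  filter_upwards [ae_cylMeasure_norm] with x hx
  by_cases hu : 0 < x.1
  · rw [indicator_of_mem (show x ∈ Ioi (0 : ℝ) ×ˢ univ from ⟨hu, mem_univ _⟩),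
      show x = (x.1, x.2) from rfl, polarExt_apply hu hx]
  · rw [indicator_of_notMem (fun h => hu h.1), show x = (x.1, x.2) from rfl,
      polarExt_of_nonpos (not_lt.1 hu), ENNReal.ofReal_zero]

theorem integrable_polarExt (hf : DensityAssumption f) (hd : IsPolarDensity f) :
    Integrable (polarExt f) (cylMeasure p) := by
  refine ⟨(measurable_polarExt hf).aestronglyMeasurable, ?_⟩
  rw [hasFiniteIntegral_iff_ofReal (Eventually.of_forall (polarExt_nonneg hd)),
    lintegral_polarExt hd]
  exact ENNReal.one_lt_top

theorem measurable_radialMean (hf : DensityAssumption f) : Measurable (radialMean f) :=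
  ((measurable_polarExt hf).stronglyMeasurable.integral_prod_right').measurable.const_mul _

theorem measurable_devPart (hf : DensityAssumption f) : Measurable (devPart f) :=
  (measurable_polarExt hf).sub ((measurable_radialMean hf).comp measurable_fst)

theorem radialMean_nonneg (hp : 2 ≤ p) (hd : IsPolarDensity f) (u : ℝ) : 0 ≤ radialMean f u := by
  have := unitSphereArea_natCast_pos hp
  exact mul_nonneg (by positivity) (integral_nonneg fun v => polarExt_nonneg hd _)

/-- Upper bound for the extended density and regularity of its two arguments. -/
structure DensityBounds (f : ℝ → EuclideanSpace ℝ (Fin p) → ℝ) (C : ℝ) : Prop where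
  pos : 0 < C
  le : ∀ u > 0, ∀ v, ‖v‖ = 1 → f u v ≤ C
  lip : ∀ u > 0, ∀ u' > 0, ∀ v, ‖v‖ = 1 → |f u v - f u' v| ≤ C * |u - u'|
  radial : ∀ u ≥ 1, ∀ u' ≥ 1, ∀ v, ‖v‖ = 1 →
        (f u v - f u' v) ^ 2 ≤ C * (u - u') ^ 2 * (f u v + f u' v)
  angular : ∀ u > 0, ∀ v w, ‖v‖ = 1 → ‖w‖ = 1 →
        (f u v - f u w) ^ 2 ≤ C * ‖v - w‖ ^ 2 * (f u v + f u w)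

theorem exists_densityBounds (hp : 2 ≤ p) (hf : DensityAssumption f) (hd : IsPolarDensity f) :
    ∃ C, DensityBounds f C := by
  obtain ⟨C, h1, h2, h3, h4, h5⟩ := exists_density_bounds hp hf hd.nonneg hd.mass.le
  exact ⟨C, h1, h2, h3, h4, h5⟩

theorem polarExt_le {C : ℝ} (hC : DensityBounds f C) (x : ℝ × EuclideanSpace ℝ (Fin p)) :
    polarExt f x ≤ C :=
  indicator_apply_le' (fun hx => hC.le x.1 hx.1 x.2 (by simpa using hx.2)) fun _ => hC.pos.le

theorem integrable_polarExt_section (hf : DensityAssumption f) (hd : IsPolarDensity f) {C : ℝ}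
    (hC : DensityBounds f C) (u : ℝ) :
    Integrable (fun v => polarExt f (u, v)) (surfaceMeasure p) :=
  Integrable.of_bound ((measurable_polarExt hf).comp measurable_prodMk_left).aestronglyMeasurable C
    (Eventually.of_forall fun v => by
      rw [Real.norm_of_nonneg (polarExt_nonneg hd _)]; exact polarExt_le hC _)

theorem radialMean_le (hp : 2 ≤ p) (hf : DensityAssumption f) (hd : IsPolarDensity f) {C : ℝ}
    (hC : DensityBounds f C) (u : ℝ) : radialMean f u ≤ C := by
  have hA := unitSphereArea_natCast_pos hp
  have h1 := integral_mono (integrable_polarExt_section hf hd hC u) (integrable_const C)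
    fun v => polarExt_le hC (u, v)
  rw [integral_const, surfaceMeasure_real_univ (by omega), smul_eq_mul] at h1
  rw [radialMean, inv_mul_le_iff₀ hA]
  exact h1

theorem integral_devPart_section (hp : 2 ≤ p) (hf : DensityAssumption f) (hd : IsPolarDensity f)
    {C : ℝ} (hC : DensityBounds f C) (u : ℝ) :
    ∫ v, devPart f (u, v) ∂(surfaceMeasure p) = 0 := by
  have hA := unitSphereArea_natCast_pos hp
  simp only [devPart]
  rw [integral_sub (integrable_polarExt_section hf hd hC u) (integrable_const _), integral_const,
    surfaceMeasure_real_univ (by omega), smul_eq_mul, radialMean, ← mul_assoc,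
    mul_inv_cancel₀ hA.ne', one_mul, sub_self]

theorem lintegral_radialMean (hp : 2 ≤ p) (hf : DensityAssumption f) (hd : IsPolarDensity f)
    {C : ℝ} (hC : DensityBounds f C) :
    ∫⁻ x, ENNReal.ofReal (radialMean f x.1) ∂(cylMeasure p) = 1 := by
  have hA := unitSphereArea_natCast_pos hp
  have hm := measurable_radialMean hf
  rw [← lintegral_polarExt hd, cylMeasure, lintegral_prod _ (by fun_prop),
    lintegral_prod _ (measurable_polarExt hf).ennreal_ofReal.aemeasurable]
  refine lintegral_congr fun u => ?_
  change ∫⁻ _, ENNReal.ofReal (radialMean f u) ∂(surfaceMeasure p) = _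
  rw [lintegral_const, surfaceMeasure_univ (by omega),
    ← ENNReal.ofReal_mul (radialMean_nonneg hp hd u), ← ofReal_integral_eq_lintegral_ofReal
      (integrable_polarExt_section hf hd hC u) (Eventually.of_forall fun v => polarExt_nonneg hd _)]
  congr 1
  rw [radialMean]; field_simp

theorem integrable_radialMean (hp : 2 ≤ p) (hf : DensityAssumption f) (hd : IsPolarDensity f)
    {C : ℝ} (hC : DensityBounds f C) :
    Integrable (fun x : ℝ × EuclideanSpace ℝ (Fin p) => radialMean f x.1) (cylMeasure p) := by
  refine ⟨((measurable_radialMean hf).comp measurable_fst).aestronglyMeasurable, ?_⟩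
  rw [hasFiniteIntegral_iff_ofReal (Eventually.of_forall fun x => radialMean_nonneg hp hd _),
    lintegral_radialMean hp hf hd hC]
  exact ENNReal.one_lt_top

theorem integrable_devPart (hp : 2 ≤ p) (hf : DensityAssumption f) (hd : IsPolarDensity f)
    {C : ℝ} (hC : DensityBounds f C) : Integrable (devPart f) (cylMeasure p) :=
  (integrable_polarExt hf hd).sub (integrable_radialMean hp hf hd hC)

theorem abs_devPart_le (hp : 2 ≤ p) (hf : DensityAssumption f) (hd : IsPolarDensity f) {C : ℝ}
    (hC : DensityBounds f C) (x : ℝ × EuclideanSpace ℝ (Fin p)) : |devPart f x| ≤ C := by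
  have h1 := polarExt_nonneg hd x
  have h2 := polarExt_le hC x
  have h3 := radialMean_nonneg hp hd x.1
  have h4 := radialMean_le hp hf hd hC x.1
  rw [devPart, abs_le]; constructor <;> linarith

/-- Estimates of the form `(a - m)² ≤ c (a + m)` express closeness of the square roots, hence can be
chained. -/
theorem sq_sub_le_of_sqrt_lip {a b m c : ℝ} (ha : 0 ≤ a) (hb : 0 ≤ b) (hm : 0 ≤ m) {c' : ℝ}
    (hc : 0 ≤ c) (hc' : 0 ≤ c')
    (h1 : (a - m) ^ 2 ≤ c * (a + m)) (h2 : (m - b) ^ 2 ≤ c' * (m + b)) :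
    (a - b) ^ 2 ≤ 4 * (c + c') * (a + b) := by
  have key : ∀ {x y k : ℝ}, 0 ≤ x → 0 ≤ y → 0 ≤ k → (x - y) ^ 2 ≤ k * (x + y) →
      (√x - √y) ^ 2 ≤ k := by
    intro x y k hx hy hk h
    have e1 : (x - y) ^ 2 = (√x - √y) ^ 2 * (√x + √y) ^ 2 := by
      rw [← mul_pow]; congr 1; nlinarith [Real.sq_sqrt hx, Real.sq_sqrt hy]
    have e2 : x + y ≤ (√x + √y) ^ 2 := by
      have h3 := Real.sq_sqrt hx
      have h4 := Real.sq_sqrt hy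
      have h5 := mul_nonneg (Real.sqrt_nonneg x) (Real.sqrt_nonneg y)
      nlinarith
    rcases (add_nonneg hx hy).eq_or_lt with h0 | h0
    · have hx0 : x = 0 := by linarith
      have hy0 : y = 0 := by linarith
      simp [hx0, hy0, hk]
    · rw [e1] at h
      have h6 := mul_le_mul_of_nonneg_left e2 (sq_nonneg (√x - √y))
      exact le_of_mul_le_mul_right (h6.trans h) h0
  have k1 := key ha hm hc h1
  have k2 := key hm hb hc' h2
  have k3 : (√a - √b) ^ 2 ≤ 2 * (c + c') := by
    nlinarith [sq_nonneg ((√a - √m) - (√m - √b))]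
  have k4 : (√a + √b) ^ 2 ≤ 2 * (a + b) := by
    nlinarith [sq_nonneg (√a - √b), Real.sq_sqrt ha, Real.sq_sqrt hb]
  have e1 : (a - b) ^ 2 = (√a - √b) ^ 2 * (√a + √b) ^ 2 := by
    rw [← mul_pow]; congr 1; nlinarith [Real.sq_sqrt ha, Real.sq_sqrt hb]
  rw [e1]
  calc _ ≤ 2 * (c + c') * (2 * (a + b)) := mul_le_mul k3 k4 (sq_nonneg _) (by positivity)
    _ = _ := by ring

/-- The dominating function for the squared increments of the deviation. The indicator serves the
neighbourhood of the origin. -/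
noncomputable def devWeight (f : ℝ → EuclideanSpace ℝ (Fin p) → ℝ)
    (x : ℝ × EuclideanSpace ℝ (Fin p)) : ℝ :=
  polarExt f x + radialMean f x.1 + (Ioo (0 : ℝ) 2).indicator (fun _ => 1) x.1

theorem devWeight_nonneg (hp : 2 ≤ p) (hd : IsPolarDensity f)
    (x : ℝ × EuclideanSpace ℝ (Fin p)) : 0 ≤ devWeight f x :=
  add_nonneg (add_nonneg (polarExt_nonneg hd x) (radialMean_nonneg hp hd _))
    (indicator_nonneg (fun _ _ => zero_le_one) _)

theorem measurable_devWeight (hf : DensityAssumption f) : Measurable (devWeight f) :=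
  ((measurable_polarExt hf).add ((measurable_radialMean hf).comp measurable_fst)).add
    ((measurable_const.indicator measurableSet_Ioo).comp measurable_fst)

theorem lintegral_devWeight (hp : 2 ≤ p) (hf : DensityAssumption f) (hd : IsPolarDensity f)
    {C : ℝ} (hC : DensityBounds f C) :
    ∫⁻ x, ENNReal.ofReal (devWeight f x) ∂(cylMeasure p)
      = ENNReal.ofReal (2 + 2 * unitSphereArea p) := by
  have hA := unitSphereArea_natCast_pos hp
  have hm := measurable_radialMean hf
  have hm2 := measurable_polarExt hf
  have h1 : ∀ x : ℝ × EuclideanSpace ℝ (Fin p), ENNReal.ofReal (devWeight f x)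
      = ENNReal.ofReal (polarExt f x) + ENNReal.ofReal (radialMean f x.1)
        + (Ioo (0 : ℝ) 2 ×ˢ univ).indicator (fun _ => 1) x := by
    intro x
    rw [devWeight, ENNReal.ofReal_add (add_nonneg (polarExt_nonneg hd x) (radialMean_nonneg hp hd _))
      (indicator_nonneg (fun _ _ => zero_le_one) _), ENNReal.ofReal_add (polarExt_nonneg hd x)
      (radialMean_nonneg hp hd _)]
    congr 1
    by_cases hx : x.1 ∈ Ioo (0 : ℝ) 2
    · rw [indicator_of_mem hx, indicator_of_mem
        (show x ∈ Ioo (0 : ℝ) 2 ×ˢ (univ : Set (EuclideanSpace ℝ (Fin p))) from ⟨hx, mem_univ _⟩),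
        ENNReal.ofReal_one]
    · rw [indicator_of_notMem hx, indicator_of_notMem
        (fun h : x ∈ Ioo (0 : ℝ) 2 ×ˢ (univ : Set (EuclideanSpace ℝ (Fin p))) => hx h.1),
        ENNReal.ofReal_zero]
  simp_rw [h1]
  rw [lintegral_add_left (by fun_prop), lintegral_add_left (by fun_prop), lintegral_polarExt hd,
    lintegral_radialMean hp hf hd hC, lintegral_indicator (measurableSet_Ioo.prod MeasurableSet.univ),
    setLIntegral_const, cylMeasure, Measure.prod_prod, surfaceMeasure_univ (by omega),
    Real.volume_Ioo, one_mul, ENNReal.ofReal_add (by norm_num) (by positivity),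
    ENNReal.ofReal_mul (by norm_num)]
  norm_num

/-- Away from the origin this combines the Lipschitz bounds for the square root of the density. For
`u < 2`, where the radial one is not available, the indicator allows the use of the Lipschitz bound
for the density itself. -/
theorem polarExt_sub_sq_le (hd : IsPolarDensity f) {C : ℝ}
    (hC : DensityBounds f C) {u u' : ℝ} (hu : 0 < u) (hu' : 0 < u') (huu : |u - u'| ≤ 1)
    {v v' : EuclideanSpace ℝ (Fin p)} (hv : ‖v‖ = 1) (hv' : ‖v'‖ = 1) :
    (polarExt f (u, v) - polarExt f (u', v')) ^ 2
      ≤ (4 * C + 2 * C ^ 2 + 4 * C ^ 2) * ((u - u') ^ 2 + ‖v - v'‖ ^ 2) *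
        (polarExt f (u, v) + polarExt f (u', v') + (Ioo (0 : ℝ) 2).indicator (fun _ => 1) u) := by
  have hC0 := hC.pos
  rw [polarExt_apply hu hv, polarExt_apply hu' hv']
  have a1 := hd.nonneg u hu v hv
  have a2 := hd.nonneg u' hu' v' hv'
  have a3 := hd.nonneg u' hu' v hv
  have hi : (0 : ℝ) ≤ (Ioo (0 : ℝ) 2).indicator (fun _ => 1) u :=
    indicator_nonneg (fun _ _ => zero_le_one) _
  have hang := hC.angular u' hu' v v' hv hv'
  set D := (u - u') ^ 2 + ‖v - v'‖ ^ 2 with hD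
  have hD0 : 0 ≤ D := by positivity
  by_cases h1 : 1 ≤ u ∧ 1 ≤ u'
  · have hrad := hC.radial u h1.1 u' h1.2 v hv
    have := sq_sub_le_of_sqrt_lip a1 a2 a3 (by positivity) (by positivity) hrad hang
    calc _ ≤ _ := this
      _ = 4 * C * D * (f u v + f u' v') := by rw [hD]; ring
      _ ≤ _ := by
        refine mul_le_mul (mul_le_mul_of_nonneg_right (by nlinarith) hD0) (by linarith)
          (by linarith) (by positivity)
  · have hu2 : u ∈ Ioo (0 : ℝ) 2 := by
      rw [abs_le] at huu
      refine ⟨hu, ?_⟩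
      by_contra! h2
      exact h1 ⟨by linarith, by linarith [huu.2]⟩
    rw [indicator_of_mem hu2]
    have hlip := hC.lip u hu u' hu' v hv
    have b1 : (f u v - f u' v) ^ 2 ≤ C ^ 2 * (u - u') ^ 2 := by
      rw [← sq_abs, ← sq_abs (u - u'), ← mul_pow]
      exact pow_le_pow_left₀ (abs_nonneg _) hlip 2
    have b2 : (f u' v - f u' v') ^ 2 ≤ C * ‖v - v'‖ ^ 2 * (2 * C) :=
      hang.trans (mul_le_mul_of_nonneg_left
        (by linarith [hC.le u' hu' v hv, hC.le u' hu' v' hv']) (by positivity))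
    have b3 : (f u v - f u' v') ^ 2 ≤ 2 * (f u v - f u' v) ^ 2 + 2 * (f u' v - f u' v') ^ 2 := by
      nlinarith [sq_nonneg ((f u v - f u' v) - (f u' v - f u' v'))]
    calc (f u v - f u' v') ^ 2 ≤ (2 * C ^ 2 + 4 * C ^ 2) * D * 1 := by
          rw [hD]
          nlinarith [mul_nonneg (sq_nonneg C) (sq_nonneg (u - u')),
            mul_nonneg (sq_nonneg C) (sq_nonneg ‖v - v'‖)]
      _ ≤ _ := by
        refine mul_le_mul (mul_le_mul_of_nonneg_right (by linarith) hD0) (by linarith)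
          zero_le_one (by positivity)

/-- The bound for the density passes to its spherical mean by Jensen's inequality. -/
theorem radialMean_sub_sq_le (hp : 2 ≤ p) (hf : DensityAssumption f) (hd : IsPolarDensity f) {C : ℝ}
    (hC : DensityBounds f C) {u u' : ℝ} (hu : 0 < u) (hu' : 0 < u') (huu : |u - u'| ≤ 1) :
    (radialMean f u - radialMean f u') ^ 2
      ≤ (4 * C + 2 * C ^ 2 + 4 * C ^ 2) * (u - u') ^ 2 *
        (radialMean f u + radialMean f u' + (Ioo (0 : ℝ) 2).indicator (fun _ => 1) u) := by
  have hA := unitSphereArea_natCast_pos hp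
  set K := 4 * C + 2 * C ^ 2 + 4 * C ^ 2
  set ι : ℝ := (Ioo (0 : ℝ) 2).indicator (fun _ => 1) u
  have i1 := integrable_polarExt_section hf hd hC u
  have i2 := integrable_polarExt_section hf hd hC u'
  set A := unitSphereArea p
  set ρ : Measure (EuclideanSpace ℝ (Fin p)) := ENNReal.ofReal A⁻¹ • surfaceMeasure p with hρ
  have hρp : IsProbabilityMeasure ρ := ⟨by
    rw [hρ, Measure.smul_apply, surfaceMeasure_univ (by omega), smul_eq_mul,
      ← ENNReal.ofReal_mul (by positivity), inv_mul_cancel₀ hA.ne', ENNReal.ofReal_one]⟩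
  have hρi : ∀ φ : EuclideanSpace ℝ (Fin p) → ℝ, ∫ v, φ v ∂ρ
      = A⁻¹ * ∫ v, φ v ∂(surfaceMeasure p) := by
    intro φ
    rw [hρ, integral_smul_measure, ENNReal.toReal_ofReal (by positivity), smul_eq_mul]
  have j1 : Integrable (fun v => polarExt f (u, v)) ρ := i1.smul_measure ENNReal.ofReal_ne_top
  have j2 : Integrable (fun v => polarExt f (u', v)) ρ := i2.smul_measure ENNReal.ofReal_ne_top
  have hb : ∀ v, |polarExt f (u, v) - polarExt f (u', v)| ≤ C := by
    intro v
    have h1 := polarExt_nonneg hd (u, v)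
    have h2 := polarExt_le hC (u, v)
    have h3 := polarExt_nonneg hd (u', v)
    have h4 := polarExt_le hC (u', v)
    rw [abs_le]; constructor <;> linarith
  have hmem : MemLp (fun v => polarExt f (u, v) - polarExt f (u', v)) 2 ρ :=
    MemLp.of_bound (j1.sub j2).aestronglyMeasurable C (Eventually.of_forall hb)
  have h1 := sq_integral_le_integral_sq hmem
  rw [integral_sub j1 j2, hρi, hρi] at h1
  refine h1.trans ?_
  have hae : ∀ᵐ v ∂ρ, ‖v‖ = 1 := Measure.ae_smul_measure ae_surfaceMeasure_norm _
  have j3 : Integrable (fun v => polarExt f (u, v) + polarExt f (u', v) + ι) ρ :=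
    (j1.add j2).add (integrable_const _)
  have h2 : ∫ v, (polarExt f (u, v) - polarExt f (u', v)) ^ 2 ∂ρ
      ≤ ∫ v, K * (u - u') ^ 2 * (polarExt f (u, v) + polarExt f (u', v) + ι) ∂ρ := by
    refine integral_mono_ae hmem.integrable_sq (j3.const_mul _) ?_
    filter_upwards [hae] with v hv
    have := polarExt_sub_sq_le hd hC hu hu' huu hv hv
    rwa [sub_self, norm_zero, zero_pow two_ne_zero, add_zero] at this
  refine h2.trans (le_of_eq ?_)
  have j4 : Integrable (fun v => polarExt f (u, v) + polarExt f (u', v)) ρ := j1.add j2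
  rw [integral_const_mul, integral_add j4 (integrable_const _), integral_add j1 j2, hρi, hρi]
  simp [radialMean, A]

/-- The common limit at the origin cancels in the deviation, which therefore vanishes there at a
linear rate. -/
theorem abs_devPart_le_mul (hp : 2 ≤ p) (hf : DensityAssumption f) (hd : IsPolarDensity f) {C : ℝ}
    (hC : DensityBounds f C) {u : ℝ} (hu : 0 < u) {v : EuclideanSpace ℝ (Fin p)} (hv : ‖v‖ = 1) :
    |devPart f (u, v)| ≤ 2 * C * u := by
  have hA := unitSphereArea_natCast_pos hp
  obtain ⟨b, hb⟩ := hf.origin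
  -- the common limit at the origin is approached at a linear rate in every direction
  have h1 : ∀ w, ‖w‖ = 1 → |polarExt f (u, w) - b| ≤ C * u := by
    intro w hw
    rw [polarExt_apply hu hw]
    have hlim : Tendsto (fun r => |f u w - f r w|) (𝓝[>] 0) (𝓝 |f u w - b|) :=
      ((hb w hw).const_sub _).abs
    refine le_of_tendsto hlim ?_
    filter_upwards [self_mem_nhdsWithin, Ioo_mem_nhdsGT hu] with r hr hru
    have := hC.lip u hu r hr w hw
    rw [abs_of_pos (by linarith [hru.2] : 0 < u - r)] at this
    nlinarith [hC.pos, hru.1]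
  have h2 : |radialMean f u - b| ≤ C * u := by
    have hi := integrable_polarExt_section hf hd hC u
    have e : radialMean f u - b
        = (unitSphereArea p)⁻¹ * ∫ w, (polarExt f (u, w) - b) ∂(surfaceMeasure p) := by
      rw [integral_sub hi (integrable_const _), integral_const,
        surfaceMeasure_real_univ (by omega), smul_eq_mul, radialMean]
      field_simp
    have h3 := norm_integral_le_of_norm_le_const (μ := surfaceMeasure p) (C := C * u)
      (f := fun w => polarExt f (u, w) - b) (by
        filter_upwards [ae_surfaceMeasure_norm] with w hw using h1 w hw)
    rw [surfaceMeasure_real_univ (by omega), Real.norm_eq_abs] at h3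
    rw [e, abs_mul, abs_of_pos (by positivity), inv_mul_le_iff₀ hA]
    linarith
  have h3 := h1 v hv
  rw [devPart]
  have e : polarExt f (u, v) - radialMean f u = (polarExt f (u, v) - b) - (radialMean f u - b) := by
    ring
  have := abs_sub (polarExt f (u, v) - b) (radialMean f u - b)
  rw [← e] at this
  simp only
  linarith

/-- Squared increments of the deviation are dominated by the squared distance with an integrable
weight. At the origin this needs the common limit of the density. -/
theorem exists_devPart_sub_sq_le (hp : 2 ≤ p) (hf : DensityAssumption f) (hd : IsPolarDensity f) :
    ∃ K > 0, ∀ u u' : ℝ, |u - u'| ≤ 1 → ∀ v v' : EuclideanSpace ℝ (Fin p), ‖v‖ = 1 → ‖v'‖ = 1 →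
      (devPart f (u, v) - devPart f (u', v')) ^ 2
        ≤ K * ((u - u') ^ 2 + ‖v - v'‖ ^ 2) * (devWeight f (u, v) + devWeight f (u', v')) := by
  obtain ⟨C, hC⟩ := exists_densityBounds hp hf hd
  have hC0 := hC.pos
  set K := 4 * C + 2 * C ^ 2 + 4 * C ^ 2 with hK
  have hK0 : 0 < K := by positivity
  refine ⟨4 * K, by positivity, fun u u' huu v v' hv hv' => ?_⟩
  have hw1 := devWeight_nonneg hp hd (u, v)
  have hw2 := devWeight_nonneg hp hd (u', v')
  set D := (u - u') ^ 2 + ‖v - v'‖ ^ 2 with hD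
  have hD0 : 0 ≤ D := by positivity
  -- increments across the origin, where the deviation vanishes on the other side
  have hone : ∀ (a b : ℝ) (w w' : EuclideanSpace ℝ (Fin p)), 0 < a → b ≤ 0 → |a - b| ≤ 1 →
      ‖w‖ = 1 → (devPart f (a, w) - devPart f (b, w')) ^ 2 ≤ 4 * K * (a - b) ^ 2 *
        devWeight f (a, w) := by
    intro a b w w' ha hb hab hw
    rw [devPart_of_nonpos hb, sub_zero]
    have h1 := abs_devPart_le_mul hp hf hd hC ha hw
    have h2 : a ∈ Ioo (0 : ℝ) 2 := ⟨ha, by linarith [le_abs_self (a - b)]⟩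
    have h3 : 1 ≤ devWeight f (a, w) := by
      rw [devWeight, indicator_of_mem h2]
      linarith [polarExt_nonneg hd (a, w), radialMean_nonneg hp hd a]
    have h4 : devPart f (a, w) ^ 2 ≤ (2 * C * (a - b)) ^ 2 := by
      rw [← sq_abs]
      exact pow_le_pow_left₀ (abs_nonneg _) (h1.trans (by nlinarith)) 2
    have h5 : (2 * C * (a - b)) ^ 2 ≤ 4 * K * (a - b) ^ 2 * 1 := by
      rw [hK]; nlinarith [mul_nonneg hC0.le (sq_nonneg (a - b)),
        mul_nonneg (sq_nonneg C) (sq_nonneg (a - b))]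
    exact h4.trans (h5.trans (mul_le_mul_of_nonneg_left h3 (by positivity)))
  have hDu : (u - u') ^ 2 ≤ D := by rw [hD]; linarith [sq_nonneg ‖v - v'‖]
  rcases le_or_gt u 0 with hu | hu <;> rcases le_or_gt u' 0 with hu' | hu'
  · rw [devPart_of_nonpos hu, devPart_of_nonpos hu']
    have : 0 ≤ 4 * K * D * (devWeight f (u, v) + devWeight f (u', v')) := by positivity
    simpa using this
  · have h1 := hone u' u v' v hu' hu (by rwa [abs_sub_comm]) hv'
    have e : (devPart f (u, v) - devPart f (u', v')) ^ 2
      = (devPart f (u', v') - devPart f (u, v)) ^ 2 := by ring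
    rw [e]
    refine h1.trans (mul_le_mul (mul_le_mul_of_nonneg_left ?_ (by positivity)) (by linarith) hw2
      (by positivity))
    rw [← neg_sub, neg_sq]; exact hDu
  · have h1 := hone u u' v v' hu hu' huu hv
    exact h1.trans (mul_le_mul (mul_le_mul_of_nonneg_left hDu (by positivity)) (by linarith) hw1
      (by positivity))
  · have h1 := polarExt_sub_sq_le hd hC hu hu' huu hv hv'
    have h2 := radialMean_sub_sq_le hp hf hd hC hu hu' huu
    rw [← hK] at h1 h2
    have hi : (0 : ℝ) ≤ (Ioo (0 : ℝ) 2).indicator (fun _ => 1) u :=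
      indicator_nonneg (fun _ _ => zero_le_one) _
    have hi' : (0 : ℝ) ≤ (Ioo (0 : ℝ) 2).indicator (fun _ => 1) u' :=
      indicator_nonneg (fun _ _ => zero_le_one) _
    have g1 := radialMean_nonneg hp hd u
    have g2 := radialMean_nonneg hp hd u'
    have p1 := polarExt_nonneg hd (u, v)
    have p2 := polarExt_nonneg hd (u', v')
    simp only [devPart, devWeight]
    set a := polarExt f (u, v)
    set a' := polarExt f (u', v')
    set g := radialMean f u
    set g' := radialMean f u'
    set ι : ℝ := (Ioo (0 : ℝ) 2).indicator (fun _ => 1) u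
    set ι' : ℝ := (Ioo (0 : ℝ) 2).indicator (fun _ => 1) u'
    have h3 : (g - g') ^ 2 ≤ K * D * (g + g' + ι) := h2.trans
      (mul_le_mul_of_nonneg_right (mul_le_mul_of_nonneg_left hDu hK0.le) (by positivity))
    have h4 : (a - g - (a' - g')) ^ 2 ≤ 2 * (a - a') ^ 2 + 2 * (g - g') ^ 2 := by
      nlinarith [sq_nonneg ((a - a') + (g - g'))]
    have h5 : 0 ≤ K * D := by positivity
    nlinarith [mul_nonneg h5 p1, mul_nonneg h5 p2, mul_nonneg h5 g1, mul_nonneg h5 g2,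
      mul_nonneg h5 hi']

end Ambient

/-! ### Reversible kernels -/

section Markov
variable {S : Type*} [MeasurableSpace S] {μ : Measure S} [SigmaFinite μ]

/-- The kernel `Q` is the density of a reversible Markov operator with invariant measure `μ`. -/
structure IsReversibleKernel (μ : Measure S) (Q : S × S → ℝ) : Prop where
  measurable : Measurable Q
  nonneg : ∀ z, 0 ≤ Q z
  symm : ∀ x y, Q (x, y) = Q (y, x)
  lintegral_eq_one : ∀ᵐ x ∂μ, ∫⁻ y, ENNReal.ofReal (Q (x, y)) ∂μ = 1

/-- The Dirichlet form `∬ Q(x, y) (d(x) - d(y))²` of a reversible kernel. -/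
noncomputable def dirichletForm (μ : Measure S) (Q : S × S → ℝ) (d : S → ℝ) : ℝ :=
  ∫ z, Q z * (d z.1 - d z.2) ^ 2 ∂(μ.prod μ)

/-- The action `x ↦ ∫ Q(x, y) d(y) μ(dy)` of a kernel on functions. -/
noncomputable def kernelAction (μ : Measure S) (Q : S × S → ℝ) (d : S → ℝ) (x : S) : ℝ :=
  ∫ y, Q (x, y) * d y ∂μ

namespace IsReversibleKernel
variable {Q : S × S → ℝ} (hQ : IsReversibleKernel μ Q) {d : S → ℝ}
include hQ

theorem lintegral_mul_fst {φ : S → ENNReal} (hφ : Measurable φ) :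
    ∫⁻ z, ENNReal.ofReal (Q z) * φ z.1 ∂(μ.prod μ) = ∫⁻ x, φ x ∂μ := by
  have hm := hQ.measurable
  rw [lintegral_prod _ (by fun_prop)]
  refine lintegral_congr_ae ?_
  filter_upwards [hQ.lintegral_eq_one] with x hx
  rw [lintegral_mul_const _ (by fun_prop), hx, one_mul]

theorem integrable_mul_fst (hd : Measurable d) (hi : Integrable d μ) :
    Integrable (fun z : S × S => Q z * d z.1) (μ.prod μ) := by
  refine ⟨(hQ.measurable.mul (hd.comp measurable_fst)).aestronglyMeasurable, ?_⟩
  rw [hasFiniteIntegral_iff_enorm]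
  have h1 : ∀ z : S × S, ‖Q z * d z.1‖ₑ = ENNReal.ofReal (Q z) * ‖d z.1‖ₑ := fun z => by
    rw [enorm_mul, Real.enorm_of_nonneg (hQ.nonneg z)]
  simp_rw [h1]
  rw [hQ.lintegral_mul_fst (φ := fun x => ‖d x‖ₑ) hd.enorm]
  exact hi.2

theorem integrable_mul_snd (hd : Measurable d) (hi : Integrable d μ) :
    Integrable (fun z : S × S => Q z * d z.2) (μ.prod μ) := by
  have := (hQ.integrable_mul_fst hd hi).swap
  refine this.congr (Eventually.of_forall fun z => ?_)
  change Q (z.2, z.1) * d z.2 = Q (z.1, z.2) * d z.2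
  rw [hQ.symm]

theorem integrable_mul_sub_sq (hd : Measurable d) (hi : Integrable d μ) {C : ℝ}
    (hC : ∀ x, |d x| ≤ C) :
    Integrable (fun z : S × S => Q z * (d z.1 - d z.2) ^ 2) (μ.prod μ) := by
  have hm := hQ.measurable
  have h1 := ((hQ.integrable_mul_fst hd.abs hi.abs).add
    (hQ.integrable_mul_snd hd.abs hi.abs)).const_mul (2 * C)
  refine h1.mono' (by fun_prop) (Eventually.of_forall fun z => ?_)
  have hq := hQ.nonneg z
  rw [Real.norm_of_nonneg (by positivity)]
  have h2 : (d z.1 - d z.2) ^ 2 ≤ 2 * C * (|d z.1| + |d z.2|) := by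
    rw [← sq_abs, sq]
    have h3 := abs_sub (d z.1) (d z.2)
    have h4 := hC z.1
    have h5 := hC z.2
    exact mul_le_mul (h3.trans (by linarith)) h3 (abs_nonneg _)
      (by linarith [abs_nonneg (d z.1)])
  calc _ ≤ Q z * (2 * C * (|d z.1| + |d z.2|)) := mul_le_mul_of_nonneg_left h2 hq
    _ = _ := by simp only [Pi.add_apply]; ring

omit [SigmaFinite μ] in
theorem ae_integrable : ∀ᵐ x ∂μ, Integrable (fun y => Q (x, y)) μ ∧ ∫ y, Q (x, y) ∂μ = 1 := by
  have hm := hQ.measurable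
  filter_upwards [hQ.lintegral_eq_one] with x hx
  have h1 : Integrable (fun y => Q (x, y)) μ := by
    refine ⟨(hm.comp measurable_prodMk_left).aestronglyMeasurable, ?_⟩
    rw [hasFiniteIntegral_iff_ofReal (Eventually.of_forall fun y => hQ.nonneg _), hx]
    exact ENNReal.one_lt_top
  refine ⟨h1, ?_⟩
  rw [integral_eq_lintegral_of_nonneg_ae (Eventually.of_forall fun y => hQ.nonneg _)
    h1.aestronglyMeasurable, hx, ENNReal.toReal_one]

theorem measurable_kernelAction (hd : Measurable d) : Measurable (kernelAction μ Q d) := by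
  have h : Measurable fun z : S × S => Q z * d z.2 := hQ.measurable.mul (hd.comp measurable_snd)
  exact h.stronglyMeasurable.integral_prod_right'.measurable

theorem abs_kernelAction_le {C : ℝ} (hC : ∀ x, |d x| ≤ C) :
    ∀ᵐ x ∂μ, |kernelAction μ Q d x| ≤ C := by
  filter_upwards [hQ.ae_integrable] with x ⟨hi, h1⟩
  refine (norm_integral_le_of_norm_le (f := fun y => Q (x, y) * d y) (hi.mul_const C)
    (Eventually.of_forall fun y => ?_)).trans ?_
  · rw [norm_mul, Real.norm_of_nonneg (hQ.nonneg _)]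
    exact mul_le_mul_of_nonneg_left (hC y) (hQ.nonneg _)
  · rw [integral_mul_const, h1, one_mul]

/-- The Markov operator of a reversible kernel is symmetric. -/
theorem integral_mul_kernelAction_comm {g : S → ℝ} (hg : Measurable g) (hgi : Integrable g μ)
    (hd : Measurable d) {C : ℝ} (hC : ∀ x, |d x| ≤ C) :
    ∫ x, g x * kernelAction μ Q d x ∂μ = ∫ x, d x * kernelAction μ Q g x ∂μ := by
  have i1 : Integrable (fun z : S × S => Q z * g z.1 * d z.2) (μ.prod μ) :=
    (hQ.integrable_mul_fst hg hgi).mul_bdd (c := C) (hd.comp measurable_snd).aestronglyMeasurable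
      (Eventually.of_forall fun z => hC z.2)
  have i2 : Integrable (fun z : S × S => Q z * g z.2 * d z.1) (μ.prod μ) :=
    (hQ.integrable_mul_snd hg hgi).mul_bdd (c := C) (hd.comp measurable_fst).aestronglyMeasurable
      (Eventually.of_forall fun z => hC z.1)
  have e1 : ∫ x, g x * kernelAction μ Q d x ∂μ = ∫ z, Q z * g z.1 * d z.2 ∂(μ.prod μ) := by
    rw [integral_prod _ i1]
    refine integral_congr_ae (Eventually.of_forall fun x => ?_)
    simp only [kernelAction]
    rw [← integral_const_mul]
    exact integral_congr_ae (Eventually.of_forall fun y => by simp only; ring)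
  have e2 : ∫ x, d x * kernelAction μ Q g x ∂μ = ∫ z, Q z * g z.2 * d z.1 ∂(μ.prod μ) := by
    rw [integral_prod _ i2]
    refine integral_congr_ae (Eventually.of_forall fun x => ?_)
    simp only [kernelAction]
    rw [← integral_const_mul]
    exact integral_congr_ae (Eventually.of_forall fun y => by simp only; ring)
  rw [e1, e2, ← integral_prod_swap]
  refine integral_congr_ae (Eventually.of_forall fun z => ?_)
  simp only [Prod.fst_swap, Prod.snd_swap]
  rw [show z.swap = (z.2, z.1) from rfl, hQ.symm z.2 z.1]

theorem kernelAction_sub (hd : Measurable d) {C : ℝ} (hC : ∀ x, |d x| ≤ C) :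
    ∀ᵐ x ∂μ, kernelAction μ Q d x - d x = ∫ y, Q (x, y) * (d y - d x) ∂μ := by
  filter_upwards [hQ.ae_integrable] with x ⟨hi, h1⟩
  simp_rw [mul_sub]
  rw [integral_sub (hi.mul_bdd hd.aestronglyMeasurable (Eventually.of_forall hC)) (hi.mul_const _), integral_mul_const, h1,
    one_mul, kernelAction]

/-- Jensen's inequality for the Markov operator. -/
theorem kernelAction_sub_sq_le (hd : Measurable d) {C : ℝ} (hC : ∀ x, |d x| ≤ C) :
    ∀ᵐ x ∂μ, (kernelAction μ Q d x - d x) ^ 2 ≤ ∫ y, Q (x, y) * (d x - d y) ^ 2 ∂μ := by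
  filter_upwards [hQ.ae_integrable] with x ⟨hi, h1⟩
  have i1 := hi.mul_bdd hd.aestronglyMeasurable (Eventually.of_forall hC)
  have i2 : Integrable (fun y => Q (x, y) * d y ^ 2) μ :=
    hi.mul_bdd (c := C ^ 2) (hd.pow_const 2).aestronglyMeasurable (Eventually.of_forall fun y => by
      rw [norm_pow]; exact pow_le_pow_left₀ (norm_nonneg _) (hC y) 2)
  have expand : ∀ m : ℝ, ∫ y, Q (x, y) * (m - d y) ^ 2 ∂μ
      = (∫ y, Q (x, y) * d y ^ 2 ∂μ) - 2 * m * kernelAction μ Q d x + m ^ 2 := by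
    intro m
    have e : ∀ y, Q (x, y) * (m - d y) ^ 2
        = (Q (x, y) * d y ^ 2 - 2 * m * (Q (x, y) * d y)) + Q (x, y) * m ^ 2 := fun y => by ring
    simp_rw [e]
    have i3 : Integrable (fun y => Q (x, y) * d y ^ 2 - 2 * m * (Q (x, y) * d y)) μ :=
      i2.sub (i1.const_mul _)
    rw [integral_add i3 (hi.mul_const _), integral_sub i2 (i1.const_mul _), integral_const_mul,
      integral_mul_const, h1, one_mul, kernelAction]
  have h2 : 0 ≤ ∫ y, Q (x, y) * (kernelAction μ Q d x - d y) ^ 2 ∂μ :=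
    integral_nonneg fun y => mul_nonneg (hQ.nonneg _) (sq_nonneg _)
  rw [expand] at h2 ⊢
  nlinarith

theorem integral_mul_kernelAction_sub_sq_le (hd : Measurable d) (hi : Integrable d μ) {C : ℝ}
    (hC : ∀ x, |d x| ≤ C) {w : S → ℝ} (hw : ∀ x, 0 ≤ w x) {B : ℝ} (hB : ∀ x, w x ≤ B) :
    ∫ x, w x * (kernelAction μ Q d x - d x) ^ 2 ∂μ ≤ B * dirichletForm μ Q d := by
  have h1 := hQ.integrable_mul_sub_sq hd hi hC
  rw [dirichletForm, integral_prod _ h1, ← integral_const_mul]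
  refine integral_mono_of_nonneg (Eventually.of_forall fun x => mul_nonneg (hw x) (sq_nonneg _))
    (h1.integral_prod_left.const_mul _) ?_
  filter_upwards [hQ.kernelAction_sub_sq_le hd hC] with x hx
  exact mul_le_mul (hB x) hx (sq_nonneg _) ((hw x).trans (hB x))

/-- By reversibility, `⟨d, Qd - d⟩` is minus one half of the Dirichlet form. -/
theorem integral_mul_kernelAction_sub (hd : Measurable d) (hi : Integrable d μ) {C : ℝ}
    (hC : ∀ x, |d x| ≤ C) :
    ∫ x, d x * (kernelAction μ Q d x - d x) ∂μ = -(dirichletForm μ Q d / 2) := by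
  have hm := hQ.measurable
  have i1 : Integrable (fun z : S × S => Q z * d z.1 * (d z.2 - d z.1)) (μ.prod μ) :=
    (hQ.integrable_mul_fst hd hi).mul_bdd (c := 2 * C) (by fun_prop) (Eventually.of_forall fun z =>
      (abs_sub _ _).trans (by linarith [hC z.1, hC z.2]))
  have i2 : Integrable (fun z : S × S => Q z * d z.2 * (d z.1 - d z.2)) (μ.prod μ) :=
    (hQ.integrable_mul_snd hd hi).mul_bdd (c := 2 * C) (by fun_prop) (Eventually.of_forall fun z =>
      (abs_sub _ _).trans (by linarith [hC z.1, hC z.2]))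
  have e1 : ∫ x, d x * (kernelAction μ Q d x - d x) ∂μ
      = ∫ z, Q z * d z.1 * (d z.2 - d z.1) ∂(μ.prod μ) := by
    rw [integral_prod _ i1]
    refine integral_congr_ae ?_
    filter_upwards [hQ.kernelAction_sub hd hC] with x hx
    rw [hx, ← integral_const_mul]
    exact integral_congr_ae (Eventually.of_forall fun y => by simp only; ring)
  have e2 : ∫ z, Q z * d z.1 * (d z.2 - d z.1) ∂(μ.prod μ)
      = ∫ z, Q z * d z.2 * (d z.1 - d z.2) ∂(μ.prod μ) := by
    rw [← integral_prod_swap]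
    refine integral_congr_ae (Eventually.of_forall fun z => ?_)
    simp only [Prod.fst_swap, Prod.snd_swap]
    rw [show z.swap = (z.2, z.1) from rfl, hQ.symm z.2 z.1]
  have e3 : (∫ z, Q z * d z.1 * (d z.2 - d z.1) ∂(μ.prod μ))
      + ∫ z, Q z * d z.2 * (d z.1 - d z.2) ∂(μ.prod μ) = - dirichletForm μ Q d := by
    rw [← integral_add i1 i2, dirichletForm, ← integral_neg]
    exact integral_congr_ae (Eventually.of_forall fun z => by simp only; ring)
  linarith

end IsReversibleKernel
end Markov

/-! ### The smoothing kernels -/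

section RadialKernel
variable {K : ℝ → ℝ} {h : ℝ}

/-- The rescaled radial smoothing kernel `h⁻¹ K((u - u') / h)`. -/
noncomputable def radialKernel (K : ℝ → ℝ) (h u u' : ℝ) : ℝ := h⁻¹ * K ((u - u') / h)

theorem radialKernel_nonneg (hK : KernelAssumption K) (hh : 0 < h) (u u' : ℝ) :
    0 ≤ radialKernel K h u u' := mul_nonneg (inv_nonneg.2 hh.le) (hK.nonneg _)

theorem radialKernel_symm (hK : KernelAssumption K) (h u u' : ℝ) :
    radialKernel K h u u' = radialKernel K h u' u := by
  rw [radialKernel, radialKernel, ← hK.symm, ← neg_div, neg_sub]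

theorem measurable_radialKernel (hK : KernelAssumption K) (h : ℝ) :
    Measurable fun z : ℝ × ℝ => radialKernel K h z.1 z.2 :=
  (hK.measurable.comp ((measurable_fst.sub measurable_snd).div_const h)).const_mul _

theorem radialKernel_eq_zero (hK : KernelAssumption K) (hh : 0 < h) {u u' : ℝ}
    (huu : h ≤ |u - u'|) : radialKernel K h u u' = 0 := by
  rw [radialKernel, hK.support, mul_zero]
  rintro ⟨h1, h2⟩
  have : |(u - u') / h| < 1 := abs_lt.2 ⟨h1, h2⟩
  rw [abs_div, abs_of_pos hh, div_lt_one hh] at this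
  exact absurd huu (not_le.2 this)

theorem integrable_comp_sub_div {φ : ℝ → ℝ} (hφ : Integrable φ) (hh : 0 < h) (u : ℝ) :
    Integrable fun u' => φ ((u - u') / h) :=
  (hφ.comp_div hh.ne').comp_sub_left u

theorem integral_comp_sub_div (φ : ℝ → ℝ) (hh : 0 < h) (u : ℝ) :
    ∫ u', φ ((u - u') / h) = h * ∫ x, φ x := by
  rw [integral_sub_left_eq_self (fun x => φ (x / h)) volume u, Measure.integral_comp_div,
    abs_of_pos hh, smul_eq_mul]

theorem integrable_radialKernel (hK : KernelAssumption K) (hh : 0 < h) (u : ℝ) :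
    Integrable (radialKernel K h u) := (integrable_comp_sub_div hK.integrable hh u).const_mul _

theorem lintegral_radialKernel (hK : KernelAssumption K) (hh : 0 < h) (u : ℝ) :
    ∫⁻ u', ENNReal.ofReal (radialKernel K h u u') = 1 := by
  rw [← ofReal_integral_eq_lintegral_ofReal (integrable_radialKernel hK hh u)
    (Eventually.of_forall fun u' => radialKernel_nonneg hK hh u u')]
  simp only [radialKernel]
  rw [integral_const_mul, integral_comp_sub_div K hh, hK.integral_eq_one, mul_one,
    inv_mul_cancel₀ hh.ne', ENNReal.ofReal_one]

/-- On the support, `K² ≤ 1 + K⁴`. -/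
theorem integrable_kernel_sq (hK : KernelAssumption K) : Integrable fun x => K x ^ 2 := by
  have h1 : Integrable ((Ioo (-1 : ℝ) 1).indicator fun _ => (1 : ℝ)) :=
    (integrable_indicator_iff measurableSet_Ioo).2
      (integrableOn_const (by rw [Real.volume_Ioo]; exact ENNReal.ofReal_ne_top))
  refine (h1.add hK.integrable_pow_four).mono' (hK.measurable.pow_const 2).aestronglyMeasurable
    (Eventually.of_forall fun x => ?_)
  rw [Real.norm_of_nonneg (sq_nonneg _), Pi.add_apply]
  by_cases hx : x ∈ Ioo (-1 : ℝ) 1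
  · rw [indicator_of_mem hx]; nlinarith [sq_nonneg (K x ^ 2 - 1), sq_nonneg (K x)]
  · rw [hK.support x hx]; simp [indicator_of_notMem hx]

theorem lintegral_radialKernel_sq (hK : KernelAssumption K) (hh : 0 < h) (u : ℝ) :
    ∫⁻ u', ENNReal.ofReal (radialKernel K h u u' ^ 2) = ENNReal.ofReal ((∫ x, K x ^ 2) / h) := by
  have h1 : Integrable fun u' => radialKernel K h u u' ^ 2 := by
    simp only [radialKernel, mul_pow]
    exact (integrable_comp_sub_div (integrable_kernel_sq hK) hh u).const_mul _
  rw [← ofReal_integral_eq_lintegral_ofReal h1 (Eventually.of_forall fun u' => sq_nonneg _)]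
  simp only [radialKernel, mul_pow]
  rw [integral_const_mul, integral_comp_sub_div (fun x => K x ^ 2) hh]
  congr 1
  field_simp

end RadialKernel

section SmoothKernel
variable {p : ℕ} {K : ℝ → ℝ} {h κ : ℝ} {f : ℝ → EuclideanSpace ℝ (Fin p) → ℝ}

/-- The product of the radial and the directional smoothing kernels. -/
noncomputable def smoothKernel (p : ℕ) (K : ℝ → ℝ) (h κ : ℝ)
    (z : (ℝ × EuclideanSpace ℝ (Fin p)) × (ℝ × EuclideanSpace ℝ (Fin p))) : ℝ :=
  radialKernel K h z.1.1 z.2.1 * langevinKernel p κ z.1.2 z.2.2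

/-- The smoothing kernel with the uniform density on the sphere subtracted in the direction: the
kernel of the `U`-statistic that estimates the deviation from sphericity. -/
noncomputable def deviationKernel (p : ℕ) (K : ℝ → ℝ) (h κ : ℝ)
    (z : (ℝ × EuclideanSpace ℝ (Fin p)) × (ℝ × EuclideanSpace ℝ (Fin p))) : ℝ :=
  radialKernel K h z.1.1 z.2.1 * (langevinKernel p κ z.1.2 z.2.2 - (unitSphereArea p)⁻¹)

theorem measurable_radialKernel_fst (hK : KernelAssumption K) (h : ℝ) :
    Measurable fun z : (ℝ × EuclideanSpace ℝ (Fin p)) × (ℝ × EuclideanSpace ℝ (Fin p)) =>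
      radialKernel K h z.1.1 z.2.1 :=
  (measurable_radialKernel hK h).comp
    ((measurable_fst.comp measurable_fst).prodMk (measurable_fst.comp measurable_snd))

theorem measurable_langevinKernel_snd (κ : ℝ) :
    Measurable fun z : (ℝ × EuclideanSpace ℝ (Fin p)) × (ℝ × EuclideanSpace ℝ (Fin p)) =>
      langevinKernel p κ z.1.2 z.2.2 := by
  have h1 : Measurable fun z : (ℝ × EuclideanSpace ℝ (Fin p)) × (ℝ × EuclideanSpace ℝ (Fin p)) =>
      (z.1.2, z.2.2) := by fun_prop
  have h2 := (measurable_langevinKernel p κ).comp h1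
  exact h2

theorem measurable_langevinKernel_left (κ : ℝ) (v : EuclideanSpace ℝ (Fin p)) :
    Measurable (langevinKernel p κ v) :=
  Measurable.of_uncurry_left (measurable_langevinKernel p κ)

theorem measurable_smoothKernel (hK : KernelAssumption K) (h κ : ℝ) :
    Measurable (smoothKernel p K h κ) :=
  (measurable_radialKernel_fst hK h).mul (measurable_langevinKernel_snd κ)

theorem measurable_deviationKernel (hK : KernelAssumption K) (h κ : ℝ) :
    Measurable (deviationKernel p K h κ) :=
  (measurable_radialKernel_fst hK h).mul ((measurable_langevinKernel_snd κ).sub_const _)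

theorem deviationKernel_symm (hK : KernelAssumption K) (h κ : ℝ)
    (x y : ℝ × EuclideanSpace ℝ (Fin p)) :
    deviationKernel p K h κ (x, y) = deviationKernel p K h κ (y, x) := by
  simp only [deviationKernel]
  rw [radialKernel_symm hK, langevinKernel_symm]

theorem lintegral_smoothKernel_mul (hK : KernelAssumption K) (hh : 0 < h)
    (u : ℝ) (v : EuclideanSpace ℝ (Fin p)) {φ : EuclideanSpace ℝ (Fin p) → ℝ} (hφ : Measurable φ) :
    ∫⁻ y, ENNReal.ofReal (smoothKernel p K h κ ((u, v), y) * φ y.2) ∂(cylMeasure p)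
      = ∫⁻ w, ENNReal.ofReal (langevinKernel p κ v w * φ w) ∂(surfaceMeasure p) := by
  have e : ∀ y : ℝ × EuclideanSpace ℝ (Fin p),
      ENNReal.ofReal (smoothKernel p K h κ ((u, v), y) * φ y.2)
      = ENNReal.ofReal (radialKernel K h u y.1) * ENNReal.ofReal (langevinKernel p κ v y.2 * φ y.2) :=
    fun y => by
      rw [smoothKernel, mul_assoc, ENNReal.ofReal_mul (radialKernel_nonneg hK hh _ _)]
  simp_rw [e]
  have m1 : Measurable (radialKernel K h u) :=
    (measurable_radialKernel hK h).comp measurable_prodMk_left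
  have m2 := measurable_langevinKernel_left κ v
  rw [cylMeasure, lintegral_prod_mul (f := fun a => ENNReal.ofReal (radialKernel K h u a))
    (g := fun w => ENNReal.ofReal (langevinKernel p κ v w * φ w)) (by fun_prop) (by fun_prop),
    lintegral_radialKernel hK hh, one_mul]

theorem isReversibleKernel_smoothKernel (hp : 2 ≤ p) (hK : KernelAssumption K) (hh : 0 < h)
    (hκ : 0 < κ) : IsReversibleKernel (cylMeasure p) (smoothKernel p K h κ) where
  measurable := measurable_smoothKernel hK h κ
  nonneg z := mul_nonneg (radialKernel_nonneg hK hh _ _) (langevinKernel_nonneg hp hκ _ _)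
  symm x y := by simp only [smoothKernel]; rw [radialKernel_symm hK, langevinKernel_symm]
  lintegral_eq_one := by
    filter_upwards [ae_cylMeasure_norm] with x hx
    have := lintegral_smoothKernel_mul (κ := κ) hK hh x.1 x.2 (φ := fun _ => 1) measurable_const
    simp only [mul_one] at this
    rw [show x = (x.1, x.2) from rfl, this, lintegral_langevinKernel hp hκ hx]

/-- The Dirichlet form of the deviation from sphericity is of the order of the squared
bandwidths. -/
theorem exists_dirichletForm_devPart_le (hp : 2 ≤ p) (hf : DensityAssumption f)
    (hd : IsPolarDensity f) (hK : KernelAssumption K) :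
    ∃ C > 0, ∀ᶠ κ in atTop, ∀ h > 0, h ≤ 1 →
      dirichletForm (cylMeasure p) (smoothKernel p K h κ) (devPart f) ≤ C * (h ^ 2 + 1 / κ) := by
  obtain ⟨B, hB0, hB⟩ := exists_devPart_sub_sq_le hp hf hd
  obtain ⟨c, hc0, hc⟩ := lintegral_langevinKernel_mul_dist_sq_le (p := p) hp
  obtain ⟨C', hC'⟩ := exists_densityBounds hp hf hd
  have hA := unitSphereArea_natCast_pos hp
  set W : ℝ := 2 + 2 * unitSphereArea p with hW
  have hW0 : 0 < W := by positivity
  refine ⟨2 * B * (1 + c) * W, by positivity, ?_⟩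
  filter_upwards [hc, eventually_gt_atTop 0] with κ hcκ hκ h hh hh1
  have hQ := isReversibleKernel_smoothKernel hp hK hh hκ
  have hmd := measurable_devPart hf
  have hmw := measurable_devWeight hf
  have hmQ := hQ.measurable
  set Q := smoothKernel p K h κ
  set μ := cylMeasure p
  -- on the support of the kernel the radial increment is at most `h`
  have key : ∀ᵐ z ∂(μ.prod μ), ENNReal.ofReal (Q z * (devPart f z.1 - devPart f z.2) ^ 2)
      ≤ ENNReal.ofReal B * (ENNReal.ofReal (Q z * (h ^ 2 + ‖z.1.2 - z.2.2‖ ^ 2))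
          * ENNReal.ofReal (devWeight f z.1)
        + ENNReal.ofReal (Q z * (h ^ 2 + ‖z.1.2 - z.2.2‖ ^ 2))
          * ENNReal.ofReal (devWeight f z.2)) := by
    have a1 : ∀ᵐ z ∂(μ.prod μ), ‖z.1.2‖ = 1 :=
      Measure.quasiMeasurePreserving_fst.ae ae_cylMeasure_norm
    have a2 : ∀ᵐ z ∂(μ.prod μ), ‖z.2.2‖ = 1 :=
      Measure.quasiMeasurePreserving_snd.ae ae_cylMeasure_norm
    filter_upwards [a1, a2] with z hz1 hz2
    have hq := hQ.nonneg z
    have w1 := devWeight_nonneg hp hd z.1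
    have w2 := devWeight_nonneg hp hd z.2
    rw [← ENNReal.ofReal_mul (by positivity), ← ENNReal.ofReal_mul (by positivity),
      ← ENNReal.ofReal_add (by positivity) (by positivity), ← ENNReal.ofReal_mul hB0.le]
    refine ENNReal.ofReal_le_ofReal ?_
    by_cases hu : h ≤ |z.1.1 - z.2.1|
    · have : Q z = 0 := by
        simp only [Q, smoothKernel]
        rw [radialKernel_eq_zero hK hh hu, zero_mul]
      simp [this]
    · have hu' := not_le.1 hu
      have h1 := hB z.1.1 z.2.1 (by linarith) z.1.2 z.2.2 hz1 hz2
      have h2 : (z.1.1 - z.2.1) ^ 2 ≤ h ^ 2 := by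
        rw [← sq_abs]; exact pow_le_pow_left₀ (abs_nonneg _) hu'.le 2
      have h3 : (devPart f z.1 - devPart f z.2) ^ 2 ≤ B * (h ^ 2 + ‖z.1.2 - z.2.2‖ ^ 2)
          * (devWeight f z.1 + devWeight f z.2) :=
        h1.trans (mul_le_mul_of_nonneg_right
          (mul_le_mul_of_nonneg_left (by linarith) hB0.le) (by positivity))
      calc _ ≤ Q z * (B * (h ^ 2 + ‖z.1.2 - z.2.2‖ ^ 2)
            * (devWeight f z.1 + devWeight f z.2)) := mul_le_mul_of_nonneg_left h3 hq
        _ = _ := by ring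
  have hmom : ∀ᵐ x ∂μ, ∫⁻ y, ENNReal.ofReal (Q (x, y) * (h ^ 2 + ‖x.2 - y.2‖ ^ 2)) ∂μ
      ≤ ENNReal.ofReal ((1 + c) * (h ^ 2 + 1 / κ)) := by
    filter_upwards [ae_cylMeasure_norm] with x hx
    rw [show x = (x.1, x.2) from rfl, lintegral_smoothKernel_mul hK hh x.1 x.2
      (φ := fun w => h ^ 2 + ‖x.2 - w‖ ^ 2) (by fun_prop)]
    have m2 := measurable_langevinKernel_left κ x.2
    have e : ∀ w, ENNReal.ofReal (langevinKernel p κ x.2 w * (h ^ 2 + ‖x.2 - w‖ ^ 2))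
        = ENNReal.ofReal (langevinKernel p κ x.2 w) * ENNReal.ofReal (h ^ 2)
          + ENNReal.ofReal (langevinKernel p κ x.2 w * ‖x.2 - w‖ ^ 2) := fun w => by
      have := langevinKernel_nonneg hp hκ x.2 w
      rw [← ENNReal.ofReal_mul this, ← ENNReal.ofReal_add (by positivity) (by positivity), mul_add]
    simp_rw [e]
    rw [lintegral_add_left (by fun_prop), lintegral_mul_const _ (by fun_prop),
      lintegral_langevinKernel hp hκ hx, one_mul]
    refine (add_le_add le_rfl (hcκ x.2 hx)).trans ?_
    rw [← ENNReal.ofReal_add (by positivity) (by positivity)]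
    refine ENNReal.ofReal_le_ofReal ?_
    have : 0 < 1 / κ := by positivity
    have e2 : c / κ = c * (1 / κ) := by ring
    rw [e2]
    nlinarith [mul_nonneg hc0.le (sq_nonneg h)]
  have hone : ∫⁻ z, ENNReal.ofReal (Q z * (h ^ 2 + ‖z.1.2 - z.2.2‖ ^ 2))
        * ENNReal.ofReal (devWeight f z.1) ∂(μ.prod μ)
      ≤ ENNReal.ofReal ((1 + c) * (h ^ 2 + 1 / κ)) * ENNReal.ofReal W := by
    rw [lintegral_prod _ (by fun_prop), ← lintegral_devWeight hp hf hd hC',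
      ← lintegral_const_mul _ (by fun_prop)]
    refine lintegral_mono_ae ?_
    filter_upwards [hmom] with x hx
    rw [lintegral_mul_const]
    · exact mul_le_mul_left hx _
    · have : Measurable fun y => Q (x, y) := hmQ.comp measurable_prodMk_left
      fun_prop
  have htwo : ∫⁻ z, ENNReal.ofReal (Q z * (h ^ 2 + ‖z.1.2 - z.2.2‖ ^ 2))
        * ENNReal.ofReal (devWeight f z.2) ∂(μ.prod μ)
      = ∫⁻ z, ENNReal.ofReal (Q z * (h ^ 2 + ‖z.1.2 - z.2.2‖ ^ 2))
        * ENNReal.ofReal (devWeight f z.1) ∂(μ.prod μ) := by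
    rw [← lintegral_prod_swap]
    refine lintegral_congr fun z => ?_
    simp only [Prod.fst_swap, Prod.snd_swap]
    rw [show z.swap = (z.2, z.1) from rfl, hQ.symm z.2 z.1, norm_sub_rev]
  rw [dirichletForm, integral_eq_lintegral_of_nonneg_ae
    (Eventually.of_forall fun z => mul_nonneg (hQ.nonneg z) (sq_nonneg _)) (by fun_prop)]
  refine ENNReal.toReal_le_of_le_ofReal (by positivity) ((lintegral_mono_ae key).trans ?_)
  rw [lintegral_const_mul _ (by fun_prop), lintegral_add_left (by fun_prop), htwo]
  refine (mul_le_mul_right (add_le_add hone hone) _).trans (le_of_eq ?_)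
  rw [← ENNReal.ofReal_mul (by positivity), ← ENNReal.ofReal_add (by positivity) (by positivity),
    ← ENNReal.ofReal_mul hB0.le]
  congr 1
  ring

end SmoothKernel

/-! ### Projection, bias and second moment of the estimator -/

section Law
variable {p : ℕ} {f : ℝ → EuclideanSpace ℝ (Fin p) → ℝ}

/-- The law of radius and direction, as a measure on the whole cylinder. -/
noncomputable def polarLaw (f : ℝ → EuclideanSpace ℝ (Fin p) → ℝ) :
    Measure (ℝ × EuclideanSpace ℝ (Fin p)) :=
  (cylMeasure p).withDensity fun x => ENNReal.ofReal (polarExt f x)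

theorem ofReal_polarExt_ae_eq :
    (fun x => ENNReal.ofReal (polarExt f x)) =ᵐ[cylMeasure p]
      (Ioi (0 : ℝ) ×ˢ univ).indicator fun x => ENNReal.ofReal (f x.1 x.2) := by
  filter_upwards [ae_cylMeasure_norm] with x hx
  by_cases hu : 0 < x.1
  · rw [indicator_of_mem (show x ∈ Ioi (0 : ℝ) ×ˢ univ from ⟨hu, mem_univ _⟩),
      show x = (x.1, x.2) from rfl, polarExt_apply hu hx]
  · rw [indicator_of_notMem (fun h => hu h.1), show x = (x.1, x.2) from rfl,
      polarExt_of_nonpos (not_lt.1 hu), ENNReal.ofReal_zero]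

theorem withDensity_polarMeasure :
    (polarMeasure p).withDensity (fun x => ENNReal.ofReal (f x.1 x.2)) = polarLaw f := by
  rw [polarLaw, withDensity_congr_ae ofReal_polarExt_ae_eq,
    withDensity_indicator (measurableSet_Ioi.prod MeasurableSet.univ), polarMeasure_eq_restrict]

theorem isProbabilityMeasure_polarLaw (hd : IsPolarDensity f) :
    IsProbabilityMeasure (polarLaw f) := by
  constructor
  rw [polarLaw, withDensity_apply _ MeasurableSet.univ, Measure.restrict_univ,
    lintegral_polarExt hd]

theorem polarLaw_absolutelyContinuous : polarLaw f ≪ cylMeasure p :=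
  withDensity_absolutelyContinuous _ _

theorem integral_polarLaw (hf : DensityAssumption f) (hd : IsPolarDensity f)
    (φ : ℝ × EuclideanSpace ℝ (Fin p) → ℝ) :
    ∫ x, φ x ∂(polarLaw f) = ∫ x, polarExt f x * φ x ∂(cylMeasure p) := by
  rw [polarLaw, integral_withDensity_eq_integral_toReal_smul
    (measurable_polarExt hf).ennreal_ofReal (Eventually.of_forall fun x => ENNReal.ofReal_lt_top)]
  refine integral_congr_ae (Eventually.of_forall fun x => ?_)
  simp only [smul_eq_mul]
  rw [ENNReal.toReal_ofReal (polarExt_nonneg hd x)]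

theorem polarLaw_le {C : ℝ} (hC : DensityBounds f C) :
    polarLaw f ≤ ENNReal.ofReal C • cylMeasure p := by
  rw [← withDensity_const, polarLaw]
  exact withDensity_mono (Eventually.of_forall fun x => ENNReal.ofReal_le_ofReal (polarExt_le hC x))

end Law

section Projection
variable {p : ℕ} {K : ℝ → ℝ} {h κ : ℝ} {f : ℝ → EuclideanSpace ℝ (Fin p) → ℝ}

theorem integral_langevinKernel (hp : 2 ≤ p) (hκ : 0 < κ) {e : EuclideanSpace ℝ (Fin p)}
    (he : ‖e‖ = 1) : ∫ v, langevinKernel p κ e v ∂(surfaceMeasure p) = 1 := by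
  rw [integral_eq_lintegral_of_nonneg_ae
    (Eventually.of_forall fun v => langevinKernel_nonneg hp hκ e v)
    (measurable_langevinKernel_left κ e).aestronglyMeasurable, lintegral_langevinKernel hp hκ he,
    ENNReal.toReal_one]

/-- Functions of the radius are smoothed in the radius only. -/
theorem kernelAction_smoothKernel_radial (hp : 2 ≤ p) (hκ : 0 < κ) (g : ℝ → ℝ)
    {x : ℝ × EuclideanSpace ℝ (Fin p)} (hx : ‖x.2‖ = 1) :
    kernelAction (cylMeasure p) (smoothKernel p K h κ) (fun y => g y.1) x
      = ∫ u, radialKernel K h x.1 u * g u := by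
  have e : ∀ y : ℝ × EuclideanSpace ℝ (Fin p), smoothKernel p K h κ (x, y) * g y.1
      = (radialKernel K h x.1 y.1 * g y.1) * langevinKernel p κ x.2 y.2 := fun y => by
    simp only [smoothKernel]; ring
  rw [kernelAction]
  simp_rw [e]
  rw [cylMeasure, integral_prod_mul (f := fun u => radialKernel K h x.1 u * g u)
    (g := langevinKernel p κ x.2), integral_langevinKernel hp hκ hx, mul_one]

/-- The deviation is orthogonal to functions of the radius. Where the product is not integrable the
integral is zero by convention. -/
theorem integral_mul_devPart (hp : 2 ≤ p) (hf : DensityAssumption f) (hd : IsPolarDensity f)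
    (G : ℝ → ℝ) : ∫ x, devPart f x * G x.1 ∂(cylMeasure p) = 0 := by
  obtain ⟨C, hC⟩ := exists_densityBounds hp hf hd
  by_cases hi : Integrable (fun x => devPart f x * G x.1) (cylMeasure p)
  · rw [cylMeasure] at hi ⊢
    rw [integral_prod _ hi]
    refine integral_eq_zero_of_ae (Eventually.of_forall fun u => ?_)
    change ∫ v, devPart f (u, v) * G u ∂(surfaceMeasure p) = 0
    rw [integral_mul_const, integral_devPart_section hp hf hd hC, zero_mul]
  · exact integral_undef hi

/-- The projection of the `U`-statistic kernel is the smoothed deviation: subtracting the uniform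
density in the direction removes exactly the spherically symmetric part. -/
theorem hajekProj_deviationKernel (hp : 2 ≤ p) (hf : DensityAssumption f) (hd : IsPolarDensity f)
    (hK : KernelAssumption K) (hh : 0 < h) (hκ : 0 < κ) :
    hajekProj (polarLaw f) (deviationKernel p K h κ) =ᵐ[cylMeasure p]
      kernelAction (cylMeasure p) (smoothKernel p K h κ) (devPart f) := by
  obtain ⟨C, hC⟩ := exists_densityBounds hp hf hd
  have hA := unitSphereArea_natCast_pos hp
  have hQ := isReversibleKernel_smoothKernel hp hK hh hκ
  filter_upwards [ae_cylMeasure_norm, hQ.ae_integrable] with x hx ⟨hi, _⟩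
  have hg : Measurable fun y : ℝ × EuclideanSpace ℝ (Fin p) => radialMean f y.1 :=
    (measurable_radialMean hf).comp measurable_fst
  have i1 : Integrable (fun y => smoothKernel p K h κ (x, y) * devPart f y) (cylMeasure p) :=
    hi.mul_bdd (measurable_devPart hf).aestronglyMeasurable
      (Eventually.of_forall (abs_devPart_le hp hf hd hC))
  have i2 : Integrable (fun y => smoothKernel p K h κ (x, y) * radialMean f y.1) (cylMeasure p) :=
    hi.mul_bdd (c := C) hg.aestronglyMeasurable (Eventually.of_forall fun y => by
      rw [Real.norm_of_nonneg (radialMean_nonneg hp hd _)]; exact radialMean_le hp hf hd hC _)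
  have i3 : Integrable (fun y : ℝ × EuclideanSpace ℝ (Fin p) =>
      radialKernel K h x.1 y.1 * (unitSphereArea p)⁻¹) (cylMeasure p) :=
    (integrable_radialKernel hK hh x.1).mul_prod (integrable_const _)
  have i4 : Integrable (fun y => radialKernel K h x.1 y.1 * (unitSphereArea p)⁻¹ * polarExt f y)
      (cylMeasure p) :=
    i3.mul_bdd (measurable_polarExt hf).aestronglyMeasurable (c := C)
      (Eventually.of_forall fun y => by
        rw [Real.norm_of_nonneg (polarExt_nonneg hd _)]; exact polarExt_le hC _)
  have e1 : ∫ y, radialKernel K h x.1 y.1 * (unitSphereArea p)⁻¹ * polarExt f y ∂(cylMeasure p)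
      = ∫ u, radialKernel K h x.1 u * radialMean f u := by
    rw [cylMeasure] at i4 ⊢
    rw [integral_prod _ i4]
    refine integral_congr_ae (Eventually.of_forall fun u => ?_)
    simp only
    rw [integral_const_mul, radialMean, mul_assoc]
  have e2 := kernelAction_smoothKernel_radial (K := K) (h := h) hp hκ (radialMean f) hx
  rw [kernelAction] at e2
  have e3 : ∀ y, polarExt f y * deviationKernel p K h κ (x, y)
      = (smoothKernel p K h κ (x, y) * devPart f y
        + smoothKernel p K h κ (x, y) * radialMean f y.1)
        - radialKernel K h x.1 y.1 * (unitSphereArea p)⁻¹ * polarExt f y := fun y => by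
    simp only [deviationKernel, smoothKernel, devPart]; ring
  rw [hajekProj, integral_polarLaw hf hd]
  simp_rw [e3]
  have i5 : Integrable (fun y => smoothKernel p K h κ (x, y) * devPart f y
        + smoothKernel p K h κ (x, y) * radialMean f y.1) (cylMeasure p) := i1.add i2
  rw [integral_sub i5 i4, integral_add i1 i2, e1, e2, add_sub_cancel_right, kernelAction]

theorem integral_hajekProj_sub_sq_le (hp : 2 ≤ p) (hf : DensityAssumption f)
    (hd : IsPolarDensity f) {C : ℝ} (hC : DensityBounds f C) (hK : KernelAssumption K)
    (hh : 0 < h) (hκ : 0 < κ) :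
    ∫ x, (hajekProj (polarLaw f) (deviationKernel p K h κ) x - devPart f x) ^ 2 ∂(polarLaw f)
      ≤ C * dirichletForm (cylMeasure p) (smoothKernel p K h κ) (devPart f) := by
  rw [integral_polarLaw hf hd]
  refine le_trans (le_of_eq (integral_congr_ae ?_))
    ((isReversibleKernel_smoothKernel hp hK hh hκ).integral_mul_kernelAction_sub_sq_le
      (measurable_devPart hf) (integrable_devPart hp hf hd hC) (abs_devPart_le hp hf hd hC)
      (polarExt_nonneg hd) (polarExt_le hC))
  filter_upwards [hajekProj_deviationKernel hp hf hd hK hh hκ] with x hx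
  rw [hx]

/-- The bias of the `U`-statistic is minus one half of the Dirichlet form of the deviation. -/
theorem integral_hajekProj_sub (hp : 2 ≤ p) (hf : DensityAssumption f)
    (hd : IsPolarDensity f) (hK : KernelAssumption K) (hh : 0 < h) (hκ : 0 < κ) :
    ∫ x, hajekProj (polarLaw f) (deviationKernel p K h κ) x ∂(polarLaw f)
        - ∫ x, devPart f x ∂(polarLaw f)
      = -(dirichletForm (cylMeasure p) (smoothKernel p K h κ) (devPart f) / 2) := by
  obtain ⟨C, hC⟩ := exists_densityBounds hp hf hd
  have hQ := isReversibleKernel_smoothKernel hp hK hh hκ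
  have hdm := measurable_devPart hf
  have hdi := integrable_devPart hp hf hd hC
  have hdC := abs_devPart_le hp hf hd hC
  have hgm : Measurable fun y : ℝ × EuclideanSpace ℝ (Fin p) => radialMean f y.1 :=
    (measurable_radialMean hf).comp measurable_fst
  have hgi := integrable_radialMean hp hf hd hC
  have hTm := hQ.measurable_kernelAction hdm
  have hTb := hQ.abs_kernelAction_le hdC
  set T := kernelAction (cylMeasure p) (smoothKernel p K h κ) (devPart f) with hT
  have e1 : ∫ x, polarExt f x * hajekProj (polarLaw f) (deviationKernel p K h κ) x ∂(cylMeasure p)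
      = ∫ x, polarExt f x * T x ∂(cylMeasure p) := by
    refine integral_congr_ae ?_
    filter_upwards [hajekProj_deviationKernel hp hf hd hK hh hκ] with x hx
    rw [hx]
  have i1 : Integrable (fun x => polarExt f x * T x) (cylMeasure p) :=
    (integrable_polarExt hf hd).mul_bdd hTm.aestronglyMeasurable hTb
  have i2 : Integrable (fun x => polarExt f x * devPart f x) (cylMeasure p) :=
    (integrable_polarExt hf hd).mul_bdd hdm.aestronglyMeasurable (Eventually.of_forall hdC)
  have i3 : Integrable (fun x => devPart f x * (T x - devPart f x)) (cylMeasure p) := by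
    simp_rw [mul_sub]
    exact (hdi.mul_bdd hTm.aestronglyMeasurable hTb).sub
      (hdi.mul_bdd hdm.aestronglyMeasurable (Eventually.of_forall hdC))
  have i4 : Integrable (fun x => radialMean f x.1 * T x) (cylMeasure p) :=
    hgi.mul_bdd hTm.aestronglyMeasurable hTb
  have i5 : Integrable (fun x => devPart f x * radialMean f x.1) (cylMeasure p) := by
    simp_rw [mul_comm (devPart f _)]
    exact hgi.mul_bdd hdm.aestronglyMeasurable (Eventually.of_forall hdC)
  have e2 : ∫ x, radialMean f x.1 * T x ∂(cylMeasure p) = 0 := by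
    rw [hT, hQ.integral_mul_kernelAction_comm hgm hgi hdm hdC,
      ← integral_mul_devPart hp hf hd fun u => ∫ u', radialKernel K h u u' * radialMean f u']
    refine integral_congr_ae ?_
    filter_upwards [ae_cylMeasure_norm] with x hx
    rw [kernelAction_smoothKernel_radial hp hκ _ hx]
  rw [integral_polarLaw hf hd, integral_polarLaw hf hd, e1, ← integral_sub i1 i2,
    ← hQ.integral_mul_kernelAction_sub hdm hdi hdC]
  have e3 : ∀ x, polarExt f x * T x - polarExt f x * devPart f x
      = (devPart f x * (T x - devPart f x) + radialMean f x.1 * T x)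
        - devPart f x * radialMean f x.1 := fun x => by
    simp only [devPart]; ring
  simp_rw [e3]
  have i6 : Integrable (fun x => devPart f x * (T x - devPart f x) + radialMean f x.1 * T x)
    (cylMeasure p) := i3.add i4
  rw [integral_sub i6 i5, integral_add i3 i4, e2, integral_mul_devPart hp hf hd, sub_zero, add_zero]

/-- The second moment of the `U`-statistic kernel is of the order `κ^{(p-1)/2} / h`. -/
theorem exists_lintegral_deviationKernel_sq_le (hp : 2 ≤ p) (hf : DensityAssumption f)
    (hd : IsPolarDensity f) (hK : KernelAssumption K) :
    ∃ C > 0, ∀ κ ≥ 1, ∀ h > 0,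
      ∫⁻ z, ENNReal.ofReal (deviationKernel p K h κ z ^ 2) ∂((polarLaw f).prod (polarLaw f))
        ≤ ENNReal.ofReal (C * (κ ^ (((p : ℝ) - 1) / 2) / h)) := by
  obtain ⟨B, hB⟩ := exists_densityBounds hp hf hd
  obtain ⟨c, hc0, hc⟩ := langevinKernel_le (p := p) hp
  have hA := unitSphereArea_natCast_pos hp
  have hB0 := hB.pos
  have := isProbabilityMeasure_polarLaw hd
  set a := (unitSphereArea p)⁻¹ with ha
  have ha0 : 0 < a := by positivity
  set k2 := ∫ x, K x ^ 2 with hk2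
  have hk20 : 0 ≤ k2 := integral_nonneg fun x => sq_nonneg _
  refine ⟨B * (k2 + 1) * (c + a), by positivity, fun κ hκ1 h hh => ?_⟩
  have hκ : 0 < κ := by linarith
  have hm := measurable_deviationKernel (p := p) hK h κ
  set M := κ ^ (((p : ℝ) - 1) / 2) with hM
  have hM1 : 1 ≤ M := Real.one_le_rpow hκ1 (by
    have : (2 : ℝ) ≤ p := by exact_mod_cast hp
    linarith)
  have inner : ∀ x : ℝ × EuclideanSpace ℝ (Fin p), ‖x.2‖ = 1 →
      ∫⁻ y, ENNReal.ofReal (deviationKernel p K h κ (x, y) ^ 2) ∂(cylMeasure p)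
        ≤ ENNReal.ofReal (k2 / h * ((c + a) * M)) := by
    intro x hx
    have mk : Measurable (radialKernel K h x.1) :=
      Measurable.of_uncurry_left (measurable_radialKernel hK h)
    have ml := measurable_langevinKernel_left κ x.2
    have e : ∀ y : ℝ × EuclideanSpace ℝ (Fin p),
        ENNReal.ofReal (deviationKernel p K h κ (x, y) ^ 2)
        = ENNReal.ofReal (radialKernel K h x.1 y.1 ^ 2)
          * ENNReal.ofReal ((langevinKernel p κ x.2 y.2 - a) ^ 2) := fun y => by
      rw [deviationKernel, mul_pow, ENNReal.ofReal_mul (sq_nonneg _)]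
    simp_rw [e]
    rw [cylMeasure, lintegral_prod_mul
      (f := fun u => ENNReal.ofReal (radialKernel K h x.1 u ^ 2))
      (g := fun w => ENNReal.ofReal ((langevinKernel p κ x.2 w - a) ^ 2)) (by fun_prop)
      (by fun_prop), lintegral_radialKernel_sq hK hh, ENNReal.ofReal_mul (by positivity)]
    refine mul_le_mul_right ?_ _
    have hb : ∀ᵐ w ∂(surfaceMeasure p), ENNReal.ofReal ((langevinKernel p κ x.2 w - a) ^ 2)
        ≤ ENNReal.ofReal (c * M) * ENNReal.ofReal (langevinKernel p κ x.2 w)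
          + ENNReal.ofReal (a ^ 2) := by
      filter_upwards [ae_surfaceMeasure_norm] with w hw
      have l0 := langevinKernel_nonneg hp hκ x.2 w
      have l1 := hc κ hκ1 x.2 w hx hw
      rw [← ENNReal.ofReal_mul (by positivity), ← ENNReal.ofReal_add (by positivity)
        (by positivity)]
      refine ENNReal.ofReal_le_ofReal ?_
      -- `(l - a)² ≤ l² + a²` and `l² ≤ c M l`
      nlinarith [mul_nonneg l0 ha0.le, mul_le_mul_of_nonneg_right l1 l0]
    refine (lintegral_mono_ae hb).trans ?_
    rw [lintegral_add_right _ measurable_const, lintegral_const_mul _ (by fun_prop),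
      lintegral_langevinKernel hp hκ hx, lintegral_const, surfaceMeasure_univ (by omega), mul_one,
      ← ENNReal.ofReal_mul (by positivity), ← ENNReal.ofReal_add (by positivity) (by positivity)]
    refine ENNReal.ofReal_le_ofReal ?_
    have : a ^ 2 * unitSphereArea p = a := by rw [ha]; field_simp
    rw [this]
    nlinarith
  rw [lintegral_prod _ (by fun_prop)]
  have houter : ∀ᵐ x ∂(polarLaw f),
      ∫⁻ y, ENNReal.ofReal (deviationKernel p K h κ (x, y) ^ 2) ∂(polarLaw f)
        ≤ ENNReal.ofReal (B * (k2 + 1) * (c + a) * (M / h)) := by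
    filter_upwards [polarLaw_absolutelyContinuous.ae_le ae_cylMeasure_norm] with x hx
    refine (lintegral_mono' (polarLaw_le hB) le_rfl).trans ?_
    rw [lintegral_smul_measure, smul_eq_mul]
    refine (mul_le_mul_right (inner x hx) _).trans ?_
    rw [← ENNReal.ofReal_mul hB0.le]
    refine ENNReal.ofReal_le_ofReal ?_
    have e : B * (k2 / h * ((c + a) * M)) = B * k2 * (c + a) * (M / h) := by ring
    rw [e]
    have : 0 < M / h := by positivity
    gcongr
    linarith
  refine (lintegral_mono_ae houter).trans ?_
  rw [lintegral_const, measure_univ, mul_one]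

theorem memLp_deviationKernel (hp : 2 ≤ p) (hf : DensityAssumption f) (hd : IsPolarDensity f)
    (hK : KernelAssumption K) (hh : 0 < h) (hκ : 1 ≤ κ) :
    MemLp (deviationKernel p K h κ) 2 ((polarLaw f).prod (polarLaw f)) := by
  obtain ⟨C, hC0, hC⟩ := exists_lintegral_deviationKernel_sq_le hp hf hd hK
  have hm := measurable_deviationKernel (p := p) hK h κ
  rw [memLp_two_iff_integrable_sq hm.aestronglyMeasurable]
  refine ⟨(hm.pow_const 2).aestronglyMeasurable, ?_⟩
  rw [hasFiniteIntegral_iff_ofReal (Eventually.of_forall fun z => sq_nonneg _)]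
  exact (hC κ hκ h hh).trans_lt ENNReal.ofReal_lt_top

end Projection

/-! ### The deviation functional and the limiting variance -/

section Deviation
variable {p : ℕ} {f : ℝ → EuclideanSpace ℝ (Fin p) → ℝ}

theorem lintegral_polarMeasure (φ : ℝ × EuclideanSpace ℝ (Fin p) → ENNReal) (hφ : Measurable φ) :
    ∫⁻ x, φ x ∂(polarMeasure p) = ∫⁻ u in Ioi 0, ∫⁻ v, φ (u, v) ∂(surfaceMeasure p) := by
  rw [polarMeasure, lintegral_prod _ hφ.aemeasurable]

theorem polarExt_ae_eq_polarMeasure :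
    ∀ᵐ x ∂(polarMeasure p), f x.1 x.2 = polarExt f x := by
  rw [polarMeasure_eq_restrict, ae_restrict_iff' (measurableSet_Ioi.prod MeasurableSet.univ)]
  filter_upwards [ae_cylMeasure_norm] with x hx hu
  rw [show x = (x.1, x.2) from rfl, polarExt_apply hu.1 hx]

theorem integrable_devPart_sq (hp : 2 ≤ p) (hf : DensityAssumption f) (hd : IsPolarDensity f) :
    Integrable (fun x => devPart f x ^ 2) (cylMeasure p) := by
  obtain ⟨C, hC⟩ := exists_densityBounds hp hf hd
  simp_rw [sq]
  exact (integrable_devPart hp hf hd hC).mul_bdd (measurable_devPart hf).aestronglyMeasurable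
    (Eventually.of_forall (abs_devPart_le hp hf hd hC))

theorem lintegral_devPart_sq_polarMeasure (hp : 2 ≤ p) (hf : DensityAssumption f)
    (hd : IsPolarDensity f) :
    ∫⁻ x, ENNReal.ofReal (devPart f x ^ 2) ∂(polarMeasure p)
      = ENNReal.ofReal (∫ x, devPart f x ^ 2 ∂(cylMeasure p)) := by
  rw [ofReal_integral_eq_lintegral_ofReal (integrable_devPart_sq hp hf hd)
    (Eventually.of_forall fun x => sq_nonneg _), polarMeasure_eq_restrict,
    ← lintegral_indicator (measurableSet_Ioi.prod MeasurableSet.univ)]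
  refine lintegral_congr fun x => ?_
  by_cases hu : 0 < x.1
  · rw [indicator_of_mem (show x ∈ Ioi (0 : ℝ) ×ˢ univ from ⟨hu, mem_univ _⟩)]
  · rw [indicator_of_notMem (fun h => hu h.1), show x = (x.1, x.2) from rfl,
      devPart_of_nonpos (not_lt.1 hu)]
    simp

/-- On each sphere the mean is the constant closest to the density in mean square. -/
theorem lintegral_devPart_sq_section_le (hp : 2 ≤ p) (hf : DensityAssumption f)
    (hd : IsPolarDensity f) (u c : ℝ) :
    ∫⁻ v, ENNReal.ofReal (devPart f (u, v) ^ 2) ∂(surfaceMeasure p)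
      ≤ ∫⁻ v, ENNReal.ofReal ((polarExt f (u, v) - c) ^ 2) ∂(surfaceMeasure p) := by
  obtain ⟨C, hC⟩ := exists_densityBounds hp hf hd
  have hm : Measurable fun v => devPart f (u, v) :=
    (measurable_devPart hf).comp measurable_prodMk_left
  have i1 : Integrable (fun v => devPart f (u, v)) (surfaceMeasure p) :=
    Integrable.of_bound hm.aestronglyMeasurable C
      (Eventually.of_forall fun v => abs_devPart_le hp hf hd hC _)
  have i2 : Integrable (fun v => devPart f (u, v) ^ 2) (surfaceMeasure p) :=
    Integrable.of_bound (hm.pow_const 2).aestronglyMeasurable (C ^ 2)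
      (Eventually.of_forall fun v => by
        rw [norm_pow]
        exact pow_le_pow_left₀ (norm_nonneg _) (abs_devPart_le hp hf hd hC _) 2)
  set t := radialMean f u - c with ht
  have e : ∀ v, (polarExt f (u, v) - c) ^ 2
      = (devPart f (u, v) ^ 2 + 2 * t * devPart f (u, v)) + t ^ 2 := fun v => by
    simp only [devPart, ht]; ring
  have i3 : Integrable (fun v => devPart f (u, v) ^ 2 + 2 * t * devPart f (u, v))
    (surfaceMeasure p) := i2.add (i1.const_mul _)
  have i4 : Integrable (fun v => (polarExt f (u, v) - c) ^ 2) (surfaceMeasure p) := by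
    simp_rw [e]; exact i3.add (integrable_const _)
  rw [← ofReal_integral_eq_lintegral_ofReal i2 (Eventually.of_forall fun v => sq_nonneg _),
    ← ofReal_integral_eq_lintegral_ofReal i4 (Eventually.of_forall fun v => sq_nonneg _)]
  refine ENNReal.ofReal_le_ofReal ?_
  simp_rw [e]
  rw [integral_add i3 (integrable_const _), integral_add i2 (i1.const_mul _), integral_const_mul,
    integral_devPart_section hp hf hd hC, mul_zero, add_zero]
  have : 0 ≤ ∫ _, t ^ 2 ∂(surfaceMeasure p) := integral_nonneg fun _ => sq_nonneg t
  linarith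

theorem isRadialDensity_radialMean (hp : 2 ≤ p) (hf : DensityAssumption f)
    (hd : IsPolarDensity f) : IsRadialDensity fun u => unitSphereArea p * radialMean f u := by
  obtain ⟨C, hC⟩ := exists_densityBounds hp hf hd
  have hA := unitSphereArea_natCast_pos hp
  have hm := measurable_radialMean hf
  refine ⟨hm.const_mul _, fun u _ => mul_nonneg hA.le (radialMean_nonneg hp hd u), ?_⟩
  have h1 := lintegral_radialMean hp hf hd hC
  rw [cylMeasure, lintegral_prod _ (by fun_prop)] at h1
  rw [← h1, ← lintegral_indicator measurableSet_Ioi]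
  refine lintegral_congr fun u => ?_
  change _ = ∫⁻ _, ENNReal.ofReal (radialMean f u) ∂(surfaceMeasure p)
  rw [lintegral_const, surfaceMeasure_univ (by omega), mul_comm, ← ENNReal.ofReal_mul hA.le]
  by_cases hu : u ∈ Ioi (0 : ℝ)
  · rw [indicator_of_mem hu]
  · rw [indicator_of_notMem hu, radialMean_of_nonpos (not_lt.1 hu)]
    simp

/-- The minimum is attained at the radial density. -/
theorem sphericityDeviation_eq (hp : 2 ≤ p) (hf : DensityAssumption f) (hd : IsPolarDensity f) :
    sphericityDeviation f = ∫ x, devPart f x ^ 2 ∂(cylMeasure p) := by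
  have hA := unitSphereArea_natCast_pos hp
  have hFm := measurable_polarExt hf
  have hdm := measurable_devPart hf
  have h0 : 0 ≤ ∫ x, devPart f x ^ 2 ∂(cylMeasure p) := integral_nonneg fun x => sq_nonneg _
  suffices h : (⨅ (g : ℝ → ℝ) (_ : IsRadialDensity g), ∫⁻ x,
      ENNReal.ofReal ((f x.1 x.2 - g x.1 * (unitSphereArea p)⁻¹) ^ 2) ∂(polarMeasure p))
      = ∫⁻ x, ENNReal.ofReal (devPart f x ^ 2) ∂(polarMeasure p) by
    rw [sphericityDeviation, h, lintegral_devPart_sq_polarMeasure hp hf hd, ENNReal.toReal_ofReal h0]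
  refine le_antisymm (iInf₂_le_of_le _ (isRadialDensity_radialMean hp hf hd) (le_of_eq ?_))
    (le_iInf₂ fun g hg => ?_)
  · refine lintegral_congr_ae ?_
    filter_upwards [polarExt_ae_eq_polarMeasure (f := f)] with x hx
    rw [hx, devPart]
    congr 3
    field_simp
  · have hgm := hg.measurable
    have e : ∫⁻ x, ENNReal.ofReal ((f x.1 x.2 - g x.1 * (unitSphereArea p)⁻¹) ^ 2) ∂(polarMeasure p)
        = ∫⁻ x, ENNReal.ofReal ((polarExt f x - g x.1 * (unitSphereArea p)⁻¹) ^ 2)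
          ∂(polarMeasure p) := by
      refine lintegral_congr_ae ?_
      filter_upwards [polarExt_ae_eq_polarMeasure (f := f)] with x hx
      rw [hx]
    rw [e, lintegral_polarMeasure _ (by fun_prop), lintegral_polarMeasure _ (by fun_prop)]
    exact lintegral_mono fun u => lintegral_devPart_sq_section_le hp hf hd u
      (g u * (unitSphereArea p)⁻¹)

theorem integral_devPart_polarLaw (hp : 2 ≤ p) (hf : DensityAssumption f)
    (hd : IsPolarDensity f) :
    ∫ x, devPart f x ∂(polarLaw f) = sphericityDeviation f := by
  obtain ⟨C, hC⟩ := exists_densityBounds hp hf hd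
  rw [integral_polarLaw hf hd, sphericityDeviation_eq hp hf hd]
  have e : ∀ x, polarExt f x * devPart f x
      = devPart f x ^ 2 + devPart f x * radialMean f x.1 := fun x => by
    simp only [devPart]; ring
  have i2 : Integrable (fun x => devPart f x * radialMean f x.1) (cylMeasure p) := by
    simp_rw [mul_comm (devPart f _)]
    exact (integrable_radialMean hp hf hd hC).mul_bdd (measurable_devPart hf).aestronglyMeasurable
      (Eventually.of_forall (abs_devPart_le hp hf hd hC))
  simp_rw [e]
  rw [integral_add (integrable_devPart_sq hp hf hd) i2, integral_mul_devPart hp hf hd, add_zero]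

theorem memLp_devPart (hp : 2 ≤ p) (hf : DensityAssumption f) (hd : IsPolarDensity f) :
    MemLp (devPart f) 2 (polarLaw f) := by
  obtain ⟨C, hC⟩ := exists_densityBounds hp hf hd
  have := isProbabilityMeasure_polarLaw hd
  exact MemLp.of_bound (measurable_devPart hf).aestronglyMeasurable C
    (Eventually.of_forall (abs_devPart_le hp hf hd hC))

theorem continuousOn_sphere (hf : DensityAssumption f) {u : ℝ} (hu : 0 < u) :
    ContinuousOn (f u) (Metric.sphere 0 1) := by
  have h1 : ContinuousOn (fun v => rayExtension f u v) (Metric.sphere 0 1) := by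
    refine hf.differentiable.continuousOn.comp (f := fun v => (u, v)) (by fun_prop) fun v hv => ?_
    refine mk_mem_prod hu fun h0 => ?_
    rw [mem_sphere_zero_iff_norm, mem_singleton_iff.1 h0, norm_zero] at hv
    exact zero_ne_one hv
  refine h1.congr fun v hv => ?_
  exact (rayExtension_of_norm_one (by simpa using hv) u).symm

/-- A continuous function on the sphere with values `0` and `c ≠ 0` is constant. -/
theorem forall_eq_zero_or_forall_eq (hp : 2 ≤ p) {φ : EuclideanSpace ℝ (Fin p) → ℝ}
    (hφ : ContinuousOn φ (Metric.sphere 0 1)) {c : ℝ}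
    (h : ∀ v, ‖v‖ = 1 → φ v = 0 ∨ φ v = c) :
    (∀ v, ‖v‖ = 1 → φ v = 0) ∨ ∀ v, ‖v‖ = 1 → φ v = c := by
  by_contra hcon
  push Not at hcon
  obtain ⟨⟨v, hv, hv0⟩, w, hw, hwc⟩ := hcon
  have hvc := (h v hv).resolve_left hv0
  have hw0 := (h w hw).resolve_right hwc
  have hconn : IsPreconnected (Metric.sphere (0 : EuclideanSpace ℝ (Fin p)) 1) := by
    refine isPreconnected_sphere ?_ 0 1
    rw [← Module.finrank_eq_rank, finrank_euclideanSpace_fin]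
    exact_mod_cast (by omega : 1 < p)
  have himg := (hconn.image φ hφ).ordConnected
  have hmid : c / 2 ∈ φ '' Metric.sphere 0 1 := by
    have a1 : (0 : ℝ) ∈ φ '' Metric.sphere 0 1 := ⟨w, by simpa using hw, hw0⟩
    have a2 : c ∈ φ '' Metric.sphere 0 1 := ⟨v, by simpa using hv, hvc⟩
    rcases le_total 0 c with hc | hc
    · exact himg.out a1 a2 ⟨by linarith, by linarith⟩
    · exact himg.out a2 a1 ⟨by linarith, by linarith⟩
  obtain ⟨z, hz, hzc⟩ := hmid
  have hc0 : c ≠ 0 := fun h0 => hv0 (hvc.trans h0)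
  rcases h z (by simpa using hz) with h1 | h1
  · exact hc0 (by linarith)
  · exact hc0 (by linarith)

/-- The limiting variance is positive: otherwise the density would take, on almost every sphere,
only the value `0` and one other value, hence be constant there. -/
theorem variance_devPart_pos (hp : 2 ≤ p) (hf : DensityAssumption f) (hd : IsPolarDensity f)
    (hM : 0 < sphericityDeviation f) : 0 < Var[devPart f; polarLaw f] := by
  obtain ⟨C, hC⟩ := exists_densityBounds hp hf hd
  have hP := isProbabilityMeasure_polarLaw hd
  have hA := unitSphereArea_natCast_pos hp
  refine lt_of_le_of_ne (variance_nonneg _ _) fun h0 => ?_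
  have h1 := ae_eq_integral_of_variance_eq_zero (memLp_devPart hp hf hd) h0.symm
  rw [integral_devPart_polarLaw hp hf hd, polarLaw,
    ae_withDensity_iff (measurable_polarExt hf).ennreal_ofReal] at h1
  have h2 := Measure.ae_ae_of_ae_prod h1
  set c := sphericityDeviation f
  have h3 : ∀ᵐ u : ℝ, ∀ v, ‖v‖ = 1 → polarExt f (u, v) = 0 := by
    filter_upwards [h2] with u hu
    rcases le_or_gt u 0 with hu0 | hu0
    · exact fun v _ => polarExt_of_nonpos hu0 v
    have hcont := continuousOn_sphere hf hu0
    set s := {v : EuclideanSpace ℝ (Fin p) | f u v = 0 ∨ f u v = c + radialMean f u} with hs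
    have hae : ∀ᵐ v ∂(surfaceMeasure p), v ∈ s := by
      filter_upwards [hu, ae_surfaceMeasure_norm] with v hv hv1
      rw [devPart, polarExt_apply hu0 hv1] at hv
      rcases (hd.nonneg u hu0 v hv1).eq_or_lt with h | h
      · exact Or.inl h.symm
      · refine Or.inr ?_
        have := hv (by simpa using h)
        simp only at this
        linarith
    have hcl : IsClosed ((↑) ⁻¹' s : Set (Metric.sphere (0 : EuclideanSpace ℝ (Fin p)) 1)) := by
      have hc' : Continuous fun v : Metric.sphere (0 : EuclideanSpace ℝ (Fin p)) 1 => f u v :=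
        continuousOn_iff_continuous_domRestrict.1 hcont
      exact (isClosed_eq hc' continuous_const).union (isClosed_eq hc' continuous_const)
    have hall : ∀ v, ‖v‖ = 1 → f u v = 0 ∨ f u v = c + radialMean f u := fun v hv =>
      forall_sphere_of_ae hae hcl hv
    rcases forall_eq_zero_or_forall_eq hp hcont hall with h | h
    · exact fun v hv => (polarExt_apply hu0 hv).trans (h v hv)
    · -- a constant density on the sphere equals its mean, contradicting `c > 0`
      exfalso
      have h4 := integral_devPart_section hp hf hd hC u
      have h5 : ∫ v, devPart f (u, v) ∂(surfaceMeasure p) = ∫ _, c ∂(surfaceMeasure p) := by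
        refine integral_congr_ae ?_
        filter_upwards [ae_surfaceMeasure_norm] with v hv
        rw [devPart, polarExt_apply hu0 hv, h v hv]
        simp
      rw [h5, integral_const, surfaceMeasure_real_univ (by omega), smul_eq_mul] at h4
      exact (mul_pos hA hM).ne' h4
  have h6 : ∫⁻ x, ENNReal.ofReal (polarExt f x) ∂(cylMeasure p) = 0 := by
    rw [cylMeasure, lintegral_prod _ (measurable_polarExt hf).ennreal_ofReal.aemeasurable]
    rw [lintegral_congr_ae (g := fun _ => 0), lintegral_zero]
    filter_upwards [h3] with u hu
    rw [lintegral_congr_ae (g := fun _ => 0), lintegral_zero]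
    filter_upwards [ae_surfaceMeasure_norm] with v hv
    rw [hu v hv, ENNReal.ofReal_zero]
  rw [lintegral_polarExt hd] at h6
  exact one_ne_zero h6

end Deviation

/-! ### The estimator as a U-statistic -/

section Estimator
variable {p : ℕ}

/-- The estimator is the `U`-statistic of the radii and directions with the kernel
`deviationKernel`. -/
theorem deviationEstimator_eq_uStat (K : ℝ → ℝ) (h κ : ℝ) (s : Finset ℕ)
    (y : ℕ → EuclideanSpace ℝ (Fin p)) :
    deviationEstimator K h κ s y
      = uStat (deviationKernel p K h κ) s fun i => (‖y i‖, direction (y i)) := by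
  rw [deviationEstimator, jointEstimator, radialEstimator, uStat, Finset.mul_sum, Finset.mul_sum,
    Finset.mul_sum, Finset.mul_sum, ← Finset.sum_sub_distrib]
  refine Finset.sum_congr rfl fun q _ => ?_
  simp only [deviationKernel, radialKernel, langevinKernel, mul_inv]
  ring

theorem jackknifeVariance_eq {K : ℝ → ℝ} (hK : KernelAssumption K) (h κ : ℝ) {n : ℕ} (hn : 3 ≤ n)
    (y : ℕ → EuclideanSpace ℝ (Fin p)) :
    jackknifeVariance K h κ n y = (n : ℝ) * ((n : ℝ) - 1) / ((n : ℝ) - 2) ^ 2 *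
      empVar n (rowMean (deviationKernel p K h κ) n fun i => (‖y i‖, direction (y i))) := by
  rw [jackknifeVariance, pseudovalueMean]
  refine jackknife_sum_sq_eq (deviationKernel_symm hK h κ) hn _ fun i _ => ?_
  rw [pseudovalue, deviationEstimator_eq_uStat, deviationEstimator_eq_uStat]

theorem measurable_direction : Measurable (direction : EuclideanSpace ℝ (Fin p) → _) := by
  unfold direction
  fun_prop

theorem HasPolarDensity.isPolarDensity {Ω : Type*} [MeasurableSpace Ω] {P : Measure Ω}
    [IsProbabilityMeasure P] {Y : Ω → EuclideanSpace ℝ (Fin p)} (hY : Measurable Y)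
    {f : ℝ → EuclideanSpace ℝ (Fin p) → ℝ} (h : HasPolarDensity P Y f) : IsPolarDensity f := by
  refine ⟨h.nonneg, ?_⟩
  have hm : Measurable fun ω => (‖Y ω‖, direction (Y ω)) :=
    hY.norm.prodMk (measurable_direction.comp hY)
  have h1 : P.map (fun ω => (‖Y ω‖, direction (Y ω))) univ = 1 := by
    rw [Measure.map_apply hm MeasurableSet.univ, preimage_univ, measure_univ]
  rwa [h.law, withDensity_apply _ MeasurableSet.univ, Measure.restrict_univ] at h1

end Estimator

/-! ### The confidence interval for the deviation -/

theorem mainTheorem6 {Ω : Type*} [MeasurableSpace Ω] (P : Measure Ω) [IsProbabilityMeasure P]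
    (p : ℕ) (hp : 2 ≤ p)
    (Y : ℕ → Ω → EuclideanSpace ℝ (Fin p)) (hYmeas : ∀ i, Measurable (Y i))
    (hYindep : iIndepFun Y P)
    (f : ℝ → EuclideanSpace ℝ (Fin p) → ℝ) (hYdens : ∀ i, HasPolarDensity P (Y i) f)
    (hf : DensityAssumption f)
    (K : ℝ → ℝ) (hK : KernelAssumption K)
    (h κ : ℕ → ℝ) (hhpos : ∀ n, 0 < h n)
    (hκ : Tendsto κ atTop atTop) (hh : Tendsto h atTop (𝓝 0))
    (hvar : Tendsto (fun n : ℕ => κ n ^ (((p : ℝ) - 1) / 2) / (n * h n)) atTop (𝓝 0))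
    (hbias : Tendsto (fun n : ℕ => √(n : ℝ) / κ n + √(n : ℝ) * h n ^ 2) atTop (𝓝 0))
    (hM : 0 < sphericityDeviation f)
    (α : ℝ) (hα0 : 0 < α) (hα1 : α < 1) :
    Tendsto
      (fun n : ℕ => P.real {ω | sphericityDeviation f ∈
        jackknifeInterval K (h n) (κ n) α n (fun i => Y i ω)})
      atTop (𝓝 (1 - α)) := by
  have hd : IsPolarDensity f := (hYdens 0).isPolarDensity (hYmeas 0)
  have hP := isProbabilityMeasure_polarLaw hd
  obtain ⟨C, hC⟩ := exists_densityBounds hp hf hd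
  obtain ⟨D, hD0, hD⟩ := exists_dirichletForm_devPart_le hp hf hd hK
  obtain ⟨B, hB0, hB⟩ := exists_lintegral_deviationKernel_sq_le hp hf hd hK
  have hC0 := hC.pos
  have hYX : Measurable fun y : EuclideanSpace ℝ (Fin p) => (‖y‖, direction y) :=
    measurable_norm.prodMk measurable_direction
  have hh1 : ∀ᶠ n in atTop, h n ≤ 1 := by
    filter_upwards [hh.eventually_lt_const one_pos] with n hn using hn.le
  have hκ1 : ∀ᶠ n in atTop, 1 ≤ κ n := hκ.eventually_ge_atTop 1
  have hDn : ∀ᶠ n in atTop, dirichletForm (cylMeasure p) (smoothKernel p K (h n) (κ n)) (devPart f)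
      ≤ D * (h n ^ 2 + 1 / κ n) := by
    filter_upwards [hκ.eventually hD, hh1] with n hn hn1 using hn (h n) (hhpos n) hn1
  have hDn0 : ∀ᶠ n in atTop,
      0 ≤ dirichletForm (cylMeasure p) (smoothKernel p K (h n) (κ n)) (devPart f) := by
    filter_upwards [hκ1] with n hn
    have hQ := isReversibleKernel_smoothKernel hp hK (hhpos n) (zero_lt_one.trans_le hn)
    exact integral_nonneg fun z => mul_nonneg (hQ.nonneg z) (sq_nonneg _)
  have hband : Tendsto (fun n => h n ^ 2 + 1 / κ n) atTop (𝓝 0) := by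
    have := (hh.pow 2).add hκ.inv_tendsto_atTop
    simpa [one_div] using this
  have hint := integral_devPart_polarLaw hp hf hd
  have hmain := tendsto_jackknife_coverage (P := P) (ν := polarLaw f)
    (X := fun i ω => (‖Y i ω‖, direction (Y i ω)))
    (fun i => hYX.comp (hYmeas i)) (hYindep.comp _ fun _ => hYX)
    (fun i => (hYdens i).law.trans withDensity_polarMeasure)
    (H := fun n => deviationKernel p K (h n) (κ n))
    (fun n => measurable_deviationKernel hK _ _) (fun n => deviationKernel_symm hK _ _)
    (by
      filter_upwards [hκ1] with n hn using memLp_deviationKernel hp hf hd hK (hhpos n) hn)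
    (by
      have h1 : Tendsto (fun n : ℕ => B * (κ n ^ (((p : ℝ) - 1) / 2) / (n * h n))) atTop (𝓝 0) := by
        simpa using hvar.const_mul B
      refine squeeze_zero' (Eventually.of_forall fun n =>
        div_nonneg (integral_nonneg fun z => sq_nonneg _) (Nat.cast_nonneg n)) ?_ h1
      filter_upwards [hκ1] with n hn
      have h2 := hB (κ n) hn (h n) (hhpos n)
      have hκn : 0 < κ n := by linarith
      have hhn := hhpos n
      rw [integral_eq_lintegral_of_nonneg_ae (Eventually.of_forall fun z => sq_nonneg _)
        ((measurable_deviationKernel hK _ _).pow_const 2).aestronglyMeasurable]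
      have h3 := ENNReal.toReal_le_of_le_ofReal (by positivity) h2
      refine (div_le_div_of_nonneg_right h3 (Nat.cast_nonneg n)).trans (le_of_eq ?_)
      rw [mul_div_assoc, div_div, mul_comm (h n)])
    (measurable_devPart hf) (memLp_devPart hp hf hd)
    (by
      have h1 : Tendsto (fun n => C * (D * (h n ^ 2 + 1 / κ n))) atTop (𝓝 0) := by
        simpa using (hband.const_mul D).const_mul C
      refine squeeze_zero' (Eventually.of_forall fun n => integral_nonneg fun z => sq_nonneg _) ?_ h1
      filter_upwards [hκ1, hDn] with n hn hn2
      exact (integral_hajekProj_sub_sq_le hp hf hd hC hK (hhpos n)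
        (zero_lt_one.trans_le hn)).trans (mul_le_mul_of_nonneg_left hn2 hC0.le))
    (by
      have h1 : Tendsto (fun n : ℕ => D * (√(n : ℝ) / κ n + √(n : ℝ) * h n ^ 2)) atTop (𝓝 0) := by
        simpa using hbias.const_mul D
      refine squeeze_zero_norm' ?_ h1
      filter_upwards [hκ1, hDn, hDn0] with n hn hn2 hn0
      rw [integral_hajekProj_sub hp hf hd hK (hhpos n) (zero_lt_one.trans_le hn), norm_mul, norm_neg,
        Real.norm_of_nonneg (Real.sqrt_nonneg _), Real.norm_of_nonneg (by positivity)]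
      calc _ ≤ √(n : ℝ) * (D * (h n ^ 2 + 1 / κ n)) :=
            mul_le_mul_of_nonneg_left (by linarith) (Real.sqrt_nonneg _)
        _ = _ := by ring)
    (variance_devPart_pos hp hf hd hM)
    (V := fun n ω => jackknifeVariance K (h n) (κ n) n fun i => Y i ω)
    (fun n hn ω => jackknifeVariance_eq hK _ _ hn _) hα0 hα1
  rw [hint] at hmain
  simp only [jackknifeInterval, deviationEstimator_eq_uStat]
  exact hmain
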